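/- Let $\Omega\subset\mathbb R^2$ be a bounded, simply connected (in particular non-empty and connected) open set with $C^2$-smooth boundary, i.e. near each boundary point, after a rigid motion of the coordinates, $\Omega$ is the region strictly below the graph of a $C^2$ function of one variable. Put $\Omega^{\mathrm{ext}}:=\mathbb R^2\setminus\overline\Omega$, let $\gamma\in\mathbb R$ and $\tau\ge 0$, and let $\sigma$ be the arc-length measure on $\partial\Omega$. Consider in the complex Hilbert space $L^2(\Omega^{\mathrm{ext}})$ the quadratic form $$\mathfrak h_{\tau,\gamma}[u]=\int_{\Omega^{\mathrm{ext}}}\big(|\nabla\partial_1u|^2+|\nabla\partial_2u|^2+\tau|\nabla u|^2\big)\,dx+\gamma\int_{\partial\Omega}|u|^2\,d\sigma,\qquad \operatorname{dom}\mathfrak h_{\tau,\gamma}=H^2(\Omega^{\mathrm{ext}}),$$ where $u|_{\partial\Omega}$ is understood in the sense of traces, and write $\mathfrak h_{\tau,\gamma}[u,v]$ for the corresponding sesquilinear form, linear in $u$. Let $\mathsf H_{\tau,\gamma}$ be the perturbed Robin bi-Laplacian, i.e. the operator in $L^2(\Omega^{\mathrm{ext}})$ associated with this form: $u\in\operatorname{dom}\mathsf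 H_{\tau,\gamma}$ and $\mathsf H_{\tau,\gamma}u=f$ if and only if $u\in H^2(\Omega^{\mathrm{ext}})$, $f\in L^2(\Omega^{\mathrm{ext}})$ and $\mathfrak h_{\tau,\gamma}[u,v]=(f,v)_{L^2(\Omega^{\mathrm{ext}})}$ for all $v\in H^2(\Omega^{\mathrm{ext}})$. Then $\mathsf H_{\tau,\gamma}$ is self-adjoint and $$\sigma_{\mathrm{ess}}(\mathsf H_{\tau,\gamma})=[0,\infty).$$ Here $\sigma_{\mathrm{ess}}$ denotes the spectrum with the discrete spectrum removed, and the discrete spectrum consists of the eigenvalues of finite multiplicity that are isolated points of the spectrum. -/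

import Mathlib

open MeasureTheory Set Filter Topology
open scoped ContDiff ENNReal

namespace RobinBiLaplacian

/-! ### Planar domains -/

/-- The Euclidean plane. -/
abbrev Plane : Type := EuclideanSpace ℝ (Fin 2)

/-- The set `Ω` has a `C²` boundary: near each of its boundary points, and after a rigid motion
`Φ` (a rotation or reflection) of the coordinates, it is the region strictly below the graph of a
`C²` function `h` of one variable. -/
def HasC2Boundary (Ω : Set Plane) : Prop :=
  ∀ x ∈ frontier Ω, ∃ r > 0, ∃ (Φ : Plane ≃ₗᵢ[ℝ] Plane) (h : ℝ → ℝ), ContDiff ℝ 2 h ∧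
    ∀ y ∈ Metric.ball x r, (y ∈ Ω ↔ (Φ y) 1 < h ((Φ y) 0))

/-- The exterior `Ω^ext = ℝ² \ closure Ω`. -/
abbrev extDomain (Ω : Set Plane) : Set Plane := (closure Ω)ᶜ

/-! ### The Sobolev space `H²` -/

/-- The Hilbert space `L²(U)` of complex-valued functions. -/
abbrev L2 (U : Set Plane) : Type := Lp ℂ 2 (volume.restrict U)

/-- The classical partial derivative `∂ᵢ φ`. -/
noncomputable def pderiv {F : Type*} [NormedAddCommGroup F] [NormedSpace ℝ F]
    (i : Fin 2) (φ : Plane → F) (x : Plane) : F :=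
  fderiv ℝ φ x (EuclideanSpace.single i 1)

/-- `v` is the weak partial derivative `∂ᵢ u` in the open set `U`. -/
def IsWeakPartial (U : Set Plane) (i : Fin 2) (u v : L2 U) : Prop :=
  ∀ φ : Plane → ℝ, ContDiff ℝ ∞ φ → HasCompactSupport φ → tsupport φ ⊆ U →
    ∫ x in U, pderiv i φ x • u x = - ∫ x in U, φ x • v x

/-- The labels of `u`, of `∂ᵢ u`, and of `∂ⱼ ∂ᵢ u`. -/
abbrev Jet : Type := Unit ⊕ (Fin 2 ⊕ (Fin 2 × Fin 2))

theorem integrable_smul_L2 {U : Set Plane} {φ : Plane → ℝ} (hφ : Continuous φ)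
    (hc : HasCompactSupport φ) (u : L2 U) :
    Integrable (fun x => φ x • u x) (volume.restrict U) := by
  have h1 : MemLp φ 2 (volume.restrict U) := (hφ.memLp_of_hasCompactSupport hc).restrict U
  exact memLp_one_iff_integrable.1 ((Lp.memLp u).smul (r := 1) h1)

theorem continuous_pderiv {F : Type*} [NormedAddCommGroup F] [NormedSpace ℝ F] {φ : Plane → F}
    (hφ : ContDiff ℝ ∞ φ) (i : Fin 2) : Continuous (pderiv i φ) :=
  (hφ.continuous_fderiv (by simp)).clm_apply continuous_const

theorem contDiff_pderiv {F : Type*} [NormedAddCommGroup F] [NormedSpace ℝ F] {φ : Plane → F}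
    (hφ : ContDiff ℝ ∞ φ) (i : Fin 2) : ContDiff ℝ ∞ (pderiv i φ) :=
  (hφ.fderiv_right (by simp)).clm_apply contDiff_const

theorem hasCompactSupport_pderiv {F : Type*} [NormedAddCommGroup F] [NormedSpace ℝ F]
    {φ : Plane → F} (hφ : HasCompactSupport φ) (i : Fin 2) : HasCompactSupport (pderiv i φ) :=
  hφ.fderiv_apply (𝕜 := ℝ) _

theorem pderiv_add {F : Type*} [NormedAddCommGroup F] [NormedSpace ℝ F] {φ ψ : Plane → F}
    (hφ : ContDiff ℝ ∞ φ) (hψ : ContDiff ℝ ∞ ψ) (i : Fin 2) :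
    pderiv i (φ + ψ) = pderiv i φ + pderiv i ψ := by
  funext x
  simp only [pderiv, Pi.add_apply]
  rw [fderiv_add (hφ.differentiable (by simp) x) (hψ.differentiable (by simp) x)]
  rfl

theorem pderiv_smul {φ : Plane → ℂ}
    (hφ : ContDiff ℝ ∞ φ) (c : ℂ) (i : Fin 2) :
    pderiv i (c • φ) = c • pderiv i φ := by
  funext x
  simp only [pderiv, Pi.smul_apply]
  rw [fderiv_const_smul (hφ.differentiable (by simp) x)]
  rfl

theorem IsWeakPartial.zero (U : Set Plane) (i : Fin 2) : IsWeakPartial U i 0 0 := by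
  intro φ _ _ _
  have h : ∀ ψ : Plane → ℝ, ∫ x in U, ψ x • (0 : L2 U) x = 0 := by
    intro ψ
    refine integral_eq_zero_of_ae ?_
    filter_upwards [Lp.coeFn_zero ℂ 2 (volume.restrict U)] with x hx
    rw [hx]
    simp
  rw [h, h, neg_zero]

theorem IsWeakPartial.add {U : Set Plane} {i : Fin 2} {u v u' v' : L2 U}
    (h : IsWeakPartial U i u v) (h' : IsWeakPartial U i u' v') :
    IsWeakPartial U i (u + u') (v + v') := by
  intro φ h1 h2 h3
  have key : ∀ ψ : Plane → ℝ, Continuous ψ → HasCompactSupport ψ → ∀ a b : L2 U,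
      ∫ x in U, ψ x • (a + b : L2 U) x = (∫ x in U, ψ x • a x) + ∫ x in U, ψ x • b x := by
    intro ψ hψ hc a b
    rw [← integral_add (integrable_smul_L2 hψ hc a) (integrable_smul_L2 hψ hc b)]
    refine integral_congr_ae ?_
    filter_upwards [Lp.coeFn_add a b] with x hx
    rw [hx, Pi.add_apply, smul_add]
  rw [key _ (continuous_pderiv h1 i) (hasCompactSupport_pderiv h2 i),
    key _ h1.continuous h2, h φ h1 h2 h3, h' φ h1 h2 h3, neg_add]

theorem IsWeakPartial.smul {U : Set Plane} {i : Fin 2} {u v : L2 U} (c : ℂ)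
    (h : IsWeakPartial U i u v) : IsWeakPartial U i (c • u) (c • v) := by
  intro φ h1 h2 h3
  have key : ∀ ψ : Plane → ℝ, ∀ a : L2 U,
      ∫ x in U, ψ x • (c • a : L2 U) x = c * ∫ x in U, ψ x • a x := by
    intro ψ a
    rw [← integral_const_mul]
    refine integral_congr_ae ?_
    filter_upwards [Lp.coeFn_smul c a] with x hx
    rw [hx]
    simp only [Pi.smul_apply, Complex.real_smul, smul_eq_mul]
    ring
  rw [key, key, h φ h1 h2 h3, mul_neg]

/-- The Sobolev space `H²(U)`: an element is a function `u ∈ L²(U)` together with its weak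
derivatives `∂ᵢ u ∈ L²(U)` and `∂ⱼ ∂ᵢ u ∈ L²(U)` (which `u` determines). As a subspace of a finite
Hilbert sum of copies of `L²(U)` it carries the norm
`‖u‖² = ‖u‖²_{L²} + ∑ᵢ ‖∂ᵢ u‖²_{L²} + ∑ᵢⱼ ‖∂ⱼ ∂ᵢ u‖²_{L²}`. -/
noncomputable def H2 (U : Set Plane) : Submodule ℂ (PiLp 2 (fun _ : Jet => L2 U)) where
  carrier := {w | (∀ i, IsWeakPartial U i (w (.inl ())) (w (.inr (.inl i)))) ∧
    ∀ i j, IsWeakPartial U j (w (.inr (.inl i))) (w (.inr (.inr (i, j))))}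
  zero_mem' := ⟨fun i => IsWeakPartial.zero U i, fun _ j => IsWeakPartial.zero U j⟩
  add_mem' := fun ha hb =>
    ⟨fun i => (ha.1 i).add (hb.1 i), fun i j => (ha.2 i j).add (hb.2 i j)⟩
  smul_mem' := fun c _ ha => ⟨fun i => (ha.1 i).smul c, fun i j => (ha.2 i j).smul c⟩

/-- `u` itself, as a function in `L²(U)`. -/
noncomputable def H2.val {U : Set Plane} (u : H2 U) : L2 U := u.1 (.inl ())

/-- The weak derivative `∂ᵢ u`. -/
noncomputable def H2.d {U : Set Plane} (i : Fin 2) (u : H2 U) : L2 U := u.1 (.inr (.inl i))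

/-- The weak derivative `∂ⱼ ∂ᵢ u`. -/
noncomputable def H2.dd {U : Set Plane} (j i : Fin 2) (u : H2 U) : L2 U :=
  u.1 (.inr (.inr (i, j)))

/-! ### The trace on the boundary -/

/-- The arc length measure `σ` on `∂Ω`: the one-dimensional Hausdorff measure on `∂Ω`. -/
noncomputable def arcLength (Ω : Set Plane) : Measure Plane :=
  (Measure.hausdorffMeasure 1 : Measure Plane).restrict (frontier Ω)

/-- The Hilbert space `L²(∂Ω)`. -/
abbrev L2Boundary (Ω : Set Plane) : Type := Lp ℂ 2 (arcLength Ω)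

/-- The space `C_c^∞(ℝ²)`. The third condition, square-integrability on `∂Ω`, is automatic as soon
as `∂Ω` has finite length, which is the case for a bounded set with `C²` boundary. -/
def testFun (Ω : Set Plane) : Submodule ℂ (Plane → ℂ) where
  carrier := {φ | ContDiff ℝ ∞ φ ∧ HasCompactSupport φ ∧ MemLp φ 2 (arcLength Ω)}
  zero_mem' := ⟨contDiff_const, HasCompactSupport.zero, MemLp.zero⟩
  add_mem' := fun ha hb => ⟨ha.1.add hb.1, ha.2.1.add hb.2.1, ha.2.2.add hb.2.2⟩
  smul_mem' := fun c _ ha => ⟨ha.1.const_smul c, ha.2.1.smul_left (f := fun _ => c),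
    ha.2.2.const_smul c⟩

theorem memLp_of_test {U : Set Plane} {φ : Plane → ℂ} (h : ContDiff ℝ ∞ φ)
    (hc : HasCompactSupport φ) : MemLp φ 2 (volume.restrict U) :=
  (h.continuous.memLp_of_hasCompactSupport hc).restrict U

/-- The classical partial derivative of a function in `C_c^∞(ℝ²)` is its weak one. -/
theorem isWeakPartial_classical {U : Set Plane} {φ : Plane → ℂ} (h : ContDiff ℝ ∞ φ)
    (hc : HasCompactSupport φ) (i : Fin 2) :
    IsWeakPartial U i (memLp_of_test (U := U) h hc).toLp
      (memLp_of_test (U := U) (contDiff_pderiv h i) (hasCompactSupport_pderiv hc i)).toLp := by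
  intro ψ h1 h2 h3
  have key : ∀ (η : Plane → ℝ) (f : Plane → ℂ) (hf : MemLp f 2 (volume.restrict U)),
      tsupport η ⊆ U → ∫ x in U, η x • (hf.toLp : L2 U) x = ∫ x, η x • f x := by
    intro η f hf hη
    rw [← setIntegral_eq_integral_of_forall_compl_eq_zero (μ := volume) (s := U)
      (f := fun x => η x • f x)]
    · refine integral_congr_ae ?_
      filter_upwards [hf.coeFn_toLp] with x hx
      rw [hx]
    · intro x hx
      rw [image_eq_zero_of_notMem_tsupport (fun hx' => hx (hη hx')), zero_smul]
  have hsub : tsupport (pderiv i ψ) ⊆ U :=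
    (tsupport_fderiv_apply_subset ℝ (EuclideanSpace.single i 1)).trans h3
  rw [key _ _ _ hsub, key _ _ _ h3, eq_comm, neg_eq_iff_eq_neg]
  refine integral_smul_fderiv_eq_neg_fderiv_smul_of_integrable (𝕜 := ℝ) ?_ ?_ ?_
    (fun x _ => h1.differentiable (by simp) x) (fun x _ => h.differentiable (by simp) x)
  · exact ((continuous_pderiv h1 i).smul h.continuous).integrable_of_hasCompactSupport
      (hasCompactSupport_pderiv h2 i).smul_right
  · exact (h1.continuous.smul (continuous_pderiv h i)).integrable_of_hasCompactSupport
      h2.smul_right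
  · exact (h1.continuous.smul h.continuous).integrable_of_hasCompactSupport h2.smul_right

/-- The element of `H²(U)` given by the restriction to `U` of a function in `C_c^∞(ℝ²)`. -/
noncomputable def toH2 (U : Set Plane) {φ : Plane → ℂ} (h : ContDiff ℝ ∞ φ)
    (hc : HasCompactSupport φ) : H2 U :=
  ⟨WithLp.toLp 2 (fun k : Jet => match k with
    | .inl _ => (memLp_of_test (U := U) h hc).toLp
    | .inr (.inl i) =>
        (memLp_of_test (U := U) (contDiff_pderiv h i) (hasCompactSupport_pderiv hc i)).toLp
    | .inr (.inr (i, j)) =>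
        (memLp_of_test (U := U) (contDiff_pderiv (contDiff_pderiv h i) j)
          (hasCompactSupport_pderiv (hasCompactSupport_pderiv hc i) j)).toLp),
    fun i => isWeakPartial_classical h hc i,
    fun i j => isWeakPartial_classical (contDiff_pderiv h i) (hasCompactSupport_pderiv hc i) j⟩

/-- The restriction map `C_c^∞(ℝ²) → H²(Ω^ext)`. -/
noncomputable def restrictExt (Ω : Set Plane) : testFun Ω →ₗ[ℂ] H2 (extDomain Ω) where
  toFun φ := toH2 (extDomain Ω) φ.2.1 φ.2.2.1
  map_add' := by
    rintro ⟨φ, h, hc, _⟩ ⟨ψ, h', hc', _⟩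
    refine Subtype.ext (PiLp.ext fun k => ?_)
    rcases k with _ | i | ⟨i, j⟩
    · rfl
    · exact MemLp.toLp_congr (memLp_of_test (contDiff_pderiv (h.add h') i)
        (hasCompactSupport_pderiv (hc.add hc') i)) ((memLp_of_test (contDiff_pderiv h i)
        (hasCompactSupport_pderiv hc i)).add (memLp_of_test (contDiff_pderiv h' i)
        (hasCompactSupport_pderiv hc' i))) (EventuallyEq.of_eq (pderiv_add h h' i))
    · exact MemLp.toLp_congr
        (memLp_of_test (contDiff_pderiv (contDiff_pderiv (h.add h') i) j)
        (hasCompactSupport_pderiv (hasCompactSupport_pderiv (hc.add hc') i) j))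
        ((memLp_of_test (contDiff_pderiv (contDiff_pderiv h i) j)
        (hasCompactSupport_pderiv (hasCompactSupport_pderiv hc i) j)).add
        (memLp_of_test (contDiff_pderiv (contDiff_pderiv h' i) j)
        (hasCompactSupport_pderiv (hasCompactSupport_pderiv hc' i) j)))
        (EventuallyEq.of_eq ((congrArg (pderiv j) (pderiv_add h h' i)).trans
          (pderiv_add (contDiff_pderiv h i) (contDiff_pderiv h' i) j)))
  map_smul' := by
    rintro c ⟨φ, h, hc, _⟩
    refine Subtype.ext (PiLp.ext fun k => ?_)
    rcases k with _ | i | ⟨i, j⟩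
    · rfl
    · exact MemLp.toLp_congr (memLp_of_test (contDiff_pderiv (h.const_smul c) i)
        (hasCompactSupport_pderiv (hc.smul_left (f := fun _ => c)) i))
        ((memLp_of_test (contDiff_pderiv h i) (hasCompactSupport_pderiv hc i)).const_smul c) (EventuallyEq.of_eq (pderiv_smul h c i))
    · exact MemLp.toLp_congr
        (memLp_of_test (contDiff_pderiv (contDiff_pderiv (h.const_smul c) i) j)
        (hasCompactSupport_pderiv (hasCompactSupport_pderiv (hc.smul_left (f := fun _ => c)) i) j))
        ((memLp_of_test (contDiff_pderiv (contDiff_pderiv h i) j)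
        (hasCompactSupport_pderiv (hasCompactSupport_pderiv hc i) j)).const_smul c)
        (EventuallyEq.of_eq ((congrArg (pderiv j) (pderiv_smul h c i)).trans
          (pderiv_smul (contDiff_pderiv h i) c j)))

/-- The restriction map `C_c^∞(ℝ²) → L²(∂Ω)`. -/
noncomputable def restrictBoundary (Ω : Set Plane) : testFun Ω →ₗ[ℂ] L2Boundary Ω where
  toFun φ := φ.2.2.2.toLp
  map_add' _ _ := rfl
  map_smul' _ _ := rfl

/-- The trace map `H²(Ω^ext) → L²(∂Ω)`, `u ↦ u|_{∂Ω}`: the unique continuous linear map that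
sends the restriction to `Ω^ext` of each `φ ∈ C_c^∞(ℝ²)` to the restriction of `φ` to `∂Ω`. (It
exists by the trace theorem and by the density of these functions in `H²(Ω^ext)`.) -/
noncomputable def trace (Ω : Set Plane) : H2 (extDomain Ω) →L[ℂ] L2Boundary Ω :=
  (restrictBoundary Ω).extendOfNorm (restrictExt Ω)

/-! ### The operator -/

/-- The sesquilinear form on `H²(Ω^ext)`, linear in `u` and antilinear in `v`, whose quadratic form
is `∫_{Ω^ext} (|∇∂₁u|² + |∇∂₂u|² + τ |∇u|²) dx + γ ∫_{∂Ω} |u|² dσ`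
(the inner products of Mathlib are antilinear in the first argument). -/
noncomputable def robinForm (Ω : Set Plane) (τ γ : ℝ) (u v : H2 (extDomain Ω)) : ℂ :=
  (∑ i, ∑ j, inner ℂ (H2.dd j i v) (H2.dd j i u)) + (τ : ℂ) * (∑ i, inner ℂ (H2.d i v) (H2.d i u))
    + (γ : ℂ) * inner ℂ (trace Ω v) (trace Ω u)

/-- The graph of the operator associated with the form by the first representation theorem: `u`
is in the domain, with image `f`, if `u` is in the form domain `H²(Ω^ext)` and `h[u, v] = (f, v)`
for all `v` in the form domain. -/
noncomputable def robinGraph (Ω : Set Plane) (τ γ : ℝ) :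
    Submodule ℂ (L2 (extDomain Ω) × L2 (extDomain Ω)) where
  carrier := {p | ∃ u : H2 (extDomain Ω), H2.val u = p.1 ∧
    ∀ v : H2 (extDomain Ω), robinForm Ω τ γ u v = inner ℂ (H2.val v) p.2}
  zero_mem' := ⟨0, rfl, fun v => by
    have h1 : ∀ i j, H2.dd j i (0 : H2 (extDomain Ω)) = 0 := fun _ _ => rfl
    have h2 : ∀ i, H2.d i (0 : H2 (extDomain Ω)) = 0 := fun _ => rfl
    simp [robinForm, h1, h2]⟩
  add_mem' := by
    rintro p q ⟨u, hu, hu'⟩ ⟨w, hw, hw'⟩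
    refine ⟨u + w, by rw [Prod.fst_add, ← hu, ← hw]; rfl, fun v => ?_⟩
    have h1 : ∀ i j, H2.dd j i (u + w) = H2.dd j i u + H2.dd j i w := fun _ _ => rfl
    have h2 : ∀ i, H2.d i (u + w) = H2.d i u + H2.d i w := fun _ => rfl
    rw [Prod.snd_add, inner_add_right, ← hu', ← hw']
    simp only [robinForm, h1, h2, map_add, inner_add_right, Finset.sum_add_distrib]
    ring
  smul_mem' := by
    rintro c p ⟨u, hu, hu'⟩
    refine ⟨c • u, by rw [Prod.smul_fst, ← hu]; rfl, fun v => ?_⟩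
    have h1 : ∀ i j, H2.dd j i (c • u) = c • H2.dd j i u := fun _ _ => rfl
    have h2 : ∀ i, H2.d i (c • u) = c • H2.d i u := fun _ => rfl
    rw [Prod.smul_snd, inner_smul_right, ← hu']
    simp only [robinForm, h1, h2, map_smul, inner_smul_right, ← Finset.mul_sum]
    ring

/-- The perturbed Robin bi-Laplacian in `L²(Ω^ext)` with boundary parameter `γ` and tension
parameter `τ`, as an unbounded operator. -/
noncomputable def robinBilaplacian (Ω : Set Plane) (τ γ : ℝ) : L2 (extDomain Ω) →ₗ.[ℂ] L2 (extDomain Ω) :=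
  (robinGraph Ω τ γ).toLinearPMap

/-! ### Spectra of unbounded operators -/

section Spectrum

variable {E : Type*} [NormedAddCommGroup E] [InnerProductSpace ℂ E]

/-- The spectrum of an unbounded operator `A`: the complement of the set of the `z` for which
`A - z : dom A → E` is bijective with a bounded inverse `R`. -/
def spectrum (A : E →ₗ.[ℂ] E) : Set ℂ :=
  {z | ∃ R : E →L[ℂ] E,
    (∀ f : E, ∃ u : A.domain, (u : E) = R f ∧ A u - z • (u : E) = f) ∧
    ∀ u : A.domain, R (A u - z • (u : E)) = u}ᶜ

/-- The eigenspace `ker (A - z)`, as a subspace of the domain. -/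
def eigenspace (A : E →ₗ.[ℂ] E) (z : ℂ) : Submodule ℂ A.domain :=
  LinearMap.ker (A.toFun - z • A.domain.subtype)

/-- The discrete spectrum: the eigenvalues of finite multiplicity that are isolated points of the
spectrum. -/
def discreteSpectrum (A : E →ₗ.[ℂ] E) : Set ℂ :=
  {z | z ∈ spectrum A ∧ (∃ ε > 0, ∀ w ∈ spectrum A, dist w z < ε → w = z) ∧
    eigenspace A z ≠ ⊥ ∧ FiniteDimensional ℂ (eigenspace A z)}

/-- The essential spectrum of a self-adjoint operator: the spectrum without the discrete one. -/
def essentialSpectrum (A : E →ₗ.[ℂ] E) : Set ℂ := spectrum A \ discreteSpectrum A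

end Spectrum

end RobinBiLaplacian

/-! On the Hilbert space `V = H²(Ω^ext)` the form is `⟪v, B u⟫` with `B` bounded and self-adjoint.
With `J : V → L²` the inclusion, the operator sends `J u` to `f` exactly when `B u = J† f`. The
abstract part needs only the Gårding inequality of `FormData`: for each `δ > 0` the form plus `δ‖J
u‖²` plus `‖P (J u)‖²` is coercive on `V`, for some `P` of finite rank. Absorbing `P` into the `L²`
norm makes a real shift of the form coercive, and Lax–Milgram then gives a real point of the
resolvent set and self-adjointness. Keeping `P` apart gives more. For `l < 0` the operator `B - l
J†J` is a finite-rank perturbation of an invertible one, so `l` is in the resolvent set or is an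
eigenvalue; and `P ∘ J` is injective on the span of the eigenvectors with eigenvalue at most `-δ`,
so these eigenvalues are finite in number and of finite multiplicity. Hence the negative spectrum is
discrete.

The Gårding inequality rests on two estimates, proved for test functions and extended by density
(`denseRange_restrictExt`). `exists_gradSq_le` bounds the gradient by the function and its Hessian,
through a one-dimensional inequality along two independent short segments inside the exterior.
`exists_trace_le` bounds the trace by an arbitrarily small multiple of the gradient plus a
finite-rank term: boundary values are compared with values on a compact set slightly off the
boundary, where averages over small squares suffice by Poincaré's inequality. It plays the role of
compactness of the trace. The same estimates show that `trace`, defined by extension, restricts test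
functions as it should.

Conversely, each `l ≥ 0` is in the spectrum: with `k⁴ + τk² = l`, a plane wave of frequency `k`
times a slowly varying bump supported away from `closure Ω` has zero trace and a relatively small
residual (`exists_singular_sequence`). As `[0, ∞)` has no isolated points, none of its points is
discrete. -/

namespace RobinBiLaplacian

/-! ### Operators associated with semibounded forms -/

section FormOperator

open ContinuousLinearMap

variable {V H : Type*} [NormedAddCommGroup V] [InnerProductSpace ℂ V] [CompleteSpace V]
  [NormedAddCommGroup H] [InnerProductSpace ℂ H] [CompleteSpace H]

/-- The form `v, u ↦ ⟪v, B u⟫` on `V` with an abstract Gårding inequality: it is coercive up to an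
arbitrarily small multiple of the norm of `H` and a form of finite rank. The operator in `H`
associated with the form has graph `g`. -/
structure FormData (J : V →L[ℂ] H) (B : V →L[ℂ] V) (g : Submodule ℂ (H × H)) : Prop where
  injective : Function.Injective J
  denseRange : DenseRange J
  isSelfAdjoint : IsSelfAdjoint B
  mem_graph : ∀ p : H × H, p ∈ g ↔ ∃ u, J u = p.1 ∧ B u = adjoint J p.2
  garding : ∀ δ > (0 : ℝ), ∃ c > (0 : ℝ), ∃ (n : ℕ) (P : H →L[ℂ] EuclideanSpace ℂ (Fin n)),
    ∀ u, c * ‖u‖ ^ 2 ≤ (inner ℂ (B u) u).re + δ * ‖J u‖ ^ 2 + ‖P (J u)‖ ^ 2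

namespace FormData

variable {J : V →L[ℂ] H} {B : V →L[ℂ] V} {g : Submodule ℂ (H × H)}

/-- The operator `B - z J†J` on the form domain. -/
noncomputable def shift (J : V →L[ℂ] H) (B : V →L[ℂ] V) (z : ℂ) : V →L[ℂ] V :=
  B - z • (adjoint J ∘L J)

theorem shift_apply (z : ℂ) (u : V) : shift J B z u = B u - z • adjoint J (J u) := rfl

theorem isUnit_of_coercive (S : V →L[ℂ] V) {c : ℝ} (hc : 0 < c)
    (h : ∀ u, c * ‖u‖ ^ 2 ≤ ‖inner ℂ (S u) u‖) : IsUnit S := by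
  refine isUnit_of_forall_le_norm_inner_map S (c := ⟨c, hc.le⟩) hc fun u => ?_
  rw [mul_comm]
  exact h u

theorem inner_shift (z : ℂ) (u : V) :
    inner ℂ (shift J B z u) u = inner ℂ (B u) u - (starRingEnd ℂ z) * (‖J u‖ ^ 2 : ℝ) := by
  rw [shift_apply, inner_sub_left, inner_smul_left, adjoint_inner_left,
    inner_self_eq_norm_sq_to_K]
  simp

theorem inner_self_im (hB : IsSelfAdjoint B) (u : V) : (inner ℂ (B u) u).im = 0 := by
  have h := hB.isSymmetric u u
  have h2 : (starRingEnd ℂ) (inner ℂ (B u) u) = inner ℂ (B u) u := by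
    rw [inner_conj_symm]; exact h.symm
  exact Complex.conj_eq_iff_im.1 h2

theorem adjoint_injective (D : FormData J B g) : Function.Injective (adjoint J) := by
  refine (injective_iff_map_eq_zero _).2 fun f hf => ?_
  refine D.denseRange.eq_zero_of_inner_left ℂ fun u => ?_
  rw [← adjoint_inner_left, hf, inner_zero_left]

/-- The finite-rank term is bounded by `‖P‖² ‖J u‖²` and joins the multiple of the norm of `H`. -/
theorem exists_coercive_shift (D : FormData J B g) : ∃ c > (0 : ℝ), ∃ a > (0 : ℝ), ∀ u,
    a * ‖u‖ ^ 2 ≤ (inner ℂ (B u) u).re + c * ‖J u‖ ^ 2 := by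
  obtain ⟨a, ha, n, P, h⟩ := D.garding 1 one_pos
  refine ⟨1 + ‖P‖ ^ 2, by positivity, a, ha, fun u => (h u).trans ?_⟩
  have h1 : ‖P (J u)‖ ^ 2 ≤ (‖P‖ * ‖J u‖) ^ 2 := by gcongr; exact P.le_opNorm _
  nlinarith

/-- Single-valuedness of the relation `g`, from injectivity of `J` and of `J†`. Only with it does
`g.toLinearPMap` have graph `g`. -/
theorem snd_eq_zero (D : FormData J B g) (x : H × H) (hx : x ∈ g) (h0 : x.1 = 0) : x.2 = 0 := by
  obtain ⟨u, hu, hu'⟩ := (D.mem_graph x).1 hx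
  have : u = 0 := D.injective (by rw [hu, h0, map_zero])
  rw [this, map_zero] at hu'
  exact D.adjoint_injective (by rw [← hu', map_zero])

theorem mem_graph_apply (D : FormData J B g) (u : g.toLinearPMap.domain) :
    ((u : H), g.toLinearPMap u) ∈ g :=
  Submodule.mem_graph_toLinearPMap D.snd_eq_zero u

theorem exists_domain (D : FormData J B g) {x y : H} (h : (x, y) ∈ g) :
    ∃ u : g.toLinearPMap.domain, (u : H) = x ∧ g.toLinearPMap u = y := by
  rw [← Submodule.toLinearPMap_graph_eq g D.snd_eq_zero] at h
  exact (LinearPMap.mem_graph_iff _).1 h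

theorem exists_shift_eq (D : FormData J B g) (z : ℂ) (u : g.toLinearPMap.domain) :
    ∃ v, J v = u ∧ shift J B z v = adjoint J (g.toLinearPMap u - z • (u : H)) := by
  obtain ⟨v, hv, hv'⟩ := (D.mem_graph _).1 (D.mem_graph_apply u)
  refine ⟨v, hv, ?_⟩
  dsimp only at hv hv'
  rw [shift_apply, hv', map_sub, map_smul, hv]

theorem mem_graph_of_shift_eq (D : FormData J B g) {z : ℂ} {v : V} {f : H}
    (h : shift J B z v = adjoint J f) : (J v, f + z • J v) ∈ g := by
  refine (D.mem_graph _).2 ⟨v, rfl, ?_⟩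
  rw [map_add, ← h, shift_apply, map_smul, sub_add_cancel]

/-- The resolvent is `J ∘ S⁻¹ ∘ J†` with `S = B - z J†J`. This moves spectral questions about the
unbounded operator to the bounded operator `S` on the form domain. -/
theorem notMem_spectrum (D : FormData J B g) {z : ℂ} (h : IsUnit (shift J B z)) :
    z ∉ spectrum g.toLinearPMap := by
  obtain ⟨S, hS⟩ := h
  have h1 : ∀ v, shift J B z ((↑S⁻¹ : V →L[ℂ] V) v) = v := fun v => by
    rw [← hS]; exact congrArg (fun T : V →L[ℂ] V => T v) S.mul_inv
  have h2 : ∀ v, (↑S⁻¹ : V →L[ℂ] V) (shift J B z v) = v := fun v => by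
    rw [← hS]; exact congrArg (fun T : V →L[ℂ] V => T v) S.inv_mul
  rw [spectrum, Set.notMem_compl_iff]
  refine ⟨J ∘L (↑S⁻¹ : V →L[ℂ] V) ∘L adjoint J, fun f => ?_, fun u => ?_⟩
  · obtain ⟨u, hu, hu'⟩ := D.exists_domain (D.mem_graph_of_shift_eq (f := f) (h1 (adjoint J f)))
    refine ⟨u, hu, ?_⟩
    rw [hu', hu, add_sub_cancel_right]
  · obtain ⟨v, hv, hv'⟩ := D.exists_shift_eq z u
    simp only [comp_apply]
    rw [← hv', h2, hv]

/-- The imaginary part of the shifted form is `z.im * ‖J u‖²`, so it controls `‖J u‖²`; the real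
part plus a multiple of `‖J u‖²` controls `‖u‖²`. Together they give coercivity in absolute value.
-/
theorem isUnit_shift_of_im_ne_zero (D : FormData J B g) {z : ℂ} (hz : z.im ≠ 0) :
    IsUnit (shift J B z) := by
  obtain ⟨c, hc, a, ha, h⟩ := D.exists_coercive_shift
  have hz' : 0 < |z.im| := abs_pos.2 hz
  set K : ℝ := 1 + |c + z.re| / |z.im| with hK
  have hKpos : 0 < K := by positivity
  refine isUnit_of_coercive _ (c := a / K) (by positivity) fun u => ?_
  rw [inner_shift]
  set w := inner ℂ (B u) u - (starRingEnd ℂ z) * (‖J u‖ ^ 2 : ℝ) with hw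
  have hre : w.re = (inner ℂ (B u) u).re - z.re * ‖J u‖ ^ 2 := by
    rw [hw, Complex.sub_re, Complex.re_mul_ofReal, Complex.conj_re]
  have him : w.im = z.im * ‖J u‖ ^ 2 := by
    rw [hw, Complex.sub_im, Complex.im_mul_ofReal, Complex.conj_im,
      inner_self_im D.isSelfAdjoint]; ring
  have h1 : ‖J u‖ ^ 2 ≤ ‖w‖ / |z.im| := by
    rw [le_div_iff₀ hz']
    calc ‖J u‖ ^ 2 * |z.im| = |w.im| := by rw [him, abs_mul, abs_of_nonneg (sq_nonneg ‖J u‖)]; ring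
      _ ≤ ‖w‖ := Complex.abs_im_le_norm w
  have h2 : w.re ≤ ‖w‖ := Complex.re_le_norm w
  have h3 := h u
  rw [div_mul_eq_mul_div, div_le_iff₀ hKpos]
  calc a * ‖u‖ ^ 2 ≤ w.re + (c + z.re) * ‖J u‖ ^ 2 := by rw [hre]; linarith
    _ ≤ ‖w‖ + |c + z.re| * (‖w‖ / |z.im|) := by
        gcongr
        exact le_abs_self _
    _ = ‖w‖ * K := by rw [hK]; ring

theorem exists_coercive_shift_neg (D : FormData J B g) : ∃ c a : ℝ, 0 < a ∧
    ∀ u, a * ‖u‖ ^ 2 ≤ ‖inner ℂ (shift J B (-c : ℝ) u) u‖ := by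
  obtain ⟨c, hc, a, ha, h⟩ := D.exists_coercive_shift
  refine ⟨c, a, ha, fun u => (h u).trans ?_⟩
  refine le_trans (le_of_eq ?_) (Complex.re_le_norm _)
  rw [inner_shift, Complex.sub_re, Complex.re_mul_ofReal, Complex.conj_re, Complex.ofReal_re]
  ring

theorem isSelfAdjoint_shift (D : FormData J B g) (c : ℝ) : IsSelfAdjoint (shift J B c) := by
  have h2 : IsSelfAdjoint (adjoint J ∘L J) := by
    rw [isSelfAdjoint_iff', adjoint_comp, adjoint_adjoint]
  exact D.isSelfAdjoint.sub (IsSelfAdjoint.smul (by simp [isSelfAdjoint_iff]) h2)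

theorem inner_toLinearPMap (D : FormData J B g) (u v : g.toLinearPMap.domain) :
    inner ℂ (g.toLinearPMap u) (v : H) = inner ℂ (u : H) (g.toLinearPMap v) := by
  obtain ⟨a, ha, ha'⟩ := (D.mem_graph _).1 (D.mem_graph_apply u)
  obtain ⟨b, hb, hb'⟩ := (D.mem_graph _).1 (D.mem_graph_apply v)
  dsimp only at ha ha' hb hb'
  rw [← ha, ← hb, ← adjoint_inner_left, ← ha', ← adjoint_inner_right J, ← hb']
  exact D.isSelfAdjoint.isSymmetric a b

theorem exists_apply_eq (D : FormData J B g) {z : ℂ} (h : IsUnit (shift J B z)) (f : H) :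
    ∃ v, shift J B z v = adjoint J f ∧
      ∃ u : g.toLinearPMap.domain, (u : H) = J v ∧ g.toLinearPMap u = f + z • J v := by
  obtain ⟨v, hv⟩ := (isUnit_iff_bijective.1 h).2 (adjoint J f)
  exact ⟨v, hv, D.exists_domain (D.mem_graph_of_shift_eq hv)⟩

/-- Let `x` be orthogonal to the domain and let `v` solve `(B + c J†J) v = J† x`. Then `J v` is in
the domain, so the shifted form at `v` equals `⟪x, J v⟫ = 0`, and coercivity forces `v = 0`, hence
`x = 0`. -/
theorem dense_domain (D : FormData J B g) : Dense (g.toLinearPMap.domain : Set H) := by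
  rw [Submodule.dense_iff_topologicalClosure_eq_top, Submodule.topologicalClosure_eq_top_iff,
    Submodule.eq_bot_iff]
  intro x hx
  obtain ⟨c, a, ha, h⟩ := D.exists_coercive_shift_neg
  obtain ⟨v, hv, u, hu, -⟩ := D.exists_apply_eq (isUnit_of_coercive _ ha h) x
  have h0 : inner ℂ (shift J B (-c : ℝ) v) v = 0 := by
    rw [hv, adjoint_inner_left, ← hu]
    exact (Submodule.mem_orthogonal' _ _).1 hx u u.2
  have h1 := h v
  rw [h0, norm_zero] at h1
  have h2 : v = 0 := by
    have : ‖v‖ ^ 2 ≤ 0 := by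
      by_contra! h3
      have := mul_pos ha h3
      linarith
    exact norm_eq_zero.1 (pow_eq_zero_iff two_ne_zero |>.1 (le_antisymm this (sq_nonneg _)))
  rw [h2, map_zero] at hv
  exact D.adjoint_injective (by rw [← hv, map_zero])

/-- The operator associated with the form is self-adjoint. -/
theorem isSelfAdjoint_toLinearPMap (D : FormData J B g) : IsSelfAdjoint g.toLinearPMap := by
  have hle : g.toLinearPMap ≤ g.toLinearPMap.adjoint :=
    LinearPMap.IsFormalAdjoint.le_adjoint D.dense_domain D.inner_toLinearPMap
  rw [LinearPMap.isSelfAdjoint_def]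
  symm
  refine LinearPMap.eq_of_le_of_domain_eq hle (le_antisymm hle.1 fun y hy => ?_)
  obtain ⟨c, a, ha, hc⟩ := D.exists_coercive_shift_neg
  have hunit := isUnit_of_coercive _ ha hc
  set w := g.toLinearPMap.adjoint ⟨y, hy⟩ with hw
  have hadj : ∀ u : g.toLinearPMap.domain, inner ℂ w (u : H) = inner ℂ y (g.toLinearPMap u) :=
    fun u => LinearPMap.adjoint_isFormalAdjoint D.dense_domain ⟨y, hy⟩ u
  -- Here `w` is the adjoint's value at `y`, and `J v` is the resolvent at `-c` applied to `w + c
  -- y`. Since every `f` is `(A + c) u'` for some `u'` in the domain, testing against all `f`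
  -- identifies `y` with `J v`.
  obtain ⟨v, hv, u, hu, -⟩ := D.exists_apply_eq hunit (w + (c : ℂ) • y)
  suffices h : y = J v by rw [h, ← hu]; exact u.2
  refine ext_inner_right ℂ fun f => ?_
  obtain ⟨v', hv', u', hu', hf⟩ := D.exists_apply_eq hunit f
  have h1 : inner ℂ y f = inner ℂ (w + (c : ℂ) • y) (J v') := by
    have h2 : f = g.toLinearPMap u' + (c : ℂ) • (u' : H) := by
      rw [hf, hu']; push_cast; module
    rw [h2, inner_add_right, ← hadj, hu', inner_add_left, inner_smul_left, inner_smul_right,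
      Complex.conj_ofReal]
  rw [h1, ← adjoint_inner_left, ← hv, ← adjoint_inner_right J, ← hv']
  exact (D.isSelfAdjoint_shift (-c)).isSymmetric v v'

/-- Fredholm alternative. Gårding with `δ = -l` says that adding the finite-rank operator `K =
J†P†PJ` makes the shift coercive, hence an invertible `S`. The shift is then `S (1 - S⁻¹K)` with
`S⁻¹K` compact, and it fails to be invertible only if `1` is an eigenvalue of `S⁻¹K`. -/
theorem isUnit_shift_or_exists_eigenvector (D : FormData J B g) {l : ℝ} (hl : l < 0) :
    IsUnit (shift J B l) ∨ ∃ v ≠ 0, B v = (l : ℂ) • adjoint J (J v) := by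
  obtain ⟨c, hc, n, P, h⟩ := D.garding (-l) (by linarith)
  set K : V →L[ℂ] V := (adjoint J ∘L adjoint P) ∘L (P ∘L J) with hK
  have hKinner : ∀ u, inner ℂ (K u) u = (‖P (J u)‖ ^ 2 : ℝ) := fun u => by
    simp only [hK, comp_apply]
    rw [adjoint_inner_left, adjoint_inner_left, inner_self_eq_norm_sq_to_K]
    simp
  have hS : IsUnit (shift J B l + K) := by
    refine isUnit_of_coercive _ hc fun u => (h u).trans ?_
    refine le_trans (le_of_eq ?_) (Complex.re_le_norm _)
    rw [add_apply, inner_add_left, inner_shift, hKinner, Complex.add_re, Complex.sub_re,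
      Complex.re_mul_ofReal, Complex.conj_re, Complex.ofReal_re, Complex.ofReal_re]
    ring
  obtain ⟨S, hS⟩ := hS
  have hKc : IsCompactOperator ((↑S⁻¹ : V →L[ℂ] V) ∘L K) :=
    IsCompactOperator.clm_comp (IsCompactOperator.clm_comp
      (f := (P ∘L J : V →L[ℂ] EuclideanSpace ℂ (Fin n)))
      (isCompactOperator_of_locallyCompactSpace_dom _) (adjoint J ∘L adjoint P))
      (↑S⁻¹ : V →L[ℂ] V)
  have hfac : shift J B l = (S : V →L[ℂ] V) * (1 - (↑S⁻¹ : V →L[ℂ] V) ∘L K) := by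
    rw [mul_sub, mul_one, ← mul_def, ← mul_assoc, Units.mul_inv, one_mul, hS, add_sub_cancel_right]
  rcases hKc.hasEigenvalue_or_mem_resolventSet one_ne_zero with h1 | h1
  · right
    obtain ⟨v, hv⟩ := h1.exists_hasEigenvector
    refine ⟨v, hv.2, ?_⟩
    have h2 : shift J B l v = 0 := by
      have h3 := hv.apply_eq_smul
      rw [one_smul] at h3
      have h4 : (1 - (↑S⁻¹ : V →L[ℂ] V) ∘L K) v = 0 := sub_eq_zero.2 h3.symm
      rw [hfac, mul_apply_eq_comp, h4, map_zero]
    rw [shift_apply, sub_eq_zero] at h2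
    exact h2
  · left
    rw [_root_.spectrum.mem_resolventSet_iff, map_one] at h1
    rw [hfac]
    exact S.isUnit.mul h1

/-- Symmetry of `B` makes eigenvectors for distinct eigenvalues orthogonal in `H`, so both quadratic
forms are diagonal on their span. -/
theorem inner_sum_eigenvectors (D : FormData J B g) {ι : Type*} (s : Finset ι) (l : ι → ℝ)
    (hl : Function.Injective l) (v : ι → V) (hv : ∀ i, B (v i) = (l i : ℂ) • adjoint J (J (v i)))
    (a : ι → ℂ) :
    inner ℂ (B (∑ i ∈ s, a i • v i)) (∑ i ∈ s, a i • v i) =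
        ((∑ i ∈ s, l i * ‖J (a i • v i)‖ ^ 2 : ℝ) : ℂ) ∧
      ‖J (∑ i ∈ s, a i • v i)‖ ^ 2 = ∑ i ∈ s, ‖J (a i • v i)‖ ^ 2 := by
  have hv' : ∀ i, B (a i • v i) = (l i : ℂ) • adjoint J (J (a i • v i)) := fun i => by
    rw [map_smul, hv, map_smul, map_smul, smul_comm]
  have horth : ∀ i j, i ≠ j → inner ℂ (J (a i • v i)) (J (a j • v j)) = 0 := by
    intro i j hij
    have h1 := D.isSelfAdjoint.isSymmetric (a i • v i) (a j • v j)
    simp only [coe_coe] at h1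
    have hi := hv' i
    have hj := hv' j
    generalize a i • v i = x at hi h1 ⊢
    generalize a j • v j = y at hj h1 ⊢
    rw [hi, hj, inner_smul_left, inner_smul_right, adjoint_inner_left, adjoint_inner_right,
      Complex.conj_ofReal, ← sub_eq_zero, ← sub_mul] at h1
    rcases mul_eq_zero.1 h1 with h2 | h2
    · exact absurd (hl (by exact_mod_cast sub_eq_zero.1 h2)) hij
    · exact h2
  have hdiag : ∀ i ∈ s, ∑ j ∈ s, inner ℂ (J (a i • v i)) (J (a j • v j)) =
      ((‖J (a i • v i)‖ ^ 2 : ℝ) : ℂ) := by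
    intro i hi
    rw [Finset.sum_eq_single_of_mem i hi fun j _ hj => horth i j hj.symm,
      inner_self_eq_norm_sq_to_K]
    simp
  constructor
  · rw [map_sum, sum_inner]
    push_cast
    refine Finset.sum_congr rfl fun i hi => ?_
    rw [hv', inner_smul_left, adjoint_inner_left, map_sum, inner_sum, hdiag i hi,
      Complex.conj_ofReal]
    push_cast
    rfl
  · have h1 : ((‖J (∑ i ∈ s, a i • v i)‖ ^ 2 : ℝ) : ℂ) =
        ((∑ i ∈ s, ‖J (a i • v i)‖ ^ 2 : ℝ) : ℂ) := by
      have := inner_self_eq_norm_sq_to_K (𝕜 := ℂ) (J (∑ i ∈ s, a i • v i))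
      push_cast
      rw [← Complex.coe_algebraMap, ← this, map_sum, sum_inner]
      refine Finset.sum_congr rfl fun i hi => ?_
      rw [inner_sum, hdiag i hi]
      push_cast
      rfl
    exact_mod_cast h1

/-- Below each negative number there are only finitely many eigenvalues. -/
theorem finite_eigenvalues (D : FormData J B g) {δ : ℝ} (hδ : 0 < δ) :
    {l : ℝ | l ≤ -δ ∧ ∃ v ≠ 0, B v = (l : ℂ) • adjoint J (J v)}.Finite := by
  obtain ⟨c, hc, n, P, h⟩ := D.garding δ hδ
  set E := {l : ℝ | l ≤ -δ ∧ ∃ v ≠ 0, B v = (l : ℂ) • adjoint J (J v)}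
  choose v hv0 hv using fun l : E => l.2.2
  -- On a combination killed by `P ∘ J`, Gårding reads `c‖u‖² ≤ ∑ (lᵢ + δ)‖J (aᵢ vᵢ)‖² ≤ 0`, so the
  -- combination vanishes. Thus there are at most `n` eigenvalues.
  have hind : LinearIndependent ℂ (fun l : E => P (J (v l))) := by
    rw [linearIndependent_iff']
    intro s a hs i hi
    obtain ⟨h1, h2⟩ := D.inner_sum_eigenvectors s (fun l : E => (l : ℝ))
      Subtype.coe_injective v hv a
    have h3 := h (∑ i ∈ s, a i • v i)
    have h4 : P (J (∑ i ∈ s, a i • v i)) = 0 := by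
      rw [map_sum, map_sum, ← hs]
      simp only [map_smul]
    rw [h4, h1, h2, Complex.ofReal_re, Finset.mul_sum, ← Finset.sum_add_distrib] at h3
    have h5 : ∑ i ∈ s, ((i : ℝ) * ‖J (a i • v i)‖ ^ 2 + δ * ‖J (a i • v i)‖ ^ 2) ≤ 0 := by
      refine Finset.sum_nonpos fun i _ => ?_
      have := i.2.1
      nlinarith [sq_nonneg ‖J (a i • v i)‖]
    rw [norm_zero] at h3
    have h6 : ‖∑ i ∈ s, a i • v i‖ ^ 2 ≤ 0 := by
      by_contra! h7
      have := mul_pos hc h7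
      linarith
    have h7 : ∑ i ∈ s, a i • v i = 0 :=
      norm_eq_zero.1 (pow_eq_zero_iff two_ne_zero |>.1 (le_antisymm h6 (sq_nonneg _)))
    rw [h7, map_zero, norm_zero, zero_pow two_ne_zero, eq_comm,
      Finset.sum_eq_zero_iff_of_nonneg fun _ _ => sq_nonneg _] at h2
    have h8 := D.injective ((norm_eq_zero.1 (pow_eq_zero_iff two_ne_zero |>.1 (h2 i hi))).trans
      (map_zero J).symm)
    exact (smul_eq_zero.1 h8).resolve_right (hv0 i)
  exact Set.finite_coe_iff.1 hind.finite

/-- On the eigenspace the form is `l‖J v‖²`, which cancels the term with `δ = -l` in Gårding's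
inequality; what remains says that `P` is injective there. -/
theorem finiteDimensional_eigenspace (D : FormData J B g) {l : ℝ} (hl : l < 0) :
    FiniteDimensional ℂ (eigenspace g.toLinearPMap l) := by
  obtain ⟨c, hc, n, P, h⟩ := D.garding (-l) (by linarith)
  let T : eigenspace g.toLinearPMap l →ₗ[ℂ] EuclideanSpace ℂ (Fin n) :=
    P.toLinearMap ∘ₗ g.toLinearPMap.domain.subtype ∘ₗ (eigenspace g.toLinearPMap l).subtype
  refine FiniteDimensional.of_injective T ((injective_iff_map_eq_zero _).2 fun u hu => ?_)
  have hu0 : g.toLinearPMap (u : g.toLinearPMap.domain) -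
      (l : ℂ) • ((u : g.toLinearPMap.domain) : H) = 0 := u.2
  obtain ⟨v, hv, hv'⟩ := D.exists_shift_eq l (u : g.toLinearPMap.domain)
  rw [hu0, map_zero] at hv'
  have hP : P (J v) = 0 := by rw [hv]; exact hu
  have h1 := h v
  have h2 := inner_shift (J := J) (B := B) l v
  rw [hv', inner_zero_left, eq_comm, sub_eq_zero] at h2
  rw [h2, hP, norm_zero, Complex.re_mul_ofReal, Complex.conj_re, Complex.ofReal_re] at h1
  have h3 : ‖v‖ ^ 2 ≤ 0 := by
    by_contra! h7
    have := mul_pos hc h7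
    linarith
  have h4 : v = 0 :=
    norm_eq_zero.1 (pow_eq_zero_iff two_ne_zero |>.1 (le_antisymm h3 (sq_nonneg _)))
  refine Subtype.ext (Subtype.ext ?_)
  rw [← hv, h4, map_zero]
  rfl

theorem eigenspace_ne_bot (D : FormData J B g) {l : ℝ} {v : V} (hv : v ≠ 0)
    (h : B v = (l : ℂ) • adjoint J (J v)) : eigenspace g.toLinearPMap l ≠ ⊥ := by
  obtain ⟨u, hu, hu'⟩ := D.exists_domain ((D.mem_graph (J v, (l : ℂ) • J v)).2
    ⟨v, rfl, by rw [h, map_smul]⟩)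
  refine (Submodule.ne_bot_iff _).2 ⟨u, ?_, fun h0 => hv (D.injective ?_)⟩
  · change g.toLinearPMap u - (l : ℂ) • (u : H) = 0
    rw [hu, hu', sub_self]
  · rw [← hu, h0, map_zero]
    rfl

/-- The essential spectrum of the operator associated with the form is non-negative. -/
theorem essentialSpectrum_subset (D : FormData J B g) :
    essentialSpectrum g.toLinearPMap ⊆ Complex.ofReal '' Set.Ici 0 := by
  have hreal : ∀ z ∈ spectrum g.toLinearPMap, z.im = 0 := fun z hz => by
    by_contra h
    exact D.notMem_spectrum (D.isUnit_shift_of_im_ne_zero h) hz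
  rintro z ⟨hz, hz'⟩
  obtain ⟨l, rfl⟩ : ∃ l : ℝ, (l : ℂ) = z := ⟨z.re, Complex.ext rfl (hreal z hz).symm⟩
  refine ⟨l, ?_, rfl⟩
  by_contra hl
  rw [Set.mem_Ici, not_le] at hl
  apply hz'
  obtain ⟨v, hv, hv'⟩ := (D.isUnit_shift_or_exists_eigenvector hl).resolve_left
    fun h => D.notMem_spectrum h hz
  refine ⟨hz, ?_, D.eigenspace_ne_bot hv hv', D.finiteDimensional_eigenspace hl⟩
  -- Points at distance less than `-l/2` from `l` stay below `l/2 < 0`. There the spectrum consists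
  -- of finitely many eigenvalues, and removing `l` leaves a closed set.
  have hfin := (D.finite_eigenvalues (δ := -l / 2) (by linarith)).subset
    (Set.sdiff_subset (t := {l}))
  obtain ⟨ε, hε, hsub⟩ := Metric.isOpen_iff.1 hfin.isClosed.isOpen_compl l (by simp)
  refine ⟨min ε (-l / 2), lt_min hε (by linarith), fun w hw hdist => ?_⟩
  obtain ⟨m, rfl⟩ : ∃ m : ℝ, (m : ℂ) = w := ⟨w.re, Complex.ext rfl (hreal w hw).symm⟩
  rw [Complex.dist_eq, ← Complex.ofReal_sub, Complex.norm_real, ← dist_eq_norm, lt_min_iff] at hdist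
  have hm := hdist.2
  rw [Real.dist_eq, abs_lt] at hm
  have hml : m ≤ -(-l / 2) := by linarith [hm.2]
  have h1 := (D.isUnit_shift_or_exists_eigenvector (l := m) (by linarith)).resolve_left
    fun h => D.notMem_spectrum h hw
  by_contra hne
  exact hsub (Metric.mem_ball.2 hdist.1) ⟨⟨hml, h1⟩, fun h => hne (by rw [Set.mem_singleton_iff.1 h])⟩

theorem mem_spectrum_of_approx (D : FormData J B g) {z : ℂ}
    (h : ∀ ε > (0 : ℝ), ∃ p ∈ g, p.1 ≠ 0 ∧ ‖p.2 - z • p.1‖ ≤ ε * ‖p.1‖) :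
    z ∈ spectrum g.toLinearPMap := by
  rw [spectrum, Set.mem_compl_iff]
  rintro ⟨R, -, hR⟩
  -- With this tolerance an inverse `R` would give `‖x‖ ≤ ‖x‖ / 2` for a nonzero `x`.
  obtain ⟨⟨x, y⟩, hp, hx, hxy⟩ := h (1 / (2 * (‖R‖ + 1))) (by positivity)
  obtain ⟨u, hu, hu'⟩ := D.exists_domain hp
  have h1 := hR u
  rw [hu, hu'] at h1
  dsimp only at hx hxy
  have hx' := norm_pos_iff.2 hx
  have h2 : ‖x‖ ≤ ‖R‖ * (1 / (2 * (‖R‖ + 1)) * ‖x‖) := by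
    calc ‖x‖ = ‖R (y - z • x)‖ := by rw [h1]
      _ ≤ ‖R‖ * ‖y - z • x‖ := R.le_opNorm _
      _ ≤ _ := by gcongr
  have h3 : ‖R‖ * (1 / (2 * (‖R‖ + 1)) * ‖x‖) < ‖x‖ := by
    rw [← mul_assoc, mul_one_div]
    refine mul_lt_of_lt_one_left hx' ?_
    rw [div_lt_one (by positivity)]
    linarith [norm_nonneg R]
  linarith

/-- A form operator with a singular sequence at each non-negative number has essential spectrum
`[0, ∞)`. -/
theorem essentialSpectrum_eq (D : FormData J B g)
    (h : ∀ l : ℝ, 0 ≤ l → ∀ ε > (0 : ℝ), ∃ p ∈ g, p.1 ≠ 0 ∧ ‖p.2 - (l : ℂ) • p.1‖ ≤ ε * ‖p.1‖) :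
    essentialSpectrum g.toLinearPMap = Complex.ofReal '' Set.Ici 0 := by
  refine D.essentialSpectrum_subset.antisymm ?_
  have hsub : ∀ l : ℝ, 0 ≤ l → (l : ℂ) ∈ spectrum g.toLinearPMap := fun l hl =>
    D.mem_spectrum_of_approx (h l hl)
  rintro _ ⟨l, hl, rfl⟩
  rw [Set.mem_Ici] at hl
  refine ⟨hsub l hl, fun hd => ?_⟩
  obtain ⟨ε, hε, hiso⟩ := hd.2.1
  -- An isolated point is excluded by its neighbour `l + ε/2`, which is also in the spectrum. No
  -- orthogonality of the approximate eigenvectors is needed.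
  have h1 := hiso _ (hsub (l + ε / 2) (by linarith)) (by
    rw [Complex.dist_eq, ← Complex.ofReal_sub, Complex.norm_real, Real.norm_eq_abs, abs_lt]
    constructor <;> linarith)
  have h2 : l + ε / 2 = l := by exact_mod_cast h1
  linarith

end FormData

end FormOperator

/-! ### Weak derivatives of locally integrable functions, and mollification -/

/-- `g` is the weak partial derivative `∂ᵢ f` in the open set `V`, for functions on the plane. -/
def HasWeakPartial (V : Set Plane) (i : Fin 2) (f g : Plane → ℂ) : Prop :=
  ∀ φ : Plane → ℝ, ContDiff ℝ ∞ φ → HasCompactSupport φ → tsupport φ ⊆ V →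
    ∫ x, pderiv i φ x • f x = - ∫ x, φ x • g x

/-- Extension by zero lets convolution act on the whole plane; the derivative identity is still
claimed only inside `U`. -/
theorem IsWeakPartial.hasWeakPartial {U : Set Plane} (hU : MeasurableSet U) {i : Fin 2}
    {u v : L2 U} (h : IsWeakPartial U i u v) :
    HasWeakPartial U i (U.indicator u) (U.indicator v) := by
  intro φ h1 h2 h3
  have key : ∀ (ψ : Plane → ℝ) (w : Plane → ℂ),
      ∫ x, ψ x • U.indicator w x = ∫ x in U, ψ x • w x := by
    intro ψ w
    rw [← integral_indicator hU]
    congr 1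
    funext x
    rw [indicator_smul_apply]
  rw [key, key, h φ h1 h2 h3]

theorem pderiv_mul {φ θ : Plane → ℝ} (hφ : ContDiff ℝ ∞ φ) (hθ : ContDiff ℝ ∞ θ) (i : Fin 2)
    (x : Plane) : pderiv i (fun y => θ y * φ y) x = pderiv i θ x * φ x + θ x * pderiv i φ x := by
  simp only [pderiv]
  rw [fderiv_fun_mul (hθ.differentiable (by simp) x) (hφ.differentiable (by simp) x)]
  simp only [add_apply, smul_apply, smul_eq_mul]
  ring

theorem tsupport_pderiv_subset {F : Type*} [NormedAddCommGroup F] [NormedSpace ℝ F] {φ : Plane → F}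
    (i : Fin 2) : tsupport (pderiv i φ) ⊆ tsupport φ :=
  tsupport_fderiv_apply_subset ℝ (EuclideanSpace.single i 1)

/-- The product rule. Multiplication by `θ` extends the domain of the weak derivative to the
complement of the support of `θ`. -/
theorem HasWeakPartial.smul {V : Set Plane} {i : Fin 2} {f g : Plane → ℂ}
    (h : HasWeakPartial V i f g) (hf : LocallyIntegrable f) (hg : LocallyIntegrable g)
    {θ : Plane → ℝ} (hθ : ContDiff ℝ ∞ θ) :
    HasWeakPartial (V ∪ (tsupport θ)ᶜ) i (fun x => θ x • f x)
      (fun x => pderiv i θ x • f x + θ x • g x) := by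
  intro φ h1 h2 h3
  have hs : tsupport (fun y => θ y * φ y) ⊆ V := by
    intro x hx
    have hx1 : x ∈ tsupport θ := tsupport_mul_subset_left hx
    have hx2 : x ∈ tsupport φ := tsupport_mul_subset_right hx
    exact (h3 hx2).resolve_right fun h => h hx1
  have h4 := h _ (hθ.mul h1) h2.mul_left hs
  have hd : ∀ ψ : Plane → ℝ, Continuous ψ → HasCompactSupport ψ → ∀ w : Plane → ℂ,
      LocallyIntegrable w → Integrable fun x => ψ x • w x := fun ψ a b w hw =>
    hw.integrable_smul_left_of_hasCompactSupport a b
  have e1 : ∫ x, pderiv i (fun y => θ y * φ y) x • f x =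
      (∫ x, (pderiv i θ x * φ x) • f x) + ∫ x, pderiv i φ x • θ x • f x := by
    rw [← integral_add]
    · congr 1
      funext x
      rw [pderiv_mul h1 hθ, add_smul, smul_smul, mul_comm (pderiv i φ x)]
    · exact hd _ ((continuous_pderiv hθ i).mul h1.continuous) h2.mul_left f hf
    · have := hd (fun x => pderiv i φ x * θ x) ((continuous_pderiv h1 i).mul hθ.continuous)
        (hasCompactSupport_pderiv h2 i).mul_right f hf
      simpa only [smul_smul] using this
  have e2 : ∫ x, φ x • (pderiv i θ x • f x + θ x • g x) =
      (∫ x, (pderiv i θ x * φ x) • f x) + ∫ x, (θ x * φ x) • g x := by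
    rw [← integral_add]
    · congr 1
      funext x
      rw [smul_add, smul_smul, smul_smul, mul_comm, mul_comm (φ x) (θ x)]
    · exact hd _ ((continuous_pderiv hθ i).mul h1.continuous) h2.mul_left f hf
    · exact hd _ (hθ.continuous.mul h1.continuous) h2.mul_left g hg
  rw [e2, neg_add, ← h4, e1]
  ring

/-- The mollification `ρ ⋆ f`. -/
noncomputable def mollify (ρ : Plane → ℝ) (f : Plane → ℂ) (x : Plane) : ℂ :=
  ∫ t, ρ (x - t) • f t

theorem mollify_eq (ρ : Plane → ℝ) (f : Plane → ℂ) :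
    mollify ρ f = convolution f ρ (ContinuousLinearMap.lsmul ℝ ℝ).flip volume := rfl

theorem contDiff_mollify {ρ : Plane → ℝ} (hρ : ContDiff ℝ ∞ ρ) (hc : HasCompactSupport ρ)
    {f : Plane → ℂ} (hf : LocallyIntegrable f) : ContDiff ℝ ∞ (mollify ρ f) := by
  rw [mollify_eq]
  exact hc.contDiff_convolution_right _ hf hρ

theorem hasCompactSupport_mollify {ρ : Plane → ℝ} (hc : HasCompactSupport ρ)
    {f : Plane → ℂ} (hf : HasCompactSupport f) : HasCompactSupport (mollify ρ f) := by
  rw [mollify_eq]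
  exact hf.convolution _ hc

theorem pderiv_mollify {ρ : Plane → ℝ} (hρ : ContDiff ℝ ∞ ρ) (hc : HasCompactSupport ρ)
    {f : Plane → ℂ} (hf : LocallyIntegrable f) (i : Fin 2) :
    pderiv i (mollify ρ f) = mollify (pderiv i ρ) f := by
  funext x
  rw [mollify_eq, pderiv,
    (hc.hasFDerivAt_convolution_right _ hf (hρ.of_le (by norm_cast)) x).fderiv,
    convolution_precompR_apply _ hf (hc.fderiv ℝ) (hρ.continuous_fderiv (by simp))]
  rfl

theorem pderiv_comp_sub {F : Type*} [NormedAddCommGroup F] [NormedSpace ℝ F] {ρ : Plane → F}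
    (hρ : ContDiff ℝ ∞ ρ) (i : Fin 2) (y x : Plane) :
    pderiv i (fun t => ρ (y - t)) x = - pderiv i ρ (y - x) := by
  have h := (hρ.differentiable (by simp) (y - x)).hasFDerivAt.comp x
    ((hasFDerivAt_const y x).sub (hasFDerivAt_id x))
  have h2 : HasFDerivAt (fun t => ρ (y - t)) _ x := h
  rw [pderiv, h2.fderiv]
  simp [pderiv]

theorem pderiv_comp_add_right {F : Type*} [NormedAddCommGroup F] [NormedSpace ℝ F] (ρ : Plane → F)
    (i : Fin 2) (a : Plane) :
    pderiv i (fun t => ρ (t + a)) = fun x => pderiv i ρ (x + a) := by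
  funext x
  rw [pderiv, fderiv_comp_add_right]
  rfl

/-- The function `t ↦ ρ (y - t)` is an admissible test function, because its support lies in the
closed ball of radius `η` about `y`. -/
theorem HasWeakPartial.mollify {V : Set Plane} {i : Fin 2} {f g : Plane → ℂ}
    (h : HasWeakPartial V i f g) (hf : LocallyIntegrable f) {ρ : Plane → ℝ}
    (hρ : ContDiff ℝ ∞ ρ) (hc : HasCompactSupport ρ) {η : ℝ}
    (hs : tsupport ρ ⊆ Metric.closedBall 0 η) {y : Plane} (hy : Metric.closedBall y η ⊆ V) :
    pderiv i (mollify ρ f) y = RobinBiLaplacian.mollify ρ g y := by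
  rw [pderiv_mollify hρ hc hf]
  have hcomp : HasCompactSupport fun t => ρ (y - t) :=
    hc.comp_homeomorph (Homeomorph.subLeft y)
  have h1 := h (fun t => ρ (y - t)) (hρ.comp (contDiff_const.sub contDiff_id)) hcomp (by
    refine subset_trans ?_ hy
    intro x hx
    have hx' : y - x ∈ tsupport ρ := by
      have := tsupport_comp_eq_preimage ρ (Homeomorph.subLeft y)
      have h2 : tsupport (fun t => ρ (y - t)) = (Homeomorph.subLeft y) ⁻¹' tsupport ρ := this
      rw [h2] at hx
      exact hx
    have := hs hx'
    rwa [mem_closedBall_zero_iff, ← dist_eq_norm, dist_comm] at this)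
  simp only [pderiv_comp_sub hρ, neg_smul, integral_neg, neg_inj] at h1
  exact h1

/-! ### Convergence of translated mollifications in `L²` -/

/-- A version of the Cauchy–Schwarz inequality. -/
theorem sq_lintegral_mul_le {α : Type*} [MeasurableSpace α] (μ : Measure α) {f g : α → ℝ≥0∞}
    (hf : AEMeasurable f μ) (hg : AEMeasurable g μ) :
    (∫⁻ a, f a * g a ∂μ) ^ 2 ≤ (∫⁻ a, f a ^ 2 ∂μ) * ∫⁻ a, g a ^ 2 ∂μ := by
  have h := ENNReal.lintegral_mul_le_Lp_mul_Lq μ Real.HolderConjugate.two_two hf hg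
  have h2 : ∀ x : ℝ≥0∞, (x ^ (1 / 2 : ℝ)) ^ 2 = x := fun x => by
    rw [← ENNReal.rpow_natCast, ← ENNReal.rpow_mul]
    norm_num
  have h3 := pow_le_pow_left' h 2
  rw [mul_pow, h2, h2] at h3
  simp only [ENNReal.rpow_two] at h3
  exact h3

/-- Cauchy–Schwarz for `√w` and `√w · g`; for a weight of mass one this is Jensen's inequality. -/
theorem sq_lintegral_weight_mul_le {α : Type*} [MeasurableSpace α] (μ : Measure α)
    {w g : α → ℝ≥0∞} (hw : AEMeasurable w μ) (hg : AEMeasurable g μ) :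
    (∫⁻ a, w a * g a ∂μ) ^ 2 ≤ (∫⁻ a, w a ∂μ) * ∫⁻ a, w a * g a ^ 2 ∂μ := by
  have h2 : ∀ x : ℝ≥0∞, (x ^ (1 / 2 : ℝ)) ^ 2 = x := fun x => by
    rw [← ENNReal.rpow_natCast, ← ENNReal.rpow_mul]
    norm_num
  have h := sq_lintegral_mul_le μ (hw.pow_const (1 / 2 : ℝ)) ((hw.pow_const (1 / 2 : ℝ)).mul hg)
  simp only [Pi.mul_apply, mul_pow, h2, ← mul_assoc, ← pow_two] at h
  exact h

theorem eLpNorm_two_sq {α E : Type*} [MeasurableSpace α] [NormedAddCommGroup E] (μ : Measure α)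
    (f : α → E) : eLpNorm f 2 μ ^ 2 = ∫⁻ x, ‖f x‖ₑ ^ 2 ∂μ := by
  rw [eLpNorm_eq_lintegral_rpow_enorm_toReal (by norm_num) (by norm_num), ← ENNReal.rpow_natCast,
    ← ENNReal.rpow_mul]
  norm_num

/-- Continuity of translations in `L²`, expressed through the additive action of the plane on `Lp`.
-/
theorem exists_eLpNorm_translate_le {f : Plane → ℂ} (hf : MemLp f 2) {ε : ℝ≥0∞} (hε : 0 < ε) :
    ∃ δ > (0 : ℝ), ∀ z : Plane, ‖z‖ < δ → eLpNorm (fun x => f (z + x) - f x) 2 volume ≤ ε := by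
  have : Fact ((2 : ℝ≥0∞) ≠ ⊤) := ⟨by norm_num⟩
  have hcont : Continuous fun z : Plane => (DomAddAct.mk z +ᵥ hf.toLp f : Lp ℂ 2 volume) :=
    (DomAddAct.continuous_mk.vadd continuous_const)
  have h0 : Tendsto (fun z : Plane => edist (DomAddAct.mk z +ᵥ hf.toLp f : Lp ℂ 2 volume)
      (hf.toLp f)) (𝓝 0) (𝓝 0) := by
    have := (hcont.tendsto 0).edist (tendsto_const_nhds (x := hf.toLp f))
    simpa using this
  obtain ⟨δ, hδ, h⟩ := Metric.eventually_nhds_iff.1 (h0.eventually (Iic_mem_nhds hε))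
  refine ⟨δ, hδ, fun z hz => ?_⟩
  have h1 := h (y := z) (by rwa [dist_zero_right])
  rw [DomAddAct.mk_vadd_toLp, Lp.edist_toLp_toLp] at h1
  exact h1

/-- The difference is the `ρ`-average over `t` of `f (a - t + ·) - f`. Jensen and Tonelli reduce its
`L²` norm to that of translations by vectors of length at most `‖a‖ + η`. The threshold `δ` depends
on neither the mollifier nor the shift. -/
theorem eLpNorm_mollify_sub_le {f : Plane → ℂ} (hf : MemLp f 2) (hfm : Measurable f) {ε : ℝ≥0∞}
    (hε : 0 < ε) : ∃ δ > (0 : ℝ), ∀ (ρ : Plane → ℝ) (η : ℝ) (a : Plane), Continuous ρ →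
      (∀ x, 0 ≤ ρ x) → HasCompactSupport ρ → ∫ x, ρ x = 1 → tsupport ρ ⊆ Metric.closedBall 0 η →
      ‖a‖ + η < δ → eLpNorm (fun x => mollify ρ f (x + a) - f x) 2 volume ≤ ε := by
  obtain ⟨δ, hδ, h⟩ := exists_eLpNorm_translate_le hf hε
  refine ⟨δ, hδ, fun ρ η a hρ hpos hc hint hs ha => ?_⟩
  have hloc : LocallyIntegrable f := hf.locallyIntegrable (by norm_num)
  have hw : ∫⁻ t, ENNReal.ofReal (ρ t) = 1 := by
    rw [← ofReal_integral_eq_lintegral_ofReal (hρ.integrable_of_hasCompactSupport hc)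
      (Eventually.of_forall hpos), hint, ENNReal.ofReal_one]
  have hwm : Measurable fun t => ENNReal.ofReal (ρ t) := hρ.measurable.ennreal_ofReal
  have hpt : ∀ x, ‖mollify ρ f (x + a) - f x‖ₑ ^ 2 ≤
      ∫⁻ t, ENNReal.ofReal (ρ t) * ‖f ((a - t) + x) - f x‖ₑ ^ 2 := by
    intro x
    have e1 : mollify ρ f (x + a) = ∫ t, ρ t • f ((a - t) + x) := by
      rw [mollify, ← integral_sub_left_eq_self _ _ (x + a)]
      congr 1
      funext t
      congr 2
      · abel
      · abel
    have hi1 : Integrable fun t => ρ t • f ((a - t) + x) := by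
      have h3 : Integrable fun t => ρ (x + a - t) • f t :=
        hloc.integrable_smul_left_of_hasCompactSupport (hρ.comp (continuous_const.sub continuous_id))
          (hc.comp_homeomorph (Homeomorph.subLeft (x + a)))
      have h4 := h3.comp_sub_left (x + a)
      refine h4.congr (Eventually.of_forall fun t => ?_)
      dsimp only
      congr 2
      · abel
      · abel
    have hi2 : Integrable fun t => ρ t • f x :=
      (hρ.integrable_of_hasCompactSupport hc).smul_const _
    have e2 : mollify ρ f (x + a) - f x = ∫ t, ρ t • (f ((a - t) + x) - f x) := by
      rw [e1]
      simp only [smul_sub]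
      rw [integral_sub hi1 hi2, integral_smul_const, hint, one_smul]
    have hm : Measurable fun t => ‖f ((a - t) + x) - f x‖ₑ := by fun_prop
    calc ‖mollify ρ f (x + a) - f x‖ₑ ^ 2
        ≤ (∫⁻ t, ENNReal.ofReal (ρ t) * ‖f ((a - t) + x) - f x‖ₑ) ^ 2 := by
          gcongr
          rw [e2]
          refine (enorm_integral_le_lintegral_enorm _).trans (lintegral_mono fun t => ?_)
          rw [enorm_smul, Real.enorm_of_nonneg (hpos t)]
      _ ≤ _ := by
          have := sq_lintegral_weight_mul_le volume hwm.aemeasurable hm.aemeasurable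
          rwa [hw, one_mul] at this
  have hsq : eLpNorm (fun x => mollify ρ f (x + a) - f x) 2 volume ^ 2 ≤ ε ^ 2 := by
    rw [eLpNorm_two_sq]
    calc _ ≤ ∫⁻ x, ∫⁻ t, ENNReal.ofReal (ρ t) * ‖f ((a - t) + x) - f x‖ₑ ^ 2 :=
          lintegral_mono hpt
      _ = ∫⁻ t, ∫⁻ x, ENNReal.ofReal (ρ t) * ‖f ((a - t) + x) - f x‖ₑ ^ 2 := by
          refine lintegral_lintegral_swap ?_
          have : Measurable fun p : Plane × Plane =>
            ENNReal.ofReal (ρ p.2) * ‖f ((a - p.2) + p.1) - f p.1‖ₑ ^ 2 := by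
            have := hρ.measurable
            fun_prop
          exact this.aemeasurable
      _ ≤ ∫⁻ t, ENNReal.ofReal (ρ t) * ε ^ 2 := by
          refine lintegral_mono fun t => ?_
          dsimp only
          rw [lintegral_const_mul _ (by fun_prop)]
          by_cases ht : ρ t = 0
          · simp [ht]
          · have ht' := hs (subset_tsupport ρ ht)
            rw [mem_closedBall_zero_iff] at ht'
            gcongr
            rw [← eLpNorm_two_sq]
            gcongr
            refine h _ (lt_of_le_of_lt (norm_sub_le _ _) ?_)
            linarith
      _ = ε ^ 2 := by rw [lintegral_mul_const _ hwm, hw, one_mul]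
  exact (ENNReal.pow_le_pow_left_iff two_ne_zero).1 hsq

/-! ### Density of test functions in `H²` -/

theorem HasWeakPartial.mono {V W : Set Plane} {i : Fin 2} {f g : Plane → ℂ}
    (h : HasWeakPartial V i f g) (hW : W ⊆ V) : HasWeakPartial W i f g :=
  fun φ h1 h2 h3 => h φ h1 h2 (h3.trans hW)

theorem HasWeakPartial.add {V : Set Plane} {i : Fin 2} {f g f' g' : Plane → ℂ}
    (h : HasWeakPartial V i f g) (h' : HasWeakPartial V i f' g') (hf : LocallyIntegrable f)
    (hg : LocallyIntegrable g) (hf' : LocallyIntegrable f') (hg' : LocallyIntegrable g') :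
    HasWeakPartial V i (fun x => f x + f' x) (fun x => g x + g' x) := by
  intro φ h1 h2 h3
  have hd : ∀ ψ : Plane → ℝ, Continuous ψ → HasCompactSupport ψ → ∀ w : Plane → ℂ,
      LocallyIntegrable w → Integrable fun x => ψ x • w x := fun ψ a b w hw =>
    hw.integrable_smul_left_of_hasCompactSupport a b
  simp only [smul_add]
  rw [integral_add (hd _ (continuous_pderiv h1 i) (hasCompactSupport_pderiv h2 i) f hf)
    (hd _ (continuous_pderiv h1 i) (hasCompactSupport_pderiv h2 i) f' hf'),
    integral_add (hd _ h1.continuous h2 g hg) (hd _ h1.continuous h2 g' hg'),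
    h φ h1 h2 h3, h' φ h1 h2 h3, neg_add]

theorem isOpen_extDomain (Ω : Set Plane) : IsOpen (extDomain Ω) := isClosed_closure.isOpen_compl

/-! ### Products with cutoffs and their approximation by test functions -/

section Cutoff

variable {U : Set Plane}

/-- The components of an element of `H²(U)`, extended by zero. -/
noncomputable def extJet (u : H2 U) (k : Jet) : Plane → ℂ := U.indicator (u.1 k)

theorem measurable_extJet (hU : MeasurableSet U) (u : H2 U) (k : Jet) : Measurable (extJet u k) :=
  (Lp.stronglyMeasurable (u.1 k)).measurable.indicator hU

theorem memLp_extJet (hU : MeasurableSet U) (u : H2 U) (k : Jet) : MemLp (extJet u k) 2 :=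
  (memLp_indicator_iff_restrict hU).2 (Lp.memLp (u.1 k))

theorem MemLp.smul_of_test {f : Plane → ℂ} (hf : MemLp f 2) {θ : Plane → ℝ}
    (hθ : Continuous θ) (hc : HasCompactSupport θ) : MemLp (fun x => θ x • f x) 2 :=
  hf.smul (r := 2) (p := ⊤) (hθ.memLp_top_of_hasCompactSupport hc volume)

/-- The components of `θ u`, extended by zero. -/
noncomputable def prodJet (θ : Plane → ℝ) (u : H2 U) : Jet → Plane → ℂ
  | .inl _ => fun x => θ x • extJet u (.inl ()) x
  | .inr (.inl i) => fun x =>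
      pderiv i θ x • extJet u (.inl ()) x + θ x • extJet u (.inr (.inl i)) x
  | .inr (.inr (i, j)) => fun x =>
      (pderiv j (pderiv i θ) x • extJet u (.inl ()) x +
        pderiv i θ x • extJet u (.inr (.inl j)) x) +
      (pderiv j θ x • extJet u (.inr (.inl i)) x + θ x • extJet u (.inr (.inr (i, j))) x)

/-- The classical derivatives of order at most two. -/
noncomputable def classicalJet (φ : Plane → ℂ) : Jet → Plane → ℂ
  | .inl _ => φ
  | .inr (.inl i) => pderiv i φ
  | .inr (.inr (i, j)) => pderiv j (pderiv i φ)

theorem memLp_prodJet (hU : MeasurableSet U) {θ : Plane → ℝ} (hθ : ContDiff ℝ ∞ θ)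
    (hc : HasCompactSupport θ) (u : H2 U) (k : Jet) : MemLp (prodJet θ u k) 2 := by
  have h1 := fun k => MemLp.smul_of_test (memLp_extJet hU u k) hθ.continuous hc
  have h2 := fun i k => MemLp.smul_of_test (memLp_extJet hU u k) (continuous_pderiv hθ i)
    (hasCompactSupport_pderiv hc i)
  have h3 := fun i j k => MemLp.smul_of_test (memLp_extJet hU u k)
    (continuous_pderiv (contDiff_pderiv hθ i) j)
    (hasCompactSupport_pderiv (hasCompactSupport_pderiv hc i) j)
  rcases k with _ | i | ⟨i, j⟩
  · exact h1 _
  · exact (h2 _ _).add (h1 _)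
  · exact ((h3 _ _ _).add (h2 _ _)).add ((h2 _ _).add (h1 _))

theorem measurable_prodJet (hU : MeasurableSet U) {θ : Plane → ℝ} (hθ : ContDiff ℝ ∞ θ)
    (u : H2 U) (k : Jet) : Measurable (prodJet θ u k) := by
  have h0 := measurable_extJet hU u
  have h1 := hθ.continuous.measurable
  have h2 := fun i => (continuous_pderiv hθ i).measurable
  have h3 := fun i j => (continuous_pderiv (contDiff_pderiv hθ i) j).measurable
  rcases k with _ | i | ⟨i, j⟩
  · exact h1.smul (h0 _)
  · exact ((h2 _).smul (h0 _)).add (h1.smul (h0 _))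
  · exact (((h3 _ _).smul (h0 _)).add ((h2 _).smul (h0 _))).add
      (((h2 _).smul (h0 _)).add (h1.smul (h0 _)))

theorem hasWeakPartial_prodJet (hU : IsOpen U) {θ : Plane → ℝ} (hθ : ContDiff ℝ ∞ θ)
    (u : H2 U) (i : Fin 2) :
    HasWeakPartial (U ∪ (tsupport θ)ᶜ) i (prodJet θ u (.inl ())) (prodJet θ u (.inr (.inl i))) :=
  ((u.2.1 i).hasWeakPartial hU.measurableSet).smul
    ((memLp_extJet hU.measurableSet u _).locallyIntegrable (by norm_num))
    ((memLp_extJet hU.measurableSet u _).locallyIntegrable (by norm_num)) hθ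

theorem hasWeakPartial_prodJet_second (hU : IsOpen U) {θ : Plane → ℝ} (hθ : ContDiff ℝ ∞ θ)
    (hc : HasCompactSupport θ) (u : H2 U) (i j : Fin 2) :
    HasWeakPartial (U ∪ (tsupport θ)ᶜ) j (prodJet θ u (.inr (.inl i)))
      (prodJet θ u (.inr (.inr (i, j)))) := by
  have hl : ∀ k, LocallyIntegrable (extJet u k) := fun k =>
    (memLp_extJet hU.measurableSet u k).locallyIntegrable (by norm_num)
  have hm : ∀ k, MemLp (extJet u k) 2 := memLp_extJet hU.measurableSet u
  have h1 : ∀ k, LocallyIntegrable fun x => θ x • extJet u k x := fun k =>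
    (MemLp.smul_of_test (hm k) hθ.continuous hc).locallyIntegrable (by norm_num)
  have h2 : ∀ i k, LocallyIntegrable fun x => pderiv i θ x • extJet u k x := fun i k =>
    (MemLp.smul_of_test (hm k) (continuous_pderiv hθ i)
      (hasCompactSupport_pderiv hc i)).locallyIntegrable (by norm_num)
  have h3 : ∀ i j k, LocallyIntegrable fun x => pderiv j (pderiv i θ) x • extJet u k x :=
    fun i j k => (MemLp.smul_of_test (hm k) (continuous_pderiv (contDiff_pderiv hθ i) j)
      (hasCompactSupport_pderiv (hasCompactSupport_pderiv hc i) j)).locallyIntegrable (by norm_num)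
  refine HasWeakPartial.add ?_ ?_ (h2 _ _) ((h3 _ _ _).add (h2 _ _)) (h1 _) ((h2 _ _).add (h1 _))
  · exact (((u.2.1 j).hasWeakPartial hU.measurableSet).smul (hl _) (hl _)
      (contDiff_pderiv hθ i)).mono (union_subset_union_right _
        (compl_subset_compl.2 (tsupport_pderiv_subset i)))
  · exact ((u.2.2 i j).hasWeakPartial hU.measurableSet).smul (hl _) (hl _) hθ

/-- The function `θ u` is a limit in `H²(U)` of restrictions of test functions. -/
def Approximable (u : H2 U) (θ : Plane → ℝ) : Prop :=
  ∀ ε > (0 : ℝ≥0∞), ∃ φ : Plane → ℂ, ContDiff ℝ ∞ φ ∧ HasCompactSupport φ ∧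
    ∀ k, eLpNorm (fun x => classicalJet φ k x - prodJet θ u k x) 2 (volume.restrict U) ≤ ε

theorem continuous_classicalJet {φ : Plane → ℂ} (hφ : ContDiff ℝ ∞ φ) (k : Jet) :
    Continuous (classicalJet φ k) := by
  rcases k with _ | i | ⟨i, j⟩
  · exact hφ.continuous
  · exact continuous_pderiv hφ i
  · exact continuous_pderiv (contDiff_pderiv hφ i) j

theorem classicalJet_add {φ ψ : Plane → ℂ} (hφ : ContDiff ℝ ∞ φ) (hψ : ContDiff ℝ ∞ ψ) (k : Jet)
    (x : Plane) : classicalJet (φ + ψ) k x = classicalJet φ k x + classicalJet ψ k x := by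
  rcases k with _ | i | ⟨i, j⟩
  · rfl
  · exact congrFun (pderiv_add hφ hψ i) x
  · simp only [classicalJet]
    rw [pderiv_add hφ hψ, pderiv_add (contDiff_pderiv hφ i) (contDiff_pderiv hψ i)]
    rfl

theorem prodJet_add {θ θ' : Plane → ℝ} (hθ : ContDiff ℝ ∞ θ) (hθ' : ContDiff ℝ ∞ θ') (u : H2 U)
    (k : Jet) (x : Plane) : prodJet (θ + θ') u k x = prodJet θ u k x + prodJet θ' u k x := by
  rcases k with _ | i | ⟨i, j⟩
  · simp only [prodJet, Pi.add_apply, add_smul]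
  · simp only [prodJet, pderiv_add hθ hθ', Pi.add_apply, add_smul]
    abel
  · simp only [prodJet, pderiv_add hθ hθ', pderiv_add (contDiff_pderiv hθ _)
      (contDiff_pderiv hθ' _), Pi.add_apply, add_smul]
    abel

theorem Approximable.add (hU : MeasurableSet U) {u : H2 U} {θ θ' : Plane → ℝ}
    (h : Approximable u θ) (h' : Approximable u θ')
    (hθ : ContDiff ℝ ∞ θ) (hθ' : ContDiff ℝ ∞ θ') : Approximable u (θ + θ') := by
  intro ε hε
  obtain ⟨φ, h1, h2, h3⟩ := h (ε / 2) (ENNReal.half_pos hε.ne')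
  obtain ⟨ψ, h1', h2', h3'⟩ := h' (ε / 2) (ENNReal.half_pos hε.ne')
  refine ⟨φ + ψ, h1.add h1', h2.add h2', fun k => ?_⟩
  have heq : (fun x => classicalJet (φ + ψ) k x - prodJet (θ + θ') u k x) =
      (fun x => classicalJet φ k x - prodJet θ u k x) +
        fun x => classicalJet ψ k x - prodJet θ' u k x := by
    funext x
    rw [Pi.add_apply, classicalJet_add h1 h1', prodJet_add hθ hθ']
    ring
  rw [heq]
  refine (eLpNorm_add_le ?_ ?_ (by norm_num)).trans ((add_le_add (h3 k) (h3' k)).trans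
    (ENNReal.add_halves ε).le)
  · exact ((continuous_classicalJet h1 k).measurable.sub
      (measurable_prodJet hU hθ u k)).aestronglyMeasurable
  · exact ((continuous_classicalJet h1' k).measurable.sub
      (measurable_prodJet hU hθ' u k)).aestronglyMeasurable

/-- Approximation by translation and mollification. -/
theorem approximable_of_translate (hU : IsOpen U) (u : H2 U) {θ : Plane → ℝ}
    (hθ : ContDiff ℝ ∞ θ) (hc : HasCompactSupport θ) (e : Plane)
    (he : ∀ t ∈ Ioc (0 : ℝ) 1, ∃ η > (0 : ℝ), ∀ x ∈ U,
      Metric.closedBall (x + t • e) η ⊆ U ∪ (tsupport θ)ᶜ) : Approximable u θ := by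
  intro ε hε
  have hm := memLp_prodJet hU.measurableSet hθ hc u
  have hl : ∀ k, LocallyIntegrable (prodJet θ u k) := fun k =>
    (hm k).locallyIntegrable (by norm_num)
  choose δ hδ hδ' using fun k => eLpNorm_mollify_sub_le (hm k)
    (measurable_prodJet hU.measurableSet hθ u k) hε
  obtain ⟨d, hd, hd'⟩ : ∃ d > (0 : ℝ), ∀ k, d ≤ δ k := by
    obtain ⟨k, hk⟩ := Finite.exists_min δ
    exact ⟨δ k, hδ k, hk⟩
  set t : ℝ := min 1 (d / (3 * (‖e‖ + 1))) with ht
  have ht0 : 0 < t := lt_min one_pos (by positivity)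
  obtain ⟨η₀, hη₀, hball⟩ := he t ⟨ht0, min_le_left _ _⟩
  -- The half of `η₀` leaves room for the first-order identity to hold on a whole neighbourhood of
  -- the point, so that it can be differentiated once more. The thirds keep `‖a‖ + η` below `d`.
  set η := min (η₀ / 2) (d / 3) with hη
  have hηpos : 0 < η := lt_min (by linarith) (by linarith)
  set a := t • e with ha
  have hanorm : ‖a‖ ≤ d / 3 := by
    rw [ha, norm_smul, Real.norm_of_nonneg ht0.le]
    calc t * ‖e‖ ≤ d / (3 * (‖e‖ + 1)) * (‖e‖ + 1) := by
          gcongr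
          · exact min_le_right _ _
          · linarith
      _ = d / 3 := by field_simp
  let b : ContDiffBump (0 : Plane) := ⟨η / 2, η, by linarith, by linarith⟩
  set ρ : Plane → ℝ := b.normed volume with hρ
  have hρs : ContDiff ℝ ∞ ρ := b.contDiff_normed
  have hρc : HasCompactSupport ρ := b.hasCompactSupport_normed
  have hρt : tsupport ρ ⊆ Metric.closedBall 0 η := by rw [hρ, b.tsupport_normed_eq]
  have hcp : HasCompactSupport (prodJet θ u (.inl ())) := hc.smul_right
  have hsm : ∀ k, ContDiff ℝ ∞ (mollify ρ (prodJet θ u k)) := fun k =>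
    contDiff_mollify hρs hρc (hl k)
  have key1 : ∀ y, Metric.closedBall y η ⊆ U ∪ (tsupport θ)ᶜ → ∀ i,
      pderiv i (mollify ρ (prodJet θ u (.inl ()))) y = mollify ρ (prodJet θ u (.inr (.inl i))) y :=
    fun y hy i => (hasWeakPartial_prodJet hU hθ u i).mollify (hl _) hρs hρc hρt hy
  have key2 : ∀ y, Metric.closedBall y η₀ ⊆ U ∪ (tsupport θ)ᶜ → ∀ i j,
      pderiv j (pderiv i (mollify ρ (prodJet θ u (.inl ())))) y =
        mollify ρ (prodJet θ u (.inr (.inr (i, j)))) y := by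
    intro y hy i j
    have hev : pderiv i (mollify ρ (prodJet θ u (.inl ()))) =ᶠ[𝓝 y]
        mollify ρ (prodJet θ u (.inr (.inl i))) := by
      filter_upwards [Metric.ball_mem_nhds y (half_pos hη₀)] with z hz
      refine key1 z (subset_trans (Metric.closedBall_subset_closedBall' ?_) hy) i
      have := min_le_left (η₀ / 2) (d / 3)
      have := Metric.mem_ball.1 hz
      linarith
    rw [pderiv, hev.fderiv_eq]
    refine (hasWeakPartial_prodJet_second hU hθ hc u i j).mollify (hl _) hρs hρc hρt
      (subset_trans (Metric.closedBall_subset_closedBall ?_) hy)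
    have := min_le_left (η₀ / 2) (d / 3)
    linarith
  refine ⟨fun x => mollify ρ (prodJet θ u (.inl ())) (x + a),
    (hsm _).comp (contDiff_id.add contDiff_const),
    (hasCompactSupport_mollify hρc hcp).comp_homeomorph (Homeomorph.addRight a), fun k => ?_⟩
  -- The mollified function has the expected derivatives only away from the part of the boundary
  -- that meets `tsupport θ`; the shift by `a` brings every point of `U` into that region.
  have hk : ∀ x ∈ U, classicalJet (fun x => mollify ρ (prodJet θ u (.inl ())) (x + a)) k x =
      mollify ρ (prodJet θ u k) (x + a) := by
    intro x hx
    have hx' := hball x hx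
    rcases k with _ | i | ⟨i, j⟩
    · rfl
    · simp only [classicalJet]
      rw [pderiv_comp_add_right]
      refine key1 _ (subset_trans (Metric.closedBall_subset_closedBall ?_) hx') i
      have := min_le_left (η₀ / 2) (d / 3)
      linarith
    · simp only [classicalJet]
      rw [pderiv_comp_add_right, pderiv_comp_add_right]
      exact key2 _ hx' i j
  refine le_trans (le_of_eq (eLpNorm_congr_ae ?_)) ((eLpNorm_mono_measure _
    Measure.restrict_le_self).trans (hδ' k ρ η a hρs.continuous b.nonneg_normed hρc
      b.integral_normed hρt ?_))
  · exact ae_restrict_of_forall_mem hU.measurableSet fun x hx => by dsimp only; rw [hk x hx]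
  · have := hd' k
    have := min_le_right (η₀ / 2) (d / 3)
    linarith

end Cutoff

/-- Translating the compact set `tsupport θ ∩ closure Ω` by `-t e` gives a compact subset of `Ω`,
which has a closed neighbourhood inside `Ω`. So for `x` in the exterior, `x + t e` keeps a uniform
distance from that part of `closure Ω`. -/
theorem approximable_of_segment {Ω : Set Plane} (hΩ : IsOpen Ω) (u : H2 (extDomain Ω))
    {θ : Plane → ℝ} (hθ : ContDiff ℝ ∞ θ) (hc : HasCompactSupport θ) (e : Plane)
    (he : ∀ y ∈ tsupport θ ∩ closure Ω, ∀ t ∈ Ioc (0 : ℝ) 1, y - t • e ∈ Ω) :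
    Approximable u θ := by
  refine approximable_of_translate (isOpen_extDomain Ω) u hθ hc e fun t ht => ?_
  set C := (fun y => y - t • e) '' (tsupport θ ∩ closure Ω) with hC
  have hCc : IsCompact C := (hc.isCompact.inter_right isClosed_closure).image (by fun_prop)
  have hCΩ : C ⊆ Ω := by
    rintro _ ⟨y, hy, rfl⟩
    exact he y hy t ht
  obtain ⟨η, hη, hsub⟩ := hCc.exists_cthickening_subset_open hΩ hCΩ
  refine ⟨η, hη, fun x hx z hz => ?_⟩
  by_contra h
  rw [mem_union, not_or, notMem_compl_iff, notMem_compl_iff] at h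
  refine hx (subset_closure (hsub (Metric.mem_cthickening_of_dist_le x (z - t • e) η C
    ⟨z, ⟨h.2, h.1⟩, rfl⟩ ?_)))
  rw [dist_comm, dist_eq_norm, sub_sub, add_comm (t • e), ← dist_eq_norm]
  exact hz

/-- Near each boundary point, a translation moves `closure Ω` into `Ω`. -/
def HasInwardSegments (Ω : Set Plane) : Prop :=
  ∀ x ∈ frontier Ω, ∃ r > (0 : ℝ), ∃ e : Plane, ∀ y ∈ Metric.ball x r ∩ closure Ω,
    ∀ t ∈ Ioc (0 : ℝ) 1, y - t • e ∈ Ω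

/-- Induction on the cover replaces a partition of unity: a bump `b` at one centre splits `θ` into
`bθ`, supported where one direction `e` works, and `(1 - b)θ`, whose support meets the frontier only
inside the remaining balls. With no balls left the support misses the frontier and `e = 0` works. -/
theorem approximable_of_cover {Ω : Set Plane} (hΩ : IsOpen Ω) (u : H2 (extDomain Ω))
    (s : Finset Plane) (r : Plane → ℝ) (hr : ∀ x ∈ s, 0 < r x)
    (hs : ∀ x ∈ s, ∃ e : Plane, ∀ y ∈ Metric.ball x (r x) ∩ closure Ω,
      ∀ t ∈ Ioc (0 : ℝ) 1, y - t • e ∈ Ω)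
    {θ : Plane → ℝ} (hθ : ContDiff ℝ ∞ θ) (hc : HasCompactSupport θ)
    (hcov : tsupport θ ∩ frontier Ω ⊆ ⋃ x ∈ s, Metric.ball x (r x / 3)) : Approximable u θ := by
  classical
  induction s using Finset.induction_on generalizing θ with
  | empty =>
    refine approximable_of_segment hΩ u hθ hc 0 fun y hy t _ => ?_
    rw [smul_zero, sub_zero]
    by_contra hy'
    have h1 : y ∈ frontier Ω := by rw [hΩ.frontier_eq]; exact ⟨hy.2, hy'⟩
    simpa using hcov ⟨hy.1, h1⟩
  | insert x s _ ih =>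
    have hrx : 0 < r x := hr x (Finset.mem_insert_self _ _)
    let b : ContDiffBump x := ⟨r x / 3, r x / 2, by linarith, by linarith⟩
    have hb : ContDiff ℝ ∞ b := b.contDiff
    have e1 : θ = (fun y => b y * θ y) + fun y => (1 - b y) * θ y := by
      funext y
      simp only [Pi.add_apply]
      ring
    have s1 : ContDiff ℝ ∞ fun y => b y * θ y := hb.mul hθ
    have s2 : ContDiff ℝ ∞ fun y => (1 - b y) * θ y := (contDiff_const.sub hb).mul hθ
    rw [e1]
    refine Approximable.add (isOpen_extDomain Ω).measurableSet ?_ ?_ s1 s2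
    · obtain ⟨e, he⟩ := hs x (Finset.mem_insert_self _ _)
      refine approximable_of_segment hΩ u s1 hc.mul_left e fun y hy => he y ⟨?_, hy.2⟩
      have h1 : y ∈ tsupport b := tsupport_mul_subset_left hy.1
      rw [b.tsupport_eq] at h1
      exact Metric.closedBall_subset_ball (by change r x / 2 < r x; linarith) h1
    · refine ih (fun z hz => hr z (Finset.mem_insert_of_mem hz))
        (fun z hz => hs z (Finset.mem_insert_of_mem hz)) s2 hc.mul_left fun y hy => ?_
      have h1 : y ∈ tsupport θ := tsupport_mul_subset_right hy.1
      have h2 : y ∉ Metric.ball x (r x / 3) := by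
        have h3 : tsupport (fun y => (1 - b y) * θ y) ⊆ (Metric.ball x (r x / 3))ᶜ := by
          refine closure_minimal (fun z hz hz' => hz ?_) Metric.isOpen_ball.isClosed_compl
          change (1 - b z) * θ z = 0
          rw [b.one_of_mem_closedBall (Metric.ball_subset_closedBall hz'), sub_self, zero_mul]
        exact h3 hy.1
      have h4 := hcov ⟨h1, hy.2⟩
      rw [Finset.set_biUnion_insert] at h4
      exact h4.resolve_left h2

theorem approximable {Ω : Set Plane} (hΩ : IsOpen Ω) (hseg : HasInwardSegments Ω)
    (u : H2 (extDomain Ω)) {θ : Plane → ℝ} (hθ : ContDiff ℝ ∞ θ) (hc : HasCompactSupport θ) :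
    Approximable u θ := by
  choose! r hr he using hseg
  obtain ⟨t, ht, hcov⟩ := (hc.isCompact.inter_right isClosed_frontier).elim_nhds_subcover
    (fun x => Metric.ball x (r x / 3)) fun x hx => Metric.ball_mem_nhds _ (by linarith [hr x hx.2])
  exact approximable_of_cover hΩ u t r (fun x hx => hr x (ht x hx).2)
    (fun x hx => he x (ht x hx).2) hθ hc hcov

/-! ### Cutoffs at infinity and density in `H²` -/

theorem pderiv_comp_smul {φ : Plane → ℝ} (c : ℝ) (i : Fin 2) :
    pderiv i (fun x => φ (c • x)) = fun x => c * pderiv i φ (c • x) := by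
  funext x
  rw [pderiv, fderiv_comp_smul]
  rfl

theorem pderiv_const_mul {φ : Plane → ℝ} (hφ : Differentiable ℝ φ) (c : ℝ) (i : Fin 2) :
    pderiv i (fun x => c * φ x) = fun x => c * pderiv i φ x := by
  funext x
  rw [pderiv, fderiv_const_mul (hφ x)]
  rfl

theorem tendsto_eLpNorm_cutoff_sub {f : Plane → ℂ} (hf : MemLp f 2) (hfm : Measurable f)
    {χ : Plane → ℝ} (hχ : Continuous χ) (h1 : ∀ᶠ x in 𝓝 0, χ x = 1) (h01 : ∀ x, |χ x| ≤ 1) :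
    Tendsto (fun c : ℝ => eLpNorm (fun x => χ (c • x) • f x - f x) 2 volume) (𝓝 0) (𝓝 0) := by
  have hsq : Tendsto (fun c : ℝ => eLpNorm (fun x => χ (c • x) • f x - f x) 2 volume ^ 2)
      (𝓝 0) (𝓝 0) := by
    simp only [eLpNorm_two_sq]
    have hfin : ∫⁻ x, (2 * ‖f x‖ₑ) ^ 2 ≠ ⊤ := by
      simp only [mul_pow]
      rw [lintegral_const_mul _ (by fun_prop), ← eLpNorm_two_sq]
      exact ENNReal.mul_ne_top (by simp) (ENNReal.pow_ne_top hf.eLpNorm_ne_top)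
    have := tendsto_lintegral_filter_of_dominated_convergence (μ := volume) (l := 𝓝 (0 : ℝ))
      (F := fun c x => ‖χ (c • x) • f x - f x‖ₑ ^ 2) (f := fun _ => 0)
      (fun x => (2 * ‖f x‖ₑ) ^ 2) (Eventually.of_forall fun c => by
        have := hχ.measurable
        fun_prop) (Eventually.of_forall fun c => Eventually.of_forall fun x => ?_) hfin
      (Eventually.of_forall fun x => ?_)
    · simpa using this
    · gcongr
      refine enorm_sub_le.trans ?_
      rw [two_mul, enorm_smul]
      gcongr
      refine mul_le_of_le_one_left' ?_
      rw [Real.enorm_eq_ofReal_abs]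
      exact ENNReal.ofReal_le_one.2 (h01 _)
    · refine tendsto_const_nhds.congr' ?_
      have hc : Tendsto (fun c : ℝ => c • x) (𝓝 0) (𝓝 0) := by
        have : Continuous fun c : ℝ => c • x := by fun_prop
        simpa using this.tendsto 0
      filter_upwards [hc.eventually h1] with c hc
      simp [hc]
  have h := (ENNReal.continuous_rpow_const (y := (1 / 2 : ℝ))).tendsto 0 |>.comp hsq
  rw [ENNReal.zero_rpow_of_pos (by norm_num)] at h
  refine h.congr fun c => ?_
  rw [Function.comp_apply, ← ENNReal.rpow_natCast, ← ENNReal.rpow_mul]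
  norm_num

theorem tendsto_eLpNorm_mul_comp_smul {f : Plane → ℂ} (hf : MemLp f 2)
    {ψ : Plane → ℝ} (hψ : Continuous ψ) (hc : HasCompactSupport ψ) {a : ℝ → ℝ}
    (ha : Tendsto a (𝓝 0) (𝓝 0)) :
    Tendsto (fun c : ℝ => eLpNorm (fun x => (a c * ψ (c • x)) • f x) 2 volume) (𝓝 0) (𝓝 0) := by
  obtain ⟨M, hM⟩ := hψ.bounded_above_of_compact_support hc
  have hM0 : 0 ≤ M := (norm_nonneg _).trans (hM 0)
  refine tendsto_of_tendsto_of_tendsto_of_le_of_le tendsto_const_nhds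
    (h := fun c => ENNReal.ofReal (|a c| * M) * eLpNorm f 2 volume) ?_ (fun _ => zero_le) fun c => ?_
  · have h1 : Tendsto (fun c => ENNReal.ofReal (|a c| * M)) (𝓝 0) (𝓝 0) := by
      have := ENNReal.tendsto_ofReal ((ha.abs).mul_const M)
      simpa using this
    simpa using ENNReal.Tendsto.mul_const h1 (Or.inr hf.eLpNorm_ne_top)
  · refine eLpNorm_le_mul_eLpNorm_of_ae_le_mul (Eventually.of_forall fun x => ?_) 2
    rw [norm_smul, norm_mul, Real.norm_eq_abs (a c)]
    gcongr
    exact hM _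

/-- Each derivative that falls on `χ (c ·)` produces a factor `c`, so only the terms with an
undifferentiated cutoff survive, and these converge by dominated convergence. -/
theorem tendsto_prodJet_cutoff {U : Set Plane} (hU : MeasurableSet U) (u : H2 U)
    {χ : Plane → ℝ} (hχ : ContDiff ℝ ∞ χ) (hc : HasCompactSupport χ) (h1 : ∀ᶠ x in 𝓝 0, χ x = 1)
    (h01 : ∀ x, |χ x| ≤ 1) (k : Jet) :
    Tendsto (fun c : ℝ => eLpNorm (fun x => prodJet (fun y => χ (c • y)) u k x - extJet u k x) 2
      volume) (𝓝 0) (𝓝 0) := by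
  have hm := memLp_extJet hU u
  have hmm := measurable_extJet hU u
  have hχm := hχ.continuous.measurable
  have hd1 := fun i => (continuous_pderiv hχ i).measurable
  have hd2 := fun i j => (continuous_pderiv (contDiff_pderiv hχ i) j).measurable
  have t0 := fun k => tendsto_eLpNorm_cutoff_sub (hm k) (hmm k) hχ.continuous h1 h01
  have t1 := fun i k => tendsto_eLpNorm_mul_comp_smul (hm k) (continuous_pderiv hχ i)
    (hasCompactSupport_pderiv hc i) (a := fun c => c) tendsto_id
  have t2 := fun i j k => tendsto_eLpNorm_mul_comp_smul (hm k)
    (continuous_pderiv (contDiff_pderiv hχ i) j)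
    (hasCompactSupport_pderiv (hasCompactSupport_pderiv hc i) j) (a := fun c => c * c)
    (by simpa using (tendsto_id (α := ℝ) (x := 𝓝 0)).mul (tendsto_id (α := ℝ) (x := 𝓝 0)))
  have e1 : ∀ (c : ℝ) i, pderiv i (fun y => χ (c • y)) = fun y => c * pderiv i χ (c • y) :=
    fun c i => pderiv_comp_smul c i
  have e2 : ∀ (c : ℝ) i j, pderiv j (pderiv i (fun y => χ (c • y))) =
      fun y => (c * c) * pderiv j (pderiv i χ) (c • y) := fun c i j => by
    rw [e1, pderiv_const_mul, pderiv_comp_smul]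
    · funext y
      ring
    · exact ((contDiff_pderiv hχ i).comp (contDiff_const_smul c)).differentiable (by simp)
  rcases k with _ | i | ⟨i, j⟩
  · exact t0 _
  · have ht := (t1 i (.inl ())).add (t0 (.inr (.inl i)))
    rw [add_zero] at ht
    refine tendsto_of_tendsto_of_tendsto_of_le_of_le tendsto_const_nhds ht
      (fun _ => zero_le) fun c => ?_
    refine le_trans (le_of_eq (congrArg (fun g => eLpNorm g 2 volume) ?_))
      (eLpNorm_add_le ?_ ?_ (by norm_num))
    · funext x
      simp only [prodJet, e1, Pi.add_apply]
      ring
    · have := hmm (.inl ()); have := hd1 i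
      exact Measurable.aestronglyMeasurable (by fun_prop)
    · have := hmm (.inr (.inl i))
      exact Measurable.aestronglyMeasurable (by fun_prop)
  · have ht := ((t2 i j (.inl ())).add (t1 i (.inr (.inl j)))).add
      ((t1 j (.inr (.inl i))).add (t0 (.inr (.inr (i, j)))))
    simp only [add_zero] at ht
    refine tendsto_of_tendsto_of_tendsto_of_le_of_le tendsto_const_nhds ht
      (fun _ => zero_le) fun c => ?_
    have := hmm (.inl ()); have := hmm (.inr (.inl j)); have := hmm (.inr (.inl i))
    have := hmm (.inr (.inr (i, j))); have := hd1 i; have := hd1 j; have := hd2 i j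
    refine le_trans (le_of_eq (congrArg (fun g => eLpNorm g 2 volume) ?_))
      ((eLpNorm_add_le (f := _ + _) (g := _ + _) ?_ ?_ (by norm_num)).trans
        (add_le_add (eLpNorm_add_le ?_ ?_ (by norm_num)) (eLpNorm_add_le ?_ ?_ (by norm_num))))
    · funext x
      simp only [prodJet, e2, Pi.add_apply]
      simp only [e1]
      ring
    all_goals
      exact Measurable.aestronglyMeasurable (by fun_prop)

theorem coeFn_toH2 {U : Set Plane} {φ : Plane → ℂ} (h : ContDiff ℝ ∞ φ)
    (hc : HasCompactSupport φ) (k : Jet) :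
    ((toH2 U h hc).1 k : Plane → ℂ) =ᵐ[volume.restrict U] classicalJet φ k := by
  rcases k with _ | i | ⟨i, j⟩
  · exact (memLp_of_test h hc).coeFn_toLp
  · exact (memLp_of_test (contDiff_pderiv h i) (hasCompactSupport_pderiv hc i)).coeFn_toLp
  · exact (memLp_of_test (contDiff_pderiv (contDiff_pderiv h i) j)
      (hasCompactSupport_pderiv (hasCompactSupport_pderiv hc i) j)).coeFn_toLp

/-- Restrictions of test functions are dense in `H²(Ω^ext)`. -/
theorem denseRange_restrictExt {Ω : Set Plane} (hΩ : IsOpen Ω) (hseg : HasInwardSegments Ω)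
    (htest : ∀ φ : Plane → ℂ, ContDiff ℝ ∞ φ → HasCompactSupport φ → MemLp φ 2 (arcLength Ω)) :
    DenseRange (restrictExt Ω) := by
  intro u
  have hU : IsOpen (extDomain Ω) := isOpen_extDomain Ω
  let b : ContDiffBump (0 : Plane) := ⟨1, 2, one_pos, one_lt_two⟩
  have hb1 : ∀ᶠ x in 𝓝 0, b x = 1 := b.eventuallyEq_one
  have hb2 : ∀ x, |b x| ≤ 1 := fun x => by rw [abs_of_nonneg b.nonneg]; exact b.le_one
  have key : ∀ n : ℕ, ∃ φ : Plane → ℂ, ContDiff ℝ ∞ φ ∧ HasCompactSupport φ ∧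
      ∀ k, eLpNorm (fun x => classicalJet φ k x - extJet u k x) 2 (volume.restrict (extDomain Ω)) ≤
        ((n : ℝ≥0∞) + 1)⁻¹ := by
    intro n
    set ε : ℝ≥0∞ := ((n : ℝ≥0∞) + 1)⁻¹ with hε
    have hε0 : 0 < ε := ENNReal.inv_pos.2 (by simp)
    -- The value `c = 0` is excluded because `b (c ·)` would be constant, not compactly supported.
    have h1 : ∀ᶠ c : ℝ in 𝓝[≠] 0, ∀ k, eLpNorm (fun x => prodJet (fun y => b (c • y)) u k x -
        extJet u k x) 2 volume ≤ ε / 2 :=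
      eventually_all.2 fun k => ((tendsto_prodJet_cutoff hU.measurableSet u b.contDiff
        b.hasCompactSupport hb1 hb2 k).eventually
        (Iic_mem_nhds (ENNReal.half_pos hε0.ne'))).filter_mono nhdsWithin_le_nhds
    obtain ⟨c, hc, hc0⟩ := (h1.and self_mem_nhdsWithin).exists
    have hs : ContDiff ℝ ∞ fun y => b (c • y) := b.contDiff.comp (contDiff_const_smul c)
    have hcs : HasCompactSupport fun y => b (c • y) :=
      b.hasCompactSupport.comp_smul hc0
    obtain ⟨φ, hφ, hφc, hφ'⟩ := approximable hΩ hseg u hs hcs (ε / 2) (ENNReal.half_pos hε0.ne')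
    refine ⟨φ, hφ, hφc, fun k => ?_⟩
    refine le_trans (le_of_eq (congrArg (fun g => eLpNorm g 2 (volume.restrict (extDomain Ω))) ?_))
      ((eLpNorm_add_le ?_ ?_ (by norm_num)).trans ((add_le_add (hφ' k)
        ((eLpNorm_mono_measure _ Measure.restrict_le_self).trans (hc k))).trans
        (ENNReal.add_halves ε).le))
    · funext x
      simp only [Pi.add_apply]
      ring
    · exact ((continuous_classicalJet hφ k).measurable.sub
        (measurable_prodJet hU.measurableSet hs u k)).aestronglyMeasurable
    · exact ((measurable_prodJet hU.measurableSet hs u k).sub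
        (measurable_extJet hU.measurableSet u k)).aestronglyMeasurable
  choose φ hφ hφc hφ' using key
  refine mem_closure_of_tendsto (f := fun n => restrictExt Ω ⟨φ n, hφ n, hφc n,
    htest _ (hφ n) (hφc n)⟩) (b := atTop) ?_ (Eventually.of_forall fun n => mem_range_self _)
  rw [tendsto_subtype_rng]
  have hpi : Tendsto (fun (n : ℕ) (k : Jet) => (toH2 (extDomain Ω) (hφ n) (hφc n)).1 k) atTop
      (𝓝 fun k => u.1 k) := by
    refine tendsto_pi_nhds.2 fun k => tendsto_iff_edist_tendsto_0.2 ?_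
    have hlim : Tendsto (fun n : ℕ => ((n : ℝ≥0∞) + 1)⁻¹) atTop (𝓝 0) := by
      have := ENNReal.tendsto_inv_nat_nhds_zero.comp (tendsto_add_atTop_nat 1)
      refine this.congr fun n => ?_
      simp
    refine tendsto_of_tendsto_of_tendsto_of_le_of_le tendsto_const_nhds hlim
      (fun _ => zero_le) fun n => le_trans (le_of_eq ?_) (hφ' n k)
    rw [Lp.edist_def]
    refine eLpNorm_congr_ae ?_
    have h1 : ((toH2 (extDomain Ω) (hφ n) (hφc n)).1 k : Plane → ℂ) =ᵐ[volume.restrict (extDomain Ω)]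
        classicalJet (φ n) k := coeFn_toH2 (hφ n) (hφc n) k
    filter_upwards [h1, ae_restrict_mem hU.measurableSet] with x hx hxU
    rw [Pi.sub_apply, hx, extJet, indicator_of_mem hxU]
  have hlim := ((PiLp.continuous_toLp 2 fun _ : Jet => L2 (extDomain Ω)).tendsto _).comp hpi
  exact hlim

/-! ### One-dimensional estimates -/

theorem enorm_add_sq_le {E : Type*} [NormedAddCommGroup E] (a b : E) :
    ‖a + b‖ₑ ^ 2 ≤ 2 * (‖a‖ₑ ^ 2 + ‖b‖ₑ ^ 2) := by
  have h : ‖a + b‖ ^ 2 ≤ 2 * (‖a‖ ^ 2 + ‖b‖ ^ 2) :=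
    (pow_le_pow_left₀ (norm_nonneg _) (norm_add_le a b) 2).trans add_sq_le
  have h3 := ENNReal.ofReal_le_ofReal h
  rw [ENNReal.ofReal_mul (by norm_num), ENNReal.ofReal_add (by positivity) (by positivity),
    ENNReal.ofReal_pow (norm_nonneg _), ENNReal.ofReal_pow (norm_nonneg _),
    ENNReal.ofReal_pow (norm_nonneg _), ofReal_norm, ofReal_norm, ofReal_norm] at h3
  simpa using h3

theorem sq_setLIntegral_le (a b : ℝ) {f : ℝ → ℝ≥0∞} (hf : Measurable f) :
    (∫⁻ t in Ioc a b, f t) ^ 2 ≤ ENNReal.ofReal (b - a) * ∫⁻ t in Ioc a b, f t ^ 2 := by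
  have h := sq_lintegral_mul_le (volume.restrict (Ioc a b)) (f := fun _ => 1)
    aemeasurable_const hf.aemeasurable
  simpa using h

/-- Integrate the derivative of `F = w g' - w' g` with the cubic `w = (1 - t)²(1 + 2t)`. Since `w 0
= 1`, `w 1 = 0` and `w'` vanishes at both ends, the boundary terms leave only `-g' 0`, while `F' = w
g'' - w'' g` contains no `g'`. The constant comes from `|w| ≤ 1` and `|w''| ≤ 6` on the unit
interval. -/
theorem enorm_deriv_sq_le {g g' g'' : ℝ → ℂ} (h1 : ∀ t, HasDerivAt g (g' t) t)
    (h2 : ∀ t, HasDerivAt g' (g'' t) t) (hc : Continuous g'') :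
    ‖g' 0‖ₑ ^ 2 ≤ 72 * ∫⁻ t in Ioc (0 : ℝ) 1, (‖g t‖ₑ ^ 2 + ‖g'' t‖ₑ ^ 2) := by
  have hg : Continuous g := continuous_iff_continuousAt.2 fun t => (h1 t).continuousAt
  set F : ℝ → ℂ := fun t => (((1 - t) ^ 2 * (1 + 2 * t) : ℝ) : ℂ) * g' t -
    ((-6 * t * (1 - t) : ℝ) : ℂ) * g t
  set F' : ℝ → ℂ := fun t => (((1 - t) ^ 2 * (1 + 2 * t) : ℝ) : ℂ) * g'' t -
    ((12 * t - 6 : ℝ) : ℂ) * g t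
  have hF : ∀ t, HasDerivAt F (F' t) t := by
    intro t
    have e1 : HasDerivAt (fun t : ℝ => (1 - t) ^ 2 * (1 + 2 * t)) (-6 * t * (1 - t)) t := by
      have := (((hasDerivAt_id t).const_sub 1).pow 2).mul (((hasDerivAt_id t).const_mul 2).const_add 1)
      convert! this using 1
      simp
      ring
    have e2 : HasDerivAt (fun t : ℝ => -6 * t * (1 - t)) (12 * t - 6) t := by
      have := ((hasDerivAt_id t).const_mul (-6)).mul ((hasDerivAt_id t).const_sub 1)
      convert! this using 1
      simp
      ring
    have := (e1.ofReal_comp.mul (h2 t)).sub (e2.ofReal_comp.mul (h1 t))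
    convert! this using 1
    ring
  have hF'c : Continuous F' := by fun_prop
  have hint := intervalIntegral.integral_eq_sub_of_hasDerivAt (a := 0) (b := 1) (fun t _ => hF t)
    (hF'c.intervalIntegrable 0 1)
  have hval : F 1 - F 0 = - g' 0 := by simp [F]
  rw [hval, intervalIntegral.integral_of_le zero_le_one] at hint
  calc ‖g' 0‖ₑ ^ 2 = ‖∫ t in Ioc (0 : ℝ) 1, F' t‖ₑ ^ 2 := by rw [hint, enorm_neg]
    _ ≤ (∫⁻ t in Ioc (0 : ℝ) 1, ‖F' t‖ₑ) ^ 2 := by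
        gcongr; exact enorm_integral_le_lintegral_enorm _
    _ ≤ ∫⁻ t in Ioc (0 : ℝ) 1, ‖F' t‖ₑ ^ 2 := by
        have := sq_setLIntegral_le 0 1 (f := fun t => ‖F' t‖ₑ)
          hF'c.measurable.enorm
        simpa using this
    _ ≤ ∫⁻ t in Ioc (0 : ℝ) 1, 72 * (‖g t‖ₑ ^ 2 + ‖g'' t‖ₑ ^ 2) := by
        refine setLIntegral_mono (by fun_prop) fun t ht => ?_
        have hn : ‖F' t‖ ≤ ‖g'' t‖ + 6 * ‖g t‖ := by
          refine (norm_sub_le _ _).trans ?_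
          rw [norm_mul, norm_mul, Complex.norm_real, Complex.norm_real]
          have a1 : ‖(1 - t) ^ 2 * (1 + 2 * t)‖ ≤ 1 := by
            rw [Real.norm_eq_abs, abs_le]
            have : 0 ≤ t ^ 2 * (3 - 2 * t) := mul_nonneg (sq_nonneg _) (by linarith [ht.2])
            constructor
            · have : 0 ≤ (1 - t) ^ 2 * (1 + 2 * t) := mul_nonneg (sq_nonneg _) (by linarith [ht.1])
              linarith
            · nlinarith
          have a2 : ‖12 * t - 6‖ ≤ 6 := by
            rw [Real.norm_eq_abs, abs_le]
            constructor <;> linarith [ht.1, ht.2]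
          refine add_le_add (mul_le_of_le_one_left (norm_nonneg _) a1) ?_
          gcongr
        have hn2 : ‖F' t‖ ^ 2 ≤ 72 * (‖g t‖ ^ 2 + ‖g'' t‖ ^ 2) := by
          have := pow_le_pow_left₀ (norm_nonneg _) hn 2
          nlinarith [sq_nonneg (‖g'' t‖ - 6 * ‖g t‖), sq_nonneg ‖g'' t‖]
        have h3 := ENNReal.ofReal_le_ofReal hn2
        rw [ENNReal.ofReal_mul (by norm_num), ENNReal.ofReal_add (by positivity) (by positivity),
          ENNReal.ofReal_pow (norm_nonneg _), ENNReal.ofReal_pow (norm_nonneg _),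
          ENNReal.ofReal_pow (norm_nonneg _), ofReal_norm, ofReal_norm, ofReal_norm] at h3
        simpa using h3
    _ = _ := lintegral_const_mul _ (by fun_prop)

theorem enorm_sub_sq_le {g g' : ℝ → ℂ} (h1 : ∀ t, HasDerivAt g (g' t) t) (hc : Continuous g')
    {a b : ℝ} (hab : a ≤ b) :
    ‖g b - g a‖ₑ ^ 2 ≤ ENNReal.ofReal (b - a) * ∫⁻ t in Ioc a b, ‖g' t‖ₑ ^ 2 := by
  have hint := intervalIntegral.integral_eq_sub_of_hasDerivAt (a := a) (b := b) (fun t _ => h1 t)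
    (hc.intervalIntegrable a b)
  rw [intervalIntegral.integral_of_le hab] at hint
  rw [← hint]
  calc _ ≤ (∫⁻ t in Ioc a b, ‖g' t‖ₑ) ^ 2 := by
        gcongr; exact enorm_integral_le_lintegral_enorm _
    _ ≤ _ := sq_setLIntegral_le a b hc.measurable.enorm

/-- Write `g 0 = g t - (g t - g 0)` and average over `t`. Averaging only over `(c/2, c]` matters:
after integration along the boundary, `g` is evaluated at a positive distance from it, hence on a
compact subset of the exterior. -/
theorem enorm_zero_sq_le {g g' : ℝ → ℂ} (h1 : ∀ t, HasDerivAt g (g' t) t) (hc : Continuous g')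
    {c : ℝ} (hc0 : 0 < c) :
    ‖g 0‖ₑ ^ 2 ≤ ENNReal.ofReal (4 / c) * (∫⁻ t in Ioc (c / 2) c, ‖g t‖ₑ ^ 2) +
      ENNReal.ofReal (2 * c) * ∫⁻ t in Ioc 0 c, ‖g' t‖ₑ ^ 2 := by
  have hg : Continuous g := continuous_iff_continuousAt.2 fun t => (h1 t).continuousAt
  set I := ∫⁻ t in Ioc 0 c, ‖g' t‖ₑ ^ 2 with hI
  have hpt : ∀ t ∈ Ioc (c / 2) c, ‖g 0‖ₑ ^ 2 ≤ 2 * (‖g t‖ₑ ^ 2 + ENNReal.ofReal c * I) := by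
    intro t ht
    have ht0 : 0 ≤ t := by linarith [ht.1]
    have e : g 0 = g t + -(g t - g 0) := by ring
    rw [e]
    refine (enorm_add_sq_le _ _).trans ?_
    rw [enorm_neg]
    gcongr
    refine (enorm_sub_sq_le h1 hc ht0).trans ?_
    rw [sub_zero]
    exact mul_le_mul' (ENNReal.ofReal_le_ofReal ht.2)
      (lintegral_mono_set (Ioc_subset_Ioc_right ht.2))
  have hint : ∫⁻ t in Ioc (c / 2) c, ‖g 0‖ₑ ^ 2 ≤
      ∫⁻ t in Ioc (c / 2) c, 2 * (‖g t‖ₑ ^ 2 + ENNReal.ofReal c * I) :=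
    setLIntegral_mono (by fun_prop) hpt
  rw [setLIntegral_const, lintegral_const_mul _ (by fun_prop), lintegral_add_right _ (by fun_prop),
    setLIntegral_const, Real.volume_Ioc, show c - c / 2 = c / 2 by ring] at hint
  have h2 : ENNReal.ofReal (2 / c) * ENNReal.ofReal (c / 2) = 1 := by
    rw [← ENNReal.ofReal_mul (by positivity)]
    have : 2 / c * (c / 2) = 1 := by field_simp
    rw [this, ENNReal.ofReal_one]
  have e4 : ENNReal.ofReal (4 / c) = ENNReal.ofReal (2 / c) * 2 := by
    rw [show (4 / c : ℝ) = 2 / c * 2 by ring, ENNReal.ofReal_mul (by positivity)]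
    simp
  have e2 : ENNReal.ofReal (2 * c) = 2 * ENNReal.ofReal c := by
    rw [ENNReal.ofReal_mul (by norm_num)]
    simp
  calc ‖g 0‖ₑ ^ 2 = ENNReal.ofReal (2 / c) * (‖g 0‖ₑ ^ 2 * ENNReal.ofReal (c / 2)) := by
        rw [mul_left_comm, h2, mul_one]
    _ ≤ ENNReal.ofReal (2 / c) * _ := mul_le_mul' le_rfl hint
    _ = ENNReal.ofReal (4 / c) * (∫⁻ t in Ioc (c / 2) c, ‖g t‖ₑ ^ 2) +
        2 * ENNReal.ofReal c * I * (ENNReal.ofReal (2 / c) * ENNReal.ofReal (c / 2)) := by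
        rw [e4]
        generalize ENNReal.ofReal (2 / c) = x
        generalize ENNReal.ofReal (c / 2) = y
        ring
    _ = _ := by rw [h2, mul_one, e2]

/-! ### Directional derivatives -/

/-- The directional derivative. -/
noncomputable def lineD (e : Plane) (φ : Plane → ℂ) (x : Plane) : ℂ := fderiv ℝ φ x e

theorem contDiff_lineD {φ : Plane → ℂ} (hφ : ContDiff ℝ ∞ φ) (e : Plane) :
    ContDiff ℝ ∞ (lineD e φ) := (hφ.fderiv_right (by simp)).clm_apply contDiff_const

theorem hasDerivAt_line {φ : Plane → ℂ} (hφ : ContDiff ℝ ∞ φ) (y e : Plane) (t : ℝ) :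
    HasDerivAt (fun t : ℝ => φ (y + t • e)) (lineD e φ (y + t • e)) t := by
  have h := (hφ.differentiable (by simp) (y + t • e)).hasFDerivAt.comp_hasDerivAt t
    (((hasDerivAt_id t).smul_const e).const_add y)
  simpa [lineD, Function.comp_def] using h

theorem lineD_add_smul {φ : Plane → ℂ} (a b : ℝ) (e f : Plane) (x : Plane) :
    lineD (a • e + b • f) φ x = a • lineD e φ x + b • lineD f φ x := by
  simp [lineD]

theorem plane_eq_sum (e : Plane) :
    e = e 0 • EuclideanSpace.single 0 1 + e 1 • EuclideanSpace.single 1 1 := by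
  ext i
  fin_cases i <;> simp

theorem lineD_eq {φ : Plane → ℂ} (e : Plane) :
    lineD e φ = fun x => e 0 • pderiv 0 φ x + e 1 • pderiv 1 φ x := by
  funext x
  conv_lhs => rw [plane_eq_sum e]
  exact lineD_add_smul _ _ _ _ _

theorem lineD_sq_le {φ : Plane → ℂ} (e : Plane) (x : Plane) :
    ‖lineD e φ x‖ₑ ^ 2 ≤ ENNReal.ofReal (‖e‖ ^ 2) * ∑ i, ‖pderiv i φ x‖ₑ ^ 2 := by
  have h1 : ‖lineD e φ x‖ ^ 2 ≤ ‖e‖ ^ 2 * ∑ i, ‖pderiv i φ x‖ ^ 2 := by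
    rw [lineD_eq, EuclideanSpace.norm_sq_eq, Fin.sum_univ_two, Fin.sum_univ_two, Real.norm_eq_abs,
      Real.norm_eq_abs, sq_abs, sq_abs]
    have h2 : ‖e 0 • pderiv 0 φ x + e 1 • pderiv 1 φ x‖ ≤
        |e 0| * ‖pderiv 0 φ x‖ + |e 1| * ‖pderiv 1 φ x‖ := by
      refine (norm_add_le _ _).trans ?_
      rw [norm_smul, norm_smul, Real.norm_eq_abs, Real.norm_eq_abs]
    refine (pow_le_pow_left₀ (norm_nonneg _) h2 2).trans ?_
    rw [← sq_abs (e 0), ← sq_abs (e 1)]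
    nlinarith [sq_nonneg (|e 0| * ‖pderiv 1 φ x‖ - |e 1| * ‖pderiv 0 φ x‖)]
  have h3 := ENNReal.ofReal_le_ofReal h1
  rw [ENNReal.ofReal_mul (sq_nonneg _), ENNReal.ofReal_pow (norm_nonneg _), ofReal_norm,
    ENNReal.ofReal_sum_of_nonneg fun i _ => sq_nonneg _] at h3
  refine h3.trans (le_of_eq ?_)
  congr 1
  refine Finset.sum_congr rfl fun i _ => ?_
  rw [ENNReal.ofReal_pow (norm_nonneg _), ofReal_norm]

theorem contDiff_lineD_lineD_sq_le {φ : Plane → ℂ} (hφ : ContDiff ℝ ∞ φ) (e : Plane) (x : Plane) :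
    ‖lineD e (lineD e φ) x‖ₑ ^ 2 ≤
      ENNReal.ofReal (2 * ‖e‖ ^ 4) * ∑ i, ∑ j, ‖pderiv j (pderiv i φ) x‖ₑ ^ 2 := by
  have h0 : ∀ i, ContDiff ℝ ∞ (pderiv i φ) := contDiff_pderiv hφ
  have h1 : lineD e (lineD e φ) x = e 0 • lineD e (pderiv 0 φ) x + e 1 • lineD e (pderiv 1 φ) x := by
    rw [lineD_eq (φ := φ) e]
    simp only [lineD]
    rw [fderiv_fun_add (((h0 0).differentiable (by simp) x).fun_const_smul (e 0))
      (((h0 1).differentiable (by simp) x).fun_const_smul (e 1)),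
      fderiv_fun_const_smul ((h0 0).differentiable (by simp) x),
      fderiv_fun_const_smul ((h0 1).differentiable (by simp) x)]
    rfl
  have hcoord : ∀ i, ‖e i‖ₑ ^ 2 ≤ ENNReal.ofReal (‖e‖ ^ 2) := fun i => by
    rw [ENNReal.ofReal_pow (norm_nonneg _), ← ofReal_norm]
    gcongr
    exact PiLp.norm_apply_le e i
  rw [h1]
  refine (enorm_add_sq_le _ _).trans ?_
  rw [enorm_smul, enorm_smul, mul_pow, mul_pow]
  calc _ ≤ 2 * (ENNReal.ofReal (‖e‖ ^ 2) *
            (ENNReal.ofReal (‖e‖ ^ 2) * ∑ j, ‖pderiv j (pderiv 0 φ) x‖ₑ ^ 2) +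
          ENNReal.ofReal (‖e‖ ^ 2) *
            (ENNReal.ofReal (‖e‖ ^ 2) * ∑ j, ‖pderiv j (pderiv 1 φ) x‖ₑ ^ 2)) := by
        gcongr
        · exact hcoord 0
        · exact lineD_sq_le e x
        · exact hcoord 1
        · exact lineD_sq_le e x
    _ = _ := by
      rw [Fin.sum_univ_two (f := fun i => ∑ j, ‖pderiv j (pderiv i φ) x‖ₑ ^ 2),
        show 2 * ‖e‖ ^ 4 = 2 * (‖e‖ ^ 2 * ‖e‖ ^ 2) by ring, ENNReal.ofReal_mul (by norm_num),
        ENNReal.ofReal_mul (sq_nonneg _)]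
      simp only [ENNReal.ofReal_ofNat]
      ring

/-! ### The interpolation inequality -/

/-- For each fixed `t` the translate `A + t e` lies in `U` and translation preserves the measure;
the range of `t` has length one. -/
theorem lintegral_sweep_le {A U : Set Plane} (hA : MeasurableSet A) (hU : MeasurableSet U)
    {e : Plane} (he : ∀ y ∈ A, ∀ t ∈ Ioc (0 : ℝ) 1, y + t • e ∈ U) {F : Plane → ℝ≥0∞}
    (hF : Measurable F) :
    ∫⁻ y in A, ∫⁻ t in Ioc (0 : ℝ) 1, F (y + t • e) ≤ ∫⁻ x in U, F x := by
  rw [lintegral_lintegral_swap (by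
    have : Measurable fun p : Plane × ℝ => F (p.1 + p.2 • e) := by fun_prop
    exact this.aemeasurable)]
  calc _ ≤ ∫⁻ t in Ioc (0 : ℝ) 1, ∫⁻ x in U, F x := by
        refine setLIntegral_mono measurable_const fun t ht => ?_
        rw [← lintegral_indicator hA, ← lintegral_indicator hU,
          ← lintegral_add_right_eq_self (U.indicator F) (t • e)]
        refine lintegral_mono fun y => ?_
        by_cases hy : y ∈ A
        · rw [indicator_of_mem hy, indicator_of_mem (he y hy t ht)]
        · rw [indicator_of_notMem hy]
          exact zero_le
    _ = _ := by simp

theorem lintegral_lineD_sq_le {A U : Set Plane} (hA : MeasurableSet A) (hU : MeasurableSet U)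
    {e : Plane} (he : ∀ y ∈ A, ∀ t ∈ Ioc (0 : ℝ) 1, y + t • e ∈ U) {φ : Plane → ℂ}
    (hφ : ContDiff ℝ ∞ φ) :
    ∫⁻ y in A, ‖lineD e φ y‖ₑ ^ 2 ≤
      72 * ∫⁻ x in U, (‖φ x‖ₑ ^ 2 + ‖lineD e (lineD e φ) x‖ₑ ^ 2) := by
  have hm1 := hφ.continuous.measurable
  have hc := (contDiff_lineD (contDiff_lineD hφ e) e).continuous
  have hm2 := hc.measurable
  calc _ ≤ ∫⁻ y in A, 72 * ∫⁻ t in Ioc (0 : ℝ) 1,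
        (‖φ (y + t • e)‖ₑ ^ 2 + ‖lineD e (lineD e φ) (y + t • e)‖ₑ ^ 2) := by
        refine lintegral_mono fun y => ?_
        have := enorm_deriv_sq_le (hasDerivAt_line hφ y e)
          (hasDerivAt_line (contDiff_lineD hφ e) y e) (by fun_prop)
        simpa using this
    _ = 72 * ∫⁻ y in A, ∫⁻ t in Ioc (0 : ℝ) 1,
        (‖φ (y + t • e)‖ₑ ^ 2 + ‖lineD e (lineD e φ) (y + t • e)‖ₑ ^ 2) := by
        refine lintegral_const_mul _ (Measurable.lintegral_prod_right' (f := fun p : Plane × ℝ =>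
          ‖φ (p.1 + p.2 • e)‖ₑ ^ 2 + ‖lineD e (lineD e φ) (p.1 + p.2 • e)‖ₑ ^ 2) ?_)
        fun_prop
    _ ≤ _ := by
        refine mul_le_mul' le_rfl ?_
        exact lintegral_sweep_le hA hU he (F := fun x => ‖φ x‖ₑ ^ 2 +
          ‖lineD e (lineD e φ) x‖ₑ ^ 2) (by fun_prop)

/-- The gradient is controlled on a set from which two independent segments lead into `U`. -/
theorem exists_lintegral_pderiv_sq_le {A U : Set Plane} (hA : MeasurableSet A)
    (hU : MeasurableSet U) {e f : Plane} (hef : e 0 * f 1 - e 1 * f 0 ≠ 0)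
    (he : ∀ y ∈ A, ∀ t ∈ Ioc (0 : ℝ) 1, y + t • e ∈ U)
    (hf : ∀ y ∈ A, ∀ t ∈ Ioc (0 : ℝ) 1, y + t • f ∈ U) :
    ∃ C : ℝ≥0∞, C ≠ ⊤ ∧ ∀ φ : Plane → ℂ, ContDiff ℝ ∞ φ → ∀ k,
      ∫⁻ y in A, ‖pderiv k φ y‖ₑ ^ 2 ≤
        C * ∫⁻ x in U, (‖φ x‖ₑ ^ 2 + ∑ i, ∑ j, ‖pderiv j (pderiv i φ) x‖ₑ ^ 2) := by
  -- Cramer's rule expresses the coordinate vectors through `e` and `f`, so the two directional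
  -- estimates control both partial derivatives.
  have hlin : ∀ k : Fin 2, ∃ a b : ℝ, EuclideanSpace.single k 1 = a • e + b • f := by
    set D := e 0 * f 1 - e 1 * f 0 with hD
    have k1 : f 1 / D * e 0 + -e 1 / D * f 0 = 1 := by
      rw [div_mul_eq_mul_div, div_mul_eq_mul_div, ← add_div, div_eq_one_iff_eq hef, hD]; ring
    have k2 : -f 0 / D * e 1 + e 0 / D * f 1 = 1 := by
      rw [div_mul_eq_mul_div, div_mul_eq_mul_div, ← add_div, div_eq_one_iff_eq hef, hD]; ring
    intro k
    fin_cases k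
    · refine ⟨f 1 / D, - e 1 / D, ?_⟩
      ext i
      fin_cases i
      · simpa using k1.symm
      · simp; ring
    · refine ⟨- f 0 / D, e 0 / D, ?_⟩
      ext i
      fin_cases i
      · simp; ring
      · simpa using k2.symm
  choose a b hab using hlin
  let M : Plane → ℝ≥0∞ := fun v => 72 * (1 + ENNReal.ofReal (2 * ‖v‖ ^ 4))
  refine ⟨∑ k, 2 * (‖a k‖ₑ ^ 2 * M e + ‖b k‖ₑ ^ 2 * M f), ?_, fun φ hφ k => ?_⟩
  · simp only [ne_eq, ENNReal.sum_eq_top, not_exists, M]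
    intro k
    simp [ENNReal.mul_eq_top]
  set J := ∫⁻ x in U, (‖φ x‖ₑ ^ 2 + ∑ i, ∑ j, ‖pderiv j (pderiv i φ) x‖ₑ ^ 2)
  have hcont : ∀ i j, Continuous (pderiv j (pderiv i φ)) := fun i j =>
    continuous_pderiv (contDiff_pderiv hφ i) j
  have hm0 := hφ.continuous.measurable
  have hm2 : ∀ i j, Measurable (pderiv j (pderiv i φ)) := fun i j => (hcont i j).measurable
  have hl : ∀ v, Measurable (lineD v φ) := fun v => (contDiff_lineD hφ v).continuous.measurable
  have hdir : ∀ v : Plane, (∀ y ∈ A, ∀ t ∈ Ioc (0 : ℝ) 1, y + t • v ∈ U) →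
      ∫⁻ y in A, ‖lineD v φ y‖ₑ ^ 2 ≤ M v * J := by
    intro v hv
    refine (lintegral_lineD_sq_le hA hU hv hφ).trans ?_
    simp only [M]
    rw [mul_assoc]
    gcongr
    rw [← lintegral_const_mul _ (by fun_prop)]
    refine lintegral_mono fun x => ?_
    dsimp only
    rw [mul_add, add_mul, one_mul]
    refine add_le_add le_self_add ((contDiff_lineD_lineD_sq_le hφ v x).trans ?_)
    gcongr
    exact le_add_self
  calc ∫⁻ y in A, ‖pderiv k φ y‖ₑ ^ 2
      ≤ ∫⁻ y in A, 2 * (‖a k‖ₑ ^ 2 * ‖lineD e φ y‖ₑ ^ 2 + ‖b k‖ₑ ^ 2 * ‖lineD f φ y‖ₑ ^ 2) := by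
        refine lintegral_mono fun y => ?_
        have : pderiv k φ y = a k • lineD e φ y + b k • lineD f φ y := by
          rw [← lineD_add_smul, ← hab]
          rfl
        dsimp only
        rw [this]
        refine (enorm_add_sq_le _ _).trans (le_of_eq ?_)
        rw [enorm_smul, enorm_smul, mul_pow, mul_pow]
    _ = 2 * (‖a k‖ₑ ^ 2 * (∫⁻ y in A, ‖lineD e φ y‖ₑ ^ 2) +
          ‖b k‖ₑ ^ 2 * ∫⁻ y in A, ‖lineD f φ y‖ₑ ^ 2) := by
        have := hl e; have := hl f
        rw [lintegral_const_mul _ (by fun_prop), lintegral_add_left (by fun_prop),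
          lintegral_const_mul _ (by fun_prop), lintegral_const_mul _ (by fun_prop)]
    _ ≤ 2 * (‖a k‖ₑ ^ 2 * (M e * J) + ‖b k‖ₑ ^ 2 * (M f * J)) := by
        gcongr
        · exact hdir e he
        · exact hdir f hf
    _ = 2 * (‖a k‖ₑ ^ 2 * M e + ‖b k‖ₑ ^ 2 * M f) * J := by ring
    _ ≤ _ := by
        gcongr
        exact Finset.single_le_sum (f := fun k => 2 * (‖a k‖ₑ ^ 2 * M e + ‖b k‖ₑ ^ 2 * M f))
          (fun _ _ => zero_le) (Finset.mem_univ k)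

/-! ### Boundary charts -/

open scoped NNReal in
/-- In the ball of radius `r` about `x`, and in the coordinates `Φ`, the set `Ω` is the region
strictly below the graph of the Lipschitz function `h`. -/
structure IsBoundaryChart (Ω : Set Plane) (x : Plane) (r : ℝ) (Φ : Plane ≃ₗᵢ[ℝ] Plane)
    (h : ℝ → ℝ) (L : ℝ≥0) : Prop where
  pos : 0 < r
  lipschitz : LipschitzWith L h
  mem_iff : ∀ y ∈ Metric.ball x r, (y ∈ Ω ↔ (Φ y) 1 < h ((Φ y) 0))

/-- The boundary function is Lipschitz only near the abscissa of `x`. It is replaced by a global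
Lipschitz extension, and the radius is shrunk so that the ball sees only the unchanged part. -/
theorem HasC2Boundary.exists_isBoundaryChart {Ω : Set Plane} (hΩ : HasC2Boundary Ω) {x : Plane}
    (hx : x ∈ frontier Ω) : ∃ r Φ h L, IsBoundaryChart Ω x r Φ h L := by
  obtain ⟨r, hr, Φ, h, hh, hmem⟩ := hΩ x hx
  obtain ⟨L, t, ht, hL⟩ := ((hh.of_le one_le_two).contDiffAt (x := (Φ x) 0)).exists_lipschitzOnWith
  obtain ⟨a, ha, hat⟩ := Metric.mem_nhds_iff.1 ht
  obtain ⟨g, hg, heq⟩ := (hL.mono hat).extend_real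
  refine ⟨min r a, Φ, g, L, lt_min hr ha, hg, fun y hy => ?_⟩
  rw [hmem y (Metric.ball_subset_ball (min_le_left _ _) hy), heq]
  rw [Metric.mem_ball, Real.dist_eq, ← PiLp.sub_apply, ← map_sub, ← Real.norm_eq_abs]
  refine (PiLp.norm_apply_le _ _).trans_lt ?_
  rw [LinearIsometryEquiv.norm_map, ← dist_eq_norm]
  exact (Metric.mem_ball.1 hy).trans_le (min_le_right _ _)

namespace IsBoundaryChart

variable {Ω : Set Plane} {x : Plane} {r : ℝ} {Φ : Plane ≃ₗᵢ[ℝ] Plane} {h : ℝ → ℝ} {L : NNReal}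

theorem continuous_coord (Φ : Plane ≃ₗᵢ[ℝ] Plane) (i : Fin 2) : Continuous fun y => (Φ y) i :=
  (PiLp.continuous_apply 2 _ i).comp Φ.continuous

theorem le_of_mem_closure (c : IsBoundaryChart Ω x r Φ h L) {y : Plane}
    (hy : y ∈ Metric.ball x r) (hcl : y ∈ closure Ω) : (Φ y) 1 ≤ h ((Φ y) 0) := by
  by_contra! hlt
  have hopen : IsOpen (Metric.ball x r ∩ {z | h ((Φ z) 0) < (Φ z) 1}) :=
    Metric.isOpen_ball.inter (isOpen_lt (c.lipschitz.continuous.comp (continuous_coord Φ 0))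
      (continuous_coord Φ 1))
  obtain ⟨z, hz, hzΩ⟩ := mem_closure_iff.1 hcl _ hopen ⟨hy, hlt⟩
  exact lt_asymm ((c.mem_iff z hz.1).1 hzΩ) hz.2

theorem eq_of_mem_frontier (c : IsBoundaryChart Ω x r Φ h L) (hΩ : IsOpen Ω) {y : Plane}
    (hy : y ∈ Metric.ball x r) (hfr : y ∈ frontier Ω) : (Φ y) 1 = h ((Φ y) 0) := by
  rw [hΩ.frontier_eq] at hfr
  exact le_antisymm (c.le_of_mem_closure hy hfr.1)
    (not_lt.1 fun hlt => hfr.2 ((c.mem_iff y hy).2 hlt))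

theorem lipschitz_shift (c : IsBoundaryChart Ω x r Φ h L) (s a : ℝ) : h (s + a) ≤ h s + L * |a| := by
  have := c.lipschitz.dist_le_mul (s + a) s
  rw [Real.dist_eq, Real.dist_eq, add_sub_cancel_left] at this
  linarith [le_abs_self (h (s + a) - h s)]

theorem add_smul_mem_ball {y v : Plane} (hy : y ∈ Metric.closedBall x (r / 3)) (hr : 0 < r)
    (hv : ‖v‖ ≤ r / 3) {t : ℝ} (ht : |t| ≤ 1) : y + t • v ∈ Metric.ball x r := by
  rw [Metric.mem_ball]
  have h1 : dist (y + t • v) y ≤ r / 3 := by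
    rw [dist_eq_norm, add_sub_cancel_left, norm_smul, Real.norm_eq_abs]
    calc |t| * ‖v‖ ≤ 1 * (r / 3) := by gcongr
      _ = r / 3 := one_mul _
  have h2 := Metric.mem_closedBall.1 hy
  linarith [dist_triangle (y + t • v) y x]

/-- The cone condition makes `v` steeper than the graph, so a point on or above the graph moves
strictly above it; the bound on `‖v‖` keeps the motion inside the chart. -/
theorem add_mem_extDomain (c : IsBoundaryChart Ω x r Φ h L) {v : Plane} (hv : ‖v‖ ≤ r / 3)
    (hcone : L * |(Φ v) 0| < (Φ v) 1) {y : Plane} (hy : y ∈ Metric.closedBall x (r / 3))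
    (hyΩ : y ∉ Ω) {t : ℝ} (ht : t ∈ Ioc (0 : ℝ) 1) : y + t • v ∈ extDomain Ω := by
  have hb := add_smul_mem_ball hy c.pos hv (t := t) (by rw [abs_of_pos ht.1]; exact ht.2)
  intro hcl
  have h1 := c.le_of_mem_closure hb hcl
  have hy' : y ∈ Metric.ball x r :=
    Metric.closedBall_subset_ball (by linarith [c.pos]) hy
  have h2 := not_lt.1 fun h => hyΩ ((c.mem_iff y hy').2 h)
  simp only [map_add, map_smul, PiLp.add_apply, PiLp.smul_apply, smul_eq_mul] at h1
  have h3 := c.lipschitz_shift ((Φ y) 0) (t * (Φ v) 0)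
  rw [abs_mul, abs_of_pos ht.1] at h3
  nlinarith [mul_lt_mul_of_pos_left hcone ht.1]

theorem sub_mem (c : IsBoundaryChart Ω x r Φ h L) {v : Plane} (hv : ‖v‖ ≤ r / 3)
    (hcone : L * |(Φ v) 0| < (Φ v) 1) {y : Plane} (hy : y ∈ Metric.closedBall x (r / 3))
    (hcl : y ∈ closure Ω) {t : ℝ} (ht : t ∈ Ioc (0 : ℝ) 1) : y - t • v ∈ Ω := by
  have hb := add_smul_mem_ball hy c.pos hv (t := -t) (by rw [abs_neg, abs_of_pos ht.1]; exact ht.2)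
  rw [neg_smul, ← sub_eq_add_neg] at hb
  have hy' : y ∈ Metric.ball x r :=
    Metric.closedBall_subset_ball (by linarith [c.pos]) hy
  rw [c.mem_iff _ hb]
  have h1 := c.le_of_mem_closure hy' hcl
  simp only [map_sub, map_smul, PiLp.sub_apply, PiLp.smul_apply, smul_eq_mul]
  have h3 := c.lipschitz_shift ((Φ y) 0 - t * (Φ v) 0) (t * (Φ v) 0)
  rw [abs_mul, abs_of_pos ht.1, sub_add_cancel] at h3
  nlinarith [mul_lt_mul_of_pos_left hcone ht.1]

/-- A vector with given coordinates in the chart. -/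
noncomputable def vec (Φ : Plane ≃ₗᵢ[ℝ] Plane) (a b : ℝ) : Plane := Φ.symm !₂[a, b]

theorem vec_zero (a b : ℝ) : (Φ (vec Φ a b)) 0 = a := by simp [vec]

theorem vec_one (a b : ℝ) : (Φ (vec Φ a b)) 1 = b := by simp [vec]

theorem norm_vec_le (a b : ℝ) : ‖vec Φ a b‖ ≤ |a| + |b| := by
  rw [vec, LinearIsometryEquiv.norm_map, EuclideanSpace.norm_eq, Fin.sum_univ_two]
  refine Real.sqrt_le_iff.2 ⟨by positivity, ?_⟩
  simp only [Matrix.cons_val_zero, Matrix.cons_val_one, Real.norm_eq_abs]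
  nlinarith [abs_nonneg a, abs_nonneg b]

end IsBoundaryChart

open IsBoundaryChart

theorem HasC2Boundary.hasInwardSegments {Ω : Set Plane} (hΩ : HasC2Boundary Ω) :
    HasInwardSegments Ω := by
  intro x hx
  obtain ⟨r, Φ, h, L, c⟩ := hΩ.exists_isBoundaryChart hx
  have hr := c.pos
  refine ⟨r / 3, by linarith, vec Φ 0 (r / 3), fun y hy t ht => c.sub_mem ?_ ?_
    (Metric.ball_subset_closedBall hy.1) hy.2 ht⟩
  · refine (norm_vec_le _ _).trans ?_
    rw [abs_zero, zero_add, abs_of_pos (by linarith)]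
  · rw [vec_zero, vec_one, abs_zero, mul_zero]
    linarith

/-- The determinant of the images is the determinant of `Φ` times that of `e, f`. -/
theorem det_ne_zero_of_coord {Φ : Plane ≃ₗᵢ[ℝ] Plane} {e f : Plane}
    (h : (Φ e) 0 * (Φ f) 1 - (Φ e) 1 * (Φ f) 0 ≠ 0) : e 0 * f 1 - e 1 * f 0 ≠ 0 := by
  intro h0
  apply h
  have he : ∀ v : Plane, ∀ i, (Φ v) i = v 0 * (Φ (EuclideanSpace.single 0 1)) i +
      v 1 * (Φ (EuclideanSpace.single 1 1)) i := fun v i => by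
    conv_lhs => rw [plane_eq_sum v]
    simp only [map_add, map_smul, PiLp.add_apply, PiLp.smul_apply, smul_eq_mul]
  rw [he e, he f, he e, he f]
  linear_combination ((Φ (EuclideanSpace.single 0 1)) 0 * (Φ (EuclideanSpace.single 1 1)) 1 -
    (Φ (EuclideanSpace.single 0 1)) 1 * (Φ (EuclideanSpace.single 1 1)) 0) * h0

theorem HasC2Boundary.exists_outward_segments {Ω : Set Plane} (hΩ : HasC2Boundary Ω) {x : Plane}
    (hx : x ∈ frontier Ω) : ∃ r > (0 : ℝ), ∃ e f : Plane, e 0 * f 1 - e 1 * f 0 ≠ 0 ∧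
      ∀ y ∈ Metric.ball x r, y ∉ Ω → ∀ t ∈ Ioc (0 : ℝ) 1,
        y + t • e ∈ extDomain Ω ∧ y + t • f ∈ extDomain Ω := by
  obtain ⟨r, Φ, h, L, c⟩ := hΩ.exists_isBoundaryChart hx
  have hr := c.pos
  have hL : (0 : ℝ) ≤ L := L.2
  -- Both directions, `(0, a)` and `(a, a(L + 1))` in chart coordinates, lie in the cone of slope
  -- greater than `L`. The longer has length at most `a(L + 2) = r/3`.
  set a : ℝ := r / (3 * (L + 2)) with ha
  have ha0 : 0 < a := by positivity
  have haL : a * (L + 2) = r / 3 := by rw [ha]; field_simp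
  refine ⟨r / 3, by linarith, vec Φ 0 a, vec Φ a (a * (L + 1)), ?_, fun y hy hyΩ t ht =>
    ⟨c.add_mem_extDomain ?_ ?_ (Metric.ball_subset_closedBall hy) hyΩ ht,
      c.add_mem_extDomain ?_ ?_ (Metric.ball_subset_closedBall hy) hyΩ ht⟩⟩
  · refine det_ne_zero_of_coord (Φ := Φ) ?_
    rw [vec_zero, vec_one, vec_zero, vec_one, zero_mul, zero_sub]
    exact neg_ne_zero.2 (mul_pos ha0 ha0).ne'
  · refine (norm_vec_le _ _).trans ?_
    rw [abs_zero, zero_add, abs_of_pos ha0]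
    nlinarith
  · rw [vec_zero, vec_one, abs_zero, mul_zero]
    exact ha0
  · refine (norm_vec_le _ _).trans ?_
    rw [abs_of_pos ha0, abs_of_pos (by positivity)]
    nlinarith
  · rw [vec_zero, vec_one, abs_of_pos ha0]
    nlinarith

theorem isCompact_frontier {Ω : Set Plane} (hb : Bornology.IsBounded Ω) : IsCompact (frontier Ω) :=
  Metric.isCompact_of_isClosed_isBounded isClosed_frontier
    (hb.closure.subset frontier_subset_closure)

theorem lintegral_biUnion_finset_le {α ι : Type*} [MeasurableSpace α] {μ : Measure α}
    (s : Finset ι) (A : ι → Set α) (F : α → ℝ≥0∞) :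
    ∫⁻ x in ⋃ i ∈ s, A i, F x ∂μ ≤ ∑ i ∈ s, ∫⁻ x in A i, F x ∂μ := by
  classical
  induction s using Finset.induction_on with
  | empty => simp
  | insert i s hi ih =>
    rw [Finset.set_biUnion_insert, Finset.sum_insert hi]
    exact (lintegral_union_le _ _ _).trans (add_le_add le_rfl ih)

/-- The points of the exterior that are not close to the boundary are not close to `Ω`. -/
theorem ball_subset_extDomain {Ω : Set Plane} {y : Plane} (hy : y ∈ extDomain Ω) {δ : ℝ}
    (hδ : 0 < δ) (h : Disjoint (Metric.ball y δ) (frontier Ω)) : Metric.ball y δ ⊆ extDomain Ω := by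
  intro z hz hzΩ
  have hpre : IsPreconnected (Metric.ball y δ) := (convex_ball y δ).isPreconnected
  have hint : ∀ w ∈ Metric.ball y δ, w ∈ closure Ω → w ∈ interior (closure Ω) := by
    intro w hw hwΩ
    by_contra hw'
    refine Set.disjoint_left.1 h hw (frontier_closure_subset ?_)
    rw [isClosed_closure.frontier_eq]
    exact ⟨hwΩ, hw'⟩
  -- A ball that misses `∂Ω` also misses the frontier of `closure Ω`. It is covered by the disjoint
  -- open sets `interior (closure Ω)` and the exterior, and by connectedness cannot meet both.
  obtain ⟨w, -, hw, hw'⟩ := hpre _ _ isOpen_interior (isOpen_extDomain Ω)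
    (fun w hw => (em (w ∈ closure Ω)).imp (hint w hw) id) ⟨z, hz, hint z hz hzΩ⟩
    ⟨y, Metric.mem_ball_self hδ, hy⟩
  exact hw' (interior_subset hw)

/-- The interpolation inequality in the exterior domain. -/
theorem exists_lintegral_gradient_sq_le {Ω : Set Plane}
    (hb : Bornology.IsBounded Ω) (hC2 : HasC2Boundary Ω) :
    ∃ C : ℝ≥0∞, C ≠ ⊤ ∧ ∀ φ : Plane → ℂ, ContDiff ℝ ∞ φ → ∀ k,
      ∫⁻ y in extDomain Ω, ‖pderiv k φ y‖ₑ ^ 2 ≤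
        C * ∫⁻ x in extDomain Ω, (‖φ x‖ₑ ^ 2 + ∑ i, ∑ j, ‖pderiv j (pderiv i φ) x‖ₑ ^ 2) := by
  have hU := (isOpen_extDomain Ω).measurableSet
  choose! r hr e f hef hseg using fun x (hx : x ∈ frontier Ω) => hC2.exists_outward_segments hx
  obtain ⟨s, hs, hcov⟩ := (isCompact_frontier hb).elim_nhds_subcover
    (fun x => Metric.ball x (r x)) fun x hx => Metric.ball_mem_nhds _ (hr x hx)
  set W := ⋃ x ∈ s, Metric.ball x (r x) with hW
  have hWo : IsOpen W := isOpen_biUnion fun _ _ => Metric.isOpen_ball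
  obtain ⟨δ, hδ, hthick⟩ := (isCompact_frontier hb).exists_thickening_subset_open hWo hcov
  have hloc : ∀ x ∈ s, ∃ C : ℝ≥0∞, C ≠ ⊤ ∧ ∀ φ : Plane → ℂ, ContDiff ℝ ∞ φ → ∀ k,
      ∫⁻ y in extDomain Ω ∩ Metric.ball x (r x), ‖pderiv k φ y‖ₑ ^ 2 ≤
        C * ∫⁻ x in extDomain Ω, (‖φ x‖ₑ ^ 2 + ∑ i, ∑ j, ‖pderiv j (pderiv i φ) x‖ₑ ^ 2) :=
    fun x hx => exists_lintegral_pderiv_sq_le (hU.inter measurableSet_ball) hU (hef x (hs x hx))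
      (fun y hy t ht => (hseg x (hs x hx) y hy.2 (fun h => hy.1 (subset_closure h)) t ht).1)
      (fun y hy t ht => (hseg x (hs x hx) y hy.2 (fun h => hy.1 (subset_closure h)) t ht).2)
  -- Exterior points outside the charts are at distance at least `δ` from `∂Ω`, so the coordinate
  -- directions scaled by `δ/2` serve there.
  have hfar : ∀ y ∈ extDomain Ω \ W, ∀ i : Fin 2, ∀ t ∈ Ioc (0 : ℝ) 1,
      y + t • ((δ / 2) • EuclideanSpace.single i (1 : ℝ)) ∈ extDomain Ω := by
    intro y hy i t ht
    refine ball_subset_extDomain hy.1 hδ ?_ ?_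
    · rw [Set.disjoint_left]
      intro z hz hz'
      exact hy.2 (hthick (Metric.mem_thickening_iff.2 ⟨z, hz', by rwa [dist_comm]⟩))
    · rw [Metric.mem_ball, dist_eq_norm, add_sub_cancel_left, norm_smul, norm_smul,
        PiLp.norm_single, norm_one, mul_one, Real.norm_of_nonneg ht.1.le,
        Real.norm_of_nonneg (by linarith)]
      nlinarith [ht.2]
  obtain ⟨C₀, hC₀, h₀⟩ := exists_lintegral_pderiv_sq_le (hU.diff hWo.measurableSet) hU
    (e := (δ / 2) • EuclideanSpace.single 0 (1 : ℝ)) (f := (δ / 2) • EuclideanSpace.single 1 (1 : ℝ))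
    (by simp [hδ.ne']) (fun y hy => hfar y hy 0) (fun y hy => hfar y hy 1)
  choose! C hC h using hloc
  refine ⟨C₀ + ∑ x ∈ s, C x, ENNReal.add_ne_top.2 ⟨hC₀, ENNReal.sum_ne_top.2 hC⟩,
    fun φ hφ k => ?_⟩
  have hsub : extDomain Ω ⊆ (extDomain Ω \ W) ∪ ⋃ x ∈ s, extDomain Ω ∩ Metric.ball x (r x) := by
    intro y hy
    by_cases hyW : y ∈ W
    · right
      rw [hW, mem_iUnion₂] at hyW
      obtain ⟨x, hx, hyx⟩ := hyW
      exact mem_iUnion₂.2 ⟨x, hx, hy, hyx⟩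
    · exact Or.inl ⟨hy, hyW⟩
  calc _ ≤ ∫⁻ y in (extDomain Ω \ W) ∪ ⋃ x ∈ s, extDomain Ω ∩ Metric.ball x (r x),
        ‖pderiv k φ y‖ₑ ^ 2 := lintegral_mono_set hsub
    _ ≤ (∫⁻ y in extDomain Ω \ W, ‖pderiv k φ y‖ₑ ^ 2) +
        ∑ x ∈ s, ∫⁻ y in extDomain Ω ∩ Metric.ball x (r x), ‖pderiv k φ y‖ₑ ^ 2 := by
        refine (lintegral_union_le _ _ _).trans (add_le_add le_rfl ?_)
        exact lintegral_biUnion_finset_le s _ _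
    _ ≤ _ := by
        rw [add_mul, Finset.sum_mul]
        exact add_le_add (h₀ φ hφ k) (Finset.sum_le_sum fun x hx => h x hx φ hφ k)

/-! ### The trace inequality -/

/-- The parametrization of a neighbourhood of a graph by its vertical translates. -/
noncomputable def graphMap (Φ : Plane ≃ₗᵢ[ℝ] Plane) (h : ℝ → ℝ) (p : ℝ × ℝ) : Plane :=
  IsBoundaryChart.vec Φ p.1 (h p.1 + p.2)

/-- A shear of the plane followed by an isometry. -/
theorem measurePreserving_graphMap (Φ : Plane ≃ₗᵢ[ℝ] Plane) {h : ℝ → ℝ} (hh : Measurable h) :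
    MeasurePreserving (graphMap Φ h) := by
  have h1 : MeasurePreserving (fun p : ℝ × ℝ => (p.1, h p.1 + p.2)) :=
    (MeasurePreserving.id (volume : Measure ℝ)).skew_product (g := fun s t => h s + t)
      (by fun_prop) (Eventually.of_forall fun s => (measurePreserving_add_left volume (h s)).map_eq)
  have h2 := (volume_preserving_finTwoArrow ℝ).symm
  have h3 := PiLp.volume_preserving_toLp (Fin 2)
  have h4 := Φ.symm.measurePreserving
  exact h4.comp (h3.comp (h2.comp h1))

theorem setLIntegral_comp_graphMap_le (Φ : Plane ≃ₗᵢ[ℝ] Plane) {h : ℝ → ℝ} (hh : Measurable h)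
    {A I : Set ℝ} (hA : MeasurableSet A) (hI : MeasurableSet I) {T : Set Plane}
    (hT : MeasurableSet T) (hmem : ∀ s ∈ A, ∀ t ∈ I, graphMap Φ h (s, t) ∈ T) {F : Plane → ℝ≥0∞}
    (hF : Measurable F) :
    ∫⁻ s in A, ∫⁻ t in I, F (graphMap Φ h (s, t)) ≤ ∫⁻ x in T, F x := by
  have hmp := measurePreserving_graphMap Φ hh
  rw [← lintegral_prod (fun p => F (graphMap Φ h p)) (hF.comp hmp.measurable).aemeasurable,
    Measure.prod_restrict, ← Measure.volume_eq_prod, ← lintegral_indicator (hA.prod hI),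
    ← lintegral_indicator hT, ← hmp.lintegral_comp (hF.indicator hT)]
  refine lintegral_mono fun p => ?_
  by_cases hp : p ∈ A ×ˢ I
  · rw [indicator_of_mem hp, indicator_of_mem (hmem _ hp.1 _ hp.2)]
  · rw [indicator_of_notMem hp]
    exact zero_le

theorem dist_vec_le (Φ : Plane ≃ₗᵢ[ℝ] Plane) (a b a' b' : ℝ) :
    dist (IsBoundaryChart.vec Φ a b) (IsBoundaryChart.vec Φ a' b') ≤ |a - a'| + |b - b'| := by
  rw [dist_eq_norm]
  have : IsBoundaryChart.vec Φ a b - IsBoundaryChart.vec Φ a' b' =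
      IsBoundaryChart.vec Φ (a - a') (b - b') := by
    simp only [IsBoundaryChart.vec]
    rw [← map_sub]
    congr 1
    ext i
    fin_cases i <;> simp
  rw [this]
  exact IsBoundaryChart.norm_vec_le _ _

theorem lipschitzWith_graph (Φ : Plane ≃ₗᵢ[ℝ] Plane) {h : ℝ → ℝ} {L : NNReal}
    (hh : LipschitzWith L h) : LipschitzWith (1 + L) fun s => graphMap Φ h (s, 0) := by
  refine LipschitzWith.of_dist_le_mul fun s t => (dist_vec_le Φ _ _ _ _).trans ?_
  have := hh.dist_le_mul s t
  rw [Real.dist_eq, Real.dist_eq] at this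
  rw [Real.dist_eq]
  push_cast
  simp only [add_zero]
  linarith

/-- The parametrization of the graph by its abscissa is `(1 + L)`-Lipschitz, so it increases
one-dimensional Hausdorff measure by at most that factor, and on the line this measure is Lebesgue
measure. -/
theorem lintegral_hausdorffMeasure_graph_le (Φ : Plane ≃ₗᵢ[ℝ] Plane) {h : ℝ → ℝ} {L : NNReal}
    (hh : LipschitzWith L h) {S : Set Plane} (hS : ∀ y ∈ S, (Φ y) 1 = h ((Φ y) 0))
    {A : Set ℝ} (hSA : ∀ y ∈ S, (Φ y) 0 ∈ A) {F : Plane → ℝ≥0∞}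
    (hF : Measurable F) :
    ∫⁻ y in S, F y ∂(Measure.hausdorffMeasure 1) ≤
      (1 + L : NNReal) * ∫⁻ s in A, F (graphMap Φ h (s, 0)) := by
  have hlip := lipschitzWith_graph Φ hh
  have hle : (Measure.hausdorffMeasure 1 : Measure Plane).restrict S ≤
      ((1 + L : NNReal) : ℝ≥0∞) • (volume.restrict A).map fun s => graphMap Φ h (s, 0) := by
    refine Measure.le_iff.2 fun E hE => ?_
    rw [Measure.restrict_apply hE, Measure.smul_apply,
      Measure.map_apply hlip.continuous.measurable hE,
      Measure.restrict_apply (hlip.continuous.measurable hE), smul_eq_mul]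
    have hsub : E ∩ S ⊆ (fun s => graphMap Φ h (s, 0)) ''
        ((fun s => graphMap Φ h (s, 0)) ⁻¹' E ∩ A) := by
      intro y hy
      have hy' : graphMap Φ h ((Φ y) 0, 0) = y := by
        simp only [graphMap, IsBoundaryChart.vec, add_zero]
        rw [← hS y hy.2, LinearIsometryEquiv.symm_apply_eq]
        ext i
        fin_cases i <;> simp
      exact ⟨(Φ y) 0, ⟨by rw [mem_preimage, hy']; exact hy.1, hSA y hy.2⟩, hy'⟩
    refine (measure_mono hsub).trans ((hlip.hausdorffMeasure_image_le zero_le_one _).trans ?_)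
    rw [ENNReal.rpow_one, hausdorffMeasure_real]
  refine (lintegral_mono' hle le_rfl).trans (le_of_eq ?_)
  rw [lintegral_smul_measure, lintegral_map hF hlip.continuous.measurable]
  rfl

namespace IsBoundaryChart

variable {Ω : Set Plane} {x : Plane} {r : ℝ} {Φ : Plane ≃ₗᵢ[ℝ] Plane} {h : ℝ → ℝ} {L : NNReal}

theorem graphMap_eq (s t : ℝ) : graphMap Φ h (s, t) = graphMap Φ h (s, 0) + t • vec Φ 0 1 := by
  simp only [graphMap, vec]
  rw [← map_smul, ← map_add]
  congr 1
  ext i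
  fin_cases i <;> simp

theorem graphMap_mem_extDomain (c : IsBoundaryChart Ω x r Φ h L) {s : ℝ}
    (hs : graphMap Φ h (s, 0) ∈ Metric.closedBall x (r / 3)) {t : ℝ} (ht : t ∈ Ioc 0 (r / 3)) :
    graphMap Φ h (s, t) ∈ extDomain Ω := by
  have hr := c.pos
  have hΩ : graphMap Φ h (s, 0) ∉ Ω := fun hmem => by
    have := (c.mem_iff _ (Metric.closedBall_subset_ball (by linarith) hs)).1 hmem
    simp only [graphMap, vec_zero, vec_one, add_zero, lt_self_iff_false] at this
  have h1 := c.add_mem_extDomain (v := t • vec Φ 0 1) ?_ ?_ hs hΩ (t := 1) ⟨one_pos, le_rfl⟩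
  · rwa [one_smul, ← graphMap_eq] at h1
  · rw [norm_smul, Real.norm_of_nonneg ht.1.le]
    have : ‖vec Φ 0 1‖ ≤ 1 := (norm_vec_le _ _).trans (by simp)
    calc t * ‖vec Φ 0 1‖ ≤ t * 1 := by gcongr; exact ht.1.le
      _ ≤ r / 3 := by linarith [ht.2]
  · simp only [map_smul, PiLp.smul_apply, vec_zero, vec_one, smul_eq_mul, mul_zero, abs_zero, mul_one]
    exact ht.1

theorem isCompact_graph_preimage (c : IsBoundaryChart Ω x r Φ h L) (ρ : ℝ) :
    IsCompact ((fun s => graphMap Φ h (s, 0)) ⁻¹' Metric.closedBall x ρ) := by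
  have hcont := (lipschitzWith_graph Φ c.lipschitz).continuous
  refine Metric.isCompact_of_isClosed_isBounded (Metric.isClosed_closedBall.preimage hcont) ?_
  refine (Metric.isBounded_closedBall (x := (Φ x) 0) (r := ρ)).subset fun s hs => ?_
  rw [Metric.mem_closedBall, Real.dist_eq, ← Real.norm_eq_abs]
  have h1 : s = (Φ (graphMap Φ h (s, 0))) 0 := by rw [graphMap, vec_zero]
  rw [h1, ← PiLp.sub_apply, ← map_sub]
  refine (PiLp.norm_apply_le _ _).trans ?_
  rw [LinearIsometryEquiv.norm_map, ← dist_eq_norm]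
  exact hs

theorem continuous_graphMap (c : IsBoundaryChart Ω x r Φ h L) : Continuous (graphMap Φ h) := by
  have : graphMap Φ h = fun p => graphMap Φ h (p.1, 0) + p.2 • vec Φ 0 1 := by
    funext p
    exact graphMap_eq p.1 p.2
  rw [this]
  exact ((lipschitzWith_graph Φ c.lipschitz).continuous.comp continuous_fst).add
    (continuous_snd.smul continuous_const)

/-- The trace inequality in a boundary chart. -/
theorem trace_inequality (c : IsBoundaryChart Ω x r Φ h L) (hΩ : IsOpen Ω) :
    Measure.hausdorffMeasure 1 (frontier Ω ∩ Metric.ball x (r / 3)) < ⊤ ∧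
    ∀ δ ∈ Ioc 0 (r / 3), ∃ K : Set Plane, IsCompact K ∧ K ⊆ extDomain Ω ∧
      ∀ φ : Plane → ℂ, ContDiff ℝ ∞ φ →
        ∫⁻ y in frontier Ω ∩ Metric.ball x (r / 3), ‖φ y‖ₑ ^ 2 ∂(Measure.hausdorffMeasure 1) ≤
          (1 + L : NNReal) * (ENNReal.ofReal (4 / δ) * (∫⁻ y in K, ‖φ y‖ₑ ^ 2) +
            ENNReal.ofReal (2 * δ) * ∫⁻ y in extDomain Ω, ∑ i, ‖pderiv i φ y‖ₑ ^ 2) := by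
  have hr := c.pos
  have hhm := c.lipschitz.continuous.measurable
  have hU := (isOpen_extDomain Ω).measurableSet
  set A := (fun s => graphMap Φ h (s, 0)) ⁻¹' Metric.closedBall x (r / 3) with hA
  have hAc : IsCompact A := c.isCompact_graph_preimage _
  have hAm : MeasurableSet A := hAc.measurableSet
  have hgraph : ∀ y ∈ frontier Ω ∩ Metric.ball x (r / 3), (Φ y) 1 = h ((Φ y) 0) := fun y hy =>
    c.eq_of_mem_frontier hΩ (Metric.ball_subset_ball (by linarith) hy.2) hy.1
  have hSA : ∀ y ∈ frontier Ω ∩ Metric.ball x (r / 3), (Φ y) 0 ∈ A := by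
    intro y hy
    have hy' : graphMap Φ h ((Φ y) 0, 0) = y := by
      simp only [graphMap, vec, add_zero]
      rw [← hgraph y hy, LinearIsometryEquiv.symm_apply_eq]
      ext i
      fin_cases i <;> simp
    rw [hA, mem_preimage, hy']
    exact Metric.ball_subset_closedBall hy.2
  have hbound := fun {F : Plane → ℝ≥0∞} (hF : Measurable F) =>
    lintegral_hausdorffMeasure_graph_le Φ c.lipschitz hgraph hSA hF
  refine ⟨?_, fun δ hδ => ?_⟩
  · have := hbound (F := fun _ => 1) measurable_const
    simp only [lintegral_const, one_mul, Measure.restrict_apply_univ] at this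
    exact this.trans_lt (ENNReal.mul_lt_top ENNReal.coe_lt_top hAc.measure_lt_top)
  -- The compact set is the layer at heights between `δ/2` and `δ` above the graph, matching the
  -- interval of `enorm_zero_sq_le`.
  · refine ⟨graphMap Φ h '' (A ×ˢ Icc (δ / 2) δ),
      (hAc.prod isCompact_Icc).image c.continuous_graphMap, ?_, fun φ hφ => ?_⟩
    · rintro _ ⟨⟨s, t⟩, ⟨hs, ht⟩, rfl⟩
      exact c.graphMap_mem_extDomain hs ⟨by linarith [ht.1, hδ.1], ht.2.trans hδ.2⟩
    set K := graphMap Φ h '' (A ×ˢ Icc (δ / 2) δ) with hK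
    have hKm : MeasurableSet K :=
      ((hAc.prod isCompact_Icc).image c.continuous_graphMap).measurableSet
    have hm := hφ.continuous.measurable
    have hgc := c.continuous_graphMap
    have hlc := (contDiff_lineD hφ (vec Φ 0 1)).continuous
    have hlm := hlc.measurable
    refine (hbound (F := fun y => ‖φ y‖ₑ ^ 2) (by fun_prop)).trans ?_
    gcongr
    have hpt : ∀ s, ‖φ (graphMap Φ h (s, 0))‖ₑ ^ 2 ≤
        ENNReal.ofReal (4 / δ) * (∫⁻ t in Ioc (δ / 2) δ, ‖φ (graphMap Φ h (s, t))‖ₑ ^ 2) +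
        ENNReal.ofReal (2 * δ) *
          ∫⁻ t in Ioc 0 δ, ‖lineD (vec Φ 0 1) φ (graphMap Φ h (s, t))‖ₑ ^ 2 := by
      intro s
      have := enorm_zero_sq_le (hasDerivAt_line hφ (graphMap Φ h (s, 0)) (vec Φ 0 1))
        (by fun_prop) hδ.1
      simp only [← graphMap_eq] at this
      exact this
    have hmeas : ∀ (I : Set ℝ) (ψ : Plane → ℂ), Continuous ψ →
        Measurable fun s => ∫⁻ t in I, ‖ψ (graphMap Φ h (s, t))‖ₑ ^ 2 := fun I ψ hψ =>
      Measurable.lintegral_prod_right' (f := fun p => ‖ψ (graphMap Φ h p)‖ₑ ^ 2)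
        ((hψ.comp hgc).measurable.enorm.pow_const 2)
    calc _ ≤ ∫⁻ s in A, _ := lintegral_mono hpt
      _ = ENNReal.ofReal (4 / δ) *
            (∫⁻ s in A, ∫⁻ t in Ioc (δ / 2) δ, ‖φ (graphMap Φ h (s, t))‖ₑ ^ 2) +
          ENNReal.ofReal (2 * δ) *
            ∫⁻ s in A, ∫⁻ t in Ioc 0 δ, ‖lineD (vec Φ 0 1) φ (graphMap Φ h (s, t))‖ₑ ^ 2 := by
          rw [lintegral_add_left ((hmeas _ φ hφ.continuous).const_mul _),
            lintegral_const_mul _ (hmeas _ φ hφ.continuous), lintegral_const_mul _ (hmeas _ _ hlc)]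
      _ ≤ _ := by
          gcongr
          · exact setLIntegral_comp_graphMap_le Φ hhm hAm measurableSet_Ioc hKm
              (fun s hs t ht => ⟨(s, t), ⟨hs, Ioc_subset_Icc_self ht⟩, rfl⟩)
              (F := fun y => ‖φ y‖ₑ ^ 2) (by fun_prop)
          · refine (setLIntegral_comp_graphMap_le Φ hhm hAm measurableSet_Ioc hU
              (fun s hs t ht => c.graphMap_mem_extDomain hs ⟨ht.1, ht.2.trans hδ.2⟩)
              (F := fun y => ‖lineD (vec Φ 0 1) φ y‖ₑ ^ 2) (by fun_prop)).trans ?_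
            refine lintegral_mono fun y => (lineD_sq_le _ y).trans ?_
            refine mul_le_of_le_one_left' (ENNReal.ofReal_le_one.2 ?_)
            have : ‖vec Φ 0 1‖ ≤ 1 := (norm_vec_le _ _).trans (by simp)
            exact pow_le_one₀ (norm_nonneg _) this

end IsBoundaryChart

/-- A finite cover by charts. The constant `C` is chosen before `δ`, and only `K` depends on `δ`, so
the gradient term can be made as small as desired. -/
theorem HasC2Boundary.trace_inequality {Ω : Set Plane} (hC2 : HasC2Boundary Ω) (hΩ : IsOpen Ω)
    (hb : Bornology.IsBounded Ω) :
    IsFiniteMeasure (arcLength Ω) ∧ ∃ C : ℝ≥0∞, C ≠ ⊤ ∧ ∃ δ₀ > (0 : ℝ), ∀ δ ∈ Ioc 0 δ₀,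
      ∃ K : Set Plane, IsCompact K ∧ K ⊆ extDomain Ω ∧
        ∀ φ : Plane → ℂ, ContDiff ℝ ∞ φ → ∫⁻ y, ‖φ y‖ₑ ^ 2 ∂(arcLength Ω) ≤
          C * (ENNReal.ofReal (4 / δ) * (∫⁻ y in K, ‖φ y‖ₑ ^ 2) +
            ENNReal.ofReal (2 * δ) * ∫⁻ y in extDomain Ω, ∑ i, ‖pderiv i φ y‖ₑ ^ 2) := by
  choose! r Φ h L c using fun x (hx : x ∈ frontier Ω) => hC2.exists_isBoundaryChart hx
  obtain ⟨s, hs, hcov⟩ := (isCompact_frontier hb).elim_nhds_subcover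
    (fun x => Metric.ball x (r x / 3)) fun x hx => Metric.ball_mem_nhds _ (by
      linarith [(c x hx).pos])
  have hsub : frontier Ω ⊆ ⋃ x ∈ s, frontier Ω ∩ Metric.ball x (r x / 3) := fun y hy => by
    obtain ⟨x, hx, hyx⟩ := mem_iUnion₂.1 (hcov hy)
    exact mem_iUnion₂.2 ⟨x, hx, hy, hyx⟩
  refine ⟨⟨?_⟩, ?_⟩
  · rw [arcLength, Measure.restrict_apply_univ]
    refine (measure_mono hsub).trans_lt ((measure_biUnion_finset_le _ _).trans_lt ?_)
    exact ENNReal.sum_lt_top.2 fun x hx => ((c x (hs x hx)).trace_inequality hΩ).1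
  obtain ⟨δ₀, hδ₀, hle⟩ : ∃ δ₀ > (0 : ℝ), ∀ x ∈ s, δ₀ ≤ r x / 3 := by
    rcases s.eq_empty_or_nonempty with rfl | hne
    · exact ⟨1, one_pos, by simp⟩
    · obtain ⟨x, hx, hmin⟩ := s.exists_min_image (fun x => r x / 3) hne
      exact ⟨r x / 3, by linarith [(c x (hs x hx)).pos], hmin⟩
  refine ⟨∑ x ∈ s, ((1 + L x : NNReal) : ℝ≥0∞), ENNReal.sum_ne_top.2 fun _ _ => ENNReal.coe_ne_top,
    δ₀, hδ₀, fun δ hδ => ?_⟩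
  choose! K hKc hKsub hK using fun x (hx : x ∈ s) =>
    ((c x (hs x hx)).trace_inequality hΩ).2 δ ⟨hδ.1, hδ.2.trans (hle x hx)⟩
  refine ⟨⋃ x ∈ s, K x, s.isCompact_biUnion hKc, iUnion₂_subset hKsub, fun φ hφ => ?_⟩
  calc _ ≤ ∫⁻ y in ⋃ x ∈ s, frontier Ω ∩ Metric.ball x (r x / 3), ‖φ y‖ₑ ^ 2
          ∂(Measure.hausdorffMeasure 1) := lintegral_mono_set hsub
    _ ≤ ∑ x ∈ s, ∫⁻ y in frontier Ω ∩ Metric.ball x (r x / 3), ‖φ y‖ₑ ^ 2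
          ∂(Measure.hausdorffMeasure 1) := lintegral_biUnion_finset_le _ _ _
    _ ≤ _ := by
        rw [Finset.sum_mul]
        refine Finset.sum_le_sum fun x hx => (hK x hx φ hφ).trans ?_
        gcongr
        exact subset_biUnion_of_mem (u := K) hx

/-! ### A Poincaré inequality -/

theorem lintegral_comp_homothety_le {G : Plane → ℝ≥0∞} (hG : Measurable G) {a : ℝ}
    (ha : 1 / 2 ≤ a) (b : Plane) (Q : Set Plane) :
    ∫⁻ y in Q, G (a • y + b) ≤ 4 * ∫⁻ y, G y := by
  have ha0 : a ≠ 0 := by linarith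
  calc ∫⁻ y in Q, G (a • y + b) ≤ ∫⁻ y, G (a • y + b) := setLIntegral_le_lintegral _ _
    _ = ENNReal.ofReal |(a ^ 2)⁻¹| * ∫⁻ y, G y := by
        have h1 := Measure.map_addHaar_smul (volume : Measure Plane) ha0
        rw [finrank_euclideanSpace_fin] at h1
        have h2 : ∫⁻ y, G (a • y + b) = ∫⁻ y, G (y + b) ∂(Measure.map (a • ·) volume) := by
          rw [lintegral_map (by fun_prop) (measurable_const_smul a)]
        rw [h2, h1, lintegral_smul_measure, lintegral_add_right_eq_self, smul_eq_mul]
    _ ≤ 4 * ∫⁻ y, G y := by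
        gcongr
        have h3 : |(a ^ 2)⁻¹| ≤ 4 := by
          rw [abs_of_nonneg (by positivity), inv_le_comm₀ (by positivity) (by norm_num)]
          nlinarith
        refine (ENNReal.ofReal_le_ofReal h3).trans (by simp)

/-- The point `y + t (x - y)` is a homothety of ratio `1 - t` in `y` and of ratio `t` in `x`. One of
these ratios is at least `1/2`; integrating first in that variable costs a Jacobian factor of at
most `4`. -/
theorem lintegral_segment_le {Q : Set Plane} {G : Plane → ℝ≥0∞} (hG : Measurable G) {t : ℝ} :
    ∫⁻ x in Q, ∫⁻ y in Q, G (y + t • (x - y)) ≤ 4 * (∫⁻ y, G y) * volume Q := by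
  rcases le_total t (1 / 2) with ht | ht
  · calc _ ≤ ∫⁻ x in Q, 4 * ∫⁻ y, G y := by
          refine lintegral_mono fun x => ?_
          refine le_trans (le_of_eq ?_)
            (lintegral_comp_homothety_le hG (a := 1 - t) (by linarith) (t • x) Q)
          refine lintegral_congr fun y => ?_
          congr 1
          module
      _ = _ := setLIntegral_const _ _
  · rw [lintegral_lintegral_swap (by
      have : Measurable fun p : Plane × Plane => G (p.2 + t • (p.1 - p.2)) := by fun_prop
      exact this.aemeasurable)]
    calc _ ≤ ∫⁻ y in Q, 4 * ∫⁻ y, G y := by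
          refine lintegral_mono fun y => ?_
          refine le_trans (le_of_eq ?_)
            (lintegral_comp_homothety_le hG (a := t) (by linarith) ((1 - t) • y) Q)
          refine lintegral_congr fun x => ?_
          congr 1
          module
      _ = _ := setLIntegral_const _ _

theorem lintegral_enorm_sub_sq_le {Q : Set Plane} (hQ : MeasurableSet Q) (hconv : Convex ℝ Q)
    {d : ℝ} (hd : ∀ x ∈ Q, ∀ y ∈ Q, ‖x - y‖ ≤ d) {φ : Plane → ℂ} (hφ : ContDiff ℝ ∞ φ) :
    ∫⁻ x in Q, ∫⁻ y in Q, ‖φ x - φ y‖ₑ ^ 2 ≤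
      ENNReal.ofReal (4 * d ^ 2) * volume Q * ∫⁻ x in Q, ∑ i, ‖pderiv i φ x‖ₑ ^ 2 := by
  set Γ : Plane → ℝ≥0∞ := fun x => ∑ i, ‖pderiv i φ x‖ₑ ^ 2 with hΓ
  have hp : ∀ i, Measurable (pderiv i φ) := fun i => (continuous_pderiv hφ i).measurable
  have hΓm : Measurable Γ := by fun_prop
  have hGm : Measurable (Q.indicator Γ) := hΓm.indicator hQ
  have hpt : ∀ x ∈ Q, ∀ y ∈ Q, ‖φ x - φ y‖ₑ ^ 2 ≤
      ENNReal.ofReal (d ^ 2) * ∫⁻ t in Ioc (0 : ℝ) 1, Q.indicator Γ (y + t • (x - y)) := by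
    intro x hx y hy
    have h1 := enorm_sub_sq_le (hasDerivAt_line hφ y (x - y))
      (by have := (contDiff_lineD hφ (x - y)).continuous; fun_prop) (zero_le_one' ℝ)
    rw [one_smul, zero_smul, add_zero, add_sub_cancel, sub_zero, ENNReal.ofReal_one, one_mul] at h1
    rw [← lintegral_const_mul _ (by fun_prop)]
    refine h1.trans (setLIntegral_mono (by fun_prop) fun t ht => ?_)
    have hmem : y + t • (x - y) ∈ Q := hconv.add_smul_sub_mem hy hx (Ioc_subset_Icc_self ht)
    rw [indicator_of_mem hmem]
    refine (lineD_sq_le _ _).trans ?_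
    gcongr
    exact hd x hx y hy
  have hm3 : Measurable fun p : (Plane × Plane) × ℝ =>
      Q.indicator Γ (p.1.2 + p.2 • (p.1.1 - p.1.2)) := hGm.comp (by fun_prop)
  have hm2 : Measurable fun p : Plane × Plane =>
      ∫⁻ t in Ioc (0 : ℝ) 1, Q.indicator Γ (p.2 + t • (p.1 - p.2)) := hm3.lintegral_prod_right'
  calc _ ≤ ∫⁻ x in Q, ∫⁻ y in Q, ENNReal.ofReal (d ^ 2) *
        ∫⁻ t in Ioc (0 : ℝ) 1, Q.indicator Γ (y + t • (x - y)) := by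
        refine setLIntegral_mono' hQ fun x hx => setLIntegral_mono' hQ fun y hy => hpt x hx y hy
    _ = ENNReal.ofReal (d ^ 2) * ∫⁻ x in Q, ∫⁻ y in Q,
        ∫⁻ t in Ioc (0 : ℝ) 1, Q.indicator Γ (y + t • (x - y)) := by
        rw [← lintegral_const_mul _ (hm2.lintegral_prod_right')]
        refine lintegral_congr fun x => ?_
        exact lintegral_const_mul _ (hm2.comp (measurable_const.prodMk measurable_id))
    _ = ENNReal.ofReal (d ^ 2) * ∫⁻ t in Ioc (0 : ℝ) 1, ∫⁻ x in Q, ∫⁻ y in Q,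
        Q.indicator Γ (y + t • (x - y)) := by
        congr 1
        have e1 : ∀ x, ∫⁻ y in Q, ∫⁻ t in Ioc (0 : ℝ) 1, Q.indicator Γ (y + t • (x - y)) =
            ∫⁻ t in Ioc (0 : ℝ) 1, ∫⁻ y in Q, Q.indicator Γ (y + t • (x - y)) := fun x =>
          lintegral_lintegral_swap (by
            have : Measurable fun p : Plane × ℝ => Q.indicator Γ (p.1 + p.2 • (x - p.1)) :=
              hGm.comp (by fun_prop)
            exact this.aemeasurable)
        simp only [e1]
        refine lintegral_lintegral_swap ?_
        have : Measurable fun p : (Plane × ℝ) × Plane =>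
            Q.indicator Γ (p.2 + p.1.2 • (p.1.1 - p.2)) := hGm.comp (by fun_prop)
        exact this.lintegral_prod_right'.aemeasurable
    _ ≤ ENNReal.ofReal (d ^ 2) * ∫⁻ t in Ioc (0 : ℝ) 1, 4 * (∫⁻ y in Q, Γ y) * volume Q := by
        gcongr with t
        rw [← lintegral_indicator hQ Γ]
        exact lintegral_segment_le hGm
    _ = _ := by
        rw [setLIntegral_const, Real.volume_Ioc, sub_zero, ENNReal.ofReal_one, mul_one,
          ENNReal.ofReal_mul (by norm_num)]
        simp only [ENNReal.ofReal_ofNat]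
        ring

theorem enorm_ofReal (r : ℝ) : ‖(r : ℂ)‖ₑ = ‖r‖ₑ := by
  rw [← ofReal_norm, ← ofReal_norm, Complex.norm_real]

theorem poincare_inequality {Q : Set Plane} (hQ : MeasurableSet Q) (hconv : Convex ℝ Q)
    (hfin : volume Q ≠ ⊤) {d : ℝ} (hd : ∀ x ∈ Q, ∀ y ∈ Q, ‖x - y‖ ≤ d) {φ : Plane → ℂ}
    (hφ : ContDiff ℝ ∞ φ) (hc : HasCompactSupport φ) :
    ∫⁻ x in Q, ‖φ x‖ₑ ^ 2 ≤
      ENNReal.ofReal (8 * d ^ 2) * (∫⁻ x in Q, ∑ i, ‖pderiv i φ x‖ₑ ^ 2) +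
        ENNReal.ofReal (2 / (volume Q).toReal) * ‖∫ x in Q, φ x‖ₑ ^ 2 := by
  rcases eq_or_ne (volume Q) 0 with h0 | h0
  · rw [setLIntegral_measure_zero _ _ h0]
    exact zero_le
  rw [ENNReal.ofReal_div_of_pos (ENNReal.toReal_pos h0 hfin), ENNReal.ofReal_toReal hfin,
    ENNReal.ofReal_ofNat]
  set q := volume Q with hq
  have hm := hφ.continuous.measurable
  have hint : Integrable φ (volume.restrict Q) :=
    (hφ.continuous.integrable_of_hasCompactSupport hc).restrict
  have hfinite : IsFiniteMeasure (volume.restrict Q) := ⟨by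
    rw [Measure.restrict_apply_univ]; exact hfin.lt_top⟩
  -- Here `q φ(x)` is split into the integral of `φ(x) - φ(y)` over `y` and the integral of `φ`. The
  -- factor `q²` avoids division in `ℝ≥0∞` and is cancelled at the end.
  have hpt : ∀ x, q ^ 2 * ‖φ x‖ₑ ^ 2 ≤
      2 * (q * (∫⁻ y in Q, ‖φ x - φ y‖ₑ ^ 2) + ‖∫ y in Q, φ y‖ₑ ^ 2) := by
    intro x
    have e1 : (q.toReal : ℂ) * φ x = (∫ y in Q, (φ x - φ y)) + ∫ y in Q, φ y := by
      rw [integral_sub (integrable_const _) hint, setIntegral_const, sub_add_cancel]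
      simp [Measure.real, hq]
    have e2 : q ^ 2 * ‖φ x‖ₑ ^ 2 = ‖(q.toReal : ℂ) * φ x‖ₑ ^ 2 := by
      rw [enorm_mul, mul_pow, enorm_ofReal, Real.enorm_of_nonneg ENNReal.toReal_nonneg,
        ENNReal.ofReal_toReal hfin]
    rw [e2, e1]
    refine (enorm_add_sq_le _ _).trans ?_
    gcongr
    calc _ ≤ (∫⁻ y in Q, ‖φ x - φ y‖ₑ) ^ 2 := by
          gcongr; exact enorm_integral_le_lintegral_enorm _
      _ ≤ _ := by
          have := sq_lintegral_mul_le (volume.restrict Q) (f := fun _ => 1)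
            (g := fun y => ‖φ x - φ y‖ₑ) aemeasurable_const (by fun_prop)
          simpa using this
  have hm2 : Measurable fun x => ∫⁻ y in Q, ‖φ x - φ y‖ₑ ^ 2 :=
    Measurable.lintegral_prod_right' (f := fun p : Plane × Plane => ‖φ p.1 - φ p.2‖ₑ ^ 2)
      (by fun_prop)
  set Γ := ∫⁻ x in Q, ∑ i, ‖pderiv i φ x‖ₑ ^ 2
  have hmain : q ^ 2 * ∫⁻ x in Q, ‖φ x‖ₑ ^ 2 ≤
      q ^ 2 * (ENNReal.ofReal (8 * d ^ 2) * Γ + 2 / q * ‖∫ x in Q, φ x‖ₑ ^ 2) := by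
    calc q ^ 2 * ∫⁻ x in Q, ‖φ x‖ₑ ^ 2 = ∫⁻ x in Q, q ^ 2 * ‖φ x‖ₑ ^ 2 :=
          (lintegral_const_mul _ (by fun_prop)).symm
      _ ≤ ∫⁻ x in Q, 2 * (q * (∫⁻ y in Q, ‖φ x - φ y‖ₑ ^ 2) + ‖∫ y in Q, φ y‖ₑ ^ 2) :=
          lintegral_mono hpt
      _ = 2 * (q * (∫⁻ x in Q, ∫⁻ y in Q, ‖φ x - φ y‖ₑ ^ 2) + ‖∫ y in Q, φ y‖ₑ ^ 2 * q) := by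
          rw [lintegral_const_mul _ (by fun_prop), lintegral_add_left (by fun_prop),
            lintegral_const_mul _ hm2, setLIntegral_const]
      _ ≤ 2 * (q * (ENNReal.ofReal (4 * d ^ 2) * q * Γ) + ‖∫ y in Q, φ y‖ₑ ^ 2 * q) := by
          gcongr
          exact lintegral_enorm_sub_sq_le hQ hconv hd hφ
      _ = q ^ 2 * (ENNReal.ofReal (8 * d ^ 2) * Γ) +
            2 * ‖∫ y in Q, φ y‖ₑ ^ 2 * q * (q * q⁻¹) := by
          rw [ENNReal.mul_inv_cancel h0 hfin, show 8 * d ^ 2 = 2 * (4 * d ^ 2) by ring,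
            ENNReal.ofReal_mul (p := 2) (by norm_num)]
          simp only [ENNReal.ofReal_ofNat]
          ring
      _ = _ := by
          rw [ENNReal.div_eq_inv_mul]
          ring
  exact (ENNReal.mul_le_mul_iff_right (pow_ne_zero 2 h0) (ENNReal.pow_ne_top hfin)).1 hmain

/-! ### Approximation by functionals of finite rank -/

/-- The squares of a grid of mesh `η`. -/
def gridSquare (η : ℝ) (k : Fin 2 → ℤ) : Set Plane :=
  {x | ∀ i, x i ∈ Ico (k i * η) ((k i + 1) * η)}

theorem measurableSet_gridSquare (η : ℝ) (k : Fin 2 → ℤ) : MeasurableSet (gridSquare η k) := by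
  have : gridSquare η k = ⋂ i, (fun x : Plane => x i) ⁻¹' Ico (k i * η) ((k i + 1) * η) := by
    ext x
    simp [gridSquare]
  rw [this]
  exact MeasurableSet.iInter fun i =>
    (PiLp.continuous_apply 2 _ i).measurable measurableSet_Ico

theorem convex_gridSquare (η : ℝ) (k : Fin 2 → ℤ) : Convex ℝ (gridSquare η k) := by
  intro x hx y hy a b ha hb hab i
  have := convex_Ico (k i * η) ((k i + 1) * η) (hx i) (hy i) ha hb hab
  simpa using this

theorem norm_sub_le_of_mem_gridSquare {η : ℝ} {k : Fin 2 → ℤ} {x y : Plane}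
    (hx : x ∈ gridSquare η k) (hy : y ∈ gridSquare η k) : ‖x - y‖ ≤ 2 * η := by
  have h : ∀ i, |(x - y) i| ≤ η := fun i => by
    have h1 := hx i
    have h2 := hy i
    rw [mem_Ico, add_mul, one_mul] at h1 h2
    rw [PiLp.sub_apply, abs_le]
    constructor <;> linarith [h1.1, h1.2, h2.1, h2.2]
  have hη : 0 ≤ η := (abs_nonneg _).trans (h 0)
  rw [EuclideanSpace.norm_eq, Fin.sum_univ_two]
  refine Real.sqrt_le_iff.2 ⟨by linarith, ?_⟩
  rw [Real.norm_eq_abs, Real.norm_eq_abs]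
  have h0 := pow_le_pow_left₀ (abs_nonneg _) (h 0) 2
  have h1 := pow_le_pow_left₀ (abs_nonneg _) (h 1) 2
  nlinarith

theorem mem_gridSquare_floor {η : ℝ} (hη : 0 < η) (x : Plane) :
    x ∈ gridSquare η fun i => ⌊x i / η⌋ := fun i => by
  constructor
  · exact (le_div_iff₀ hη).1 (Int.floor_le _)
  · exact (div_lt_iff₀ hη).1 (Int.lt_floor_add_one _)

theorem floor_eq_of_mem_gridSquare {η : ℝ} (hη : 0 < η) {x : Plane} {k : Fin 2 → ℤ}
    (hx : x ∈ gridSquare η k) : k = fun i => ⌊x i / η⌋ := by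
  funext i
  refine (Int.floor_eq_iff.2 ⟨(le_div_iff₀ hη).2 (hx i).1, (div_lt_iff₀ hη).2 (hx i).2⟩).symm

theorem volume_gridSquare_ne_top (η : ℝ) (k : Fin 2 → ℤ) : volume (gridSquare η k) ≠ ⊤ := by
  rcases (gridSquare η k).eq_empty_or_nonempty with h | ⟨x, hx⟩
  · rw [h, measure_empty]; exact ENNReal.zero_ne_top
  · refine ne_top_of_le_ne_top (measure_closedBall_lt_top (x := x) (r := 2 * η)).ne
      (measure_mono fun y hy => ?_)
    rw [Metric.mem_closedBall, dist_eq_norm]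
    exact norm_sub_le_of_mem_gridSquare hy hx

theorem finite_gridSquare_inter {η : ℝ} (hη : 0 < η) {K : Set Plane} (hK : Bornology.IsBounded K) :
    {k | (gridSquare η k ∩ K).Nonempty}.Finite := by
  obtain ⟨R, hR⟩ := hK.subset_closedBall 0
  refine (Set.finite_Icc (fun _ : Fin 2 => ⌊-R / η⌋) (fun _ => ⌊R / η⌋)).subset ?_
  rintro k ⟨x, hx, hxK⟩
  rw [floor_eq_of_mem_gridSquare hη hx]
  have h1 : ∀ i, |x i| ≤ R := fun i => by
    have := hR hxK
    rw [mem_closedBall_zero_iff] at this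
    exact (PiLp.norm_apply_le x i).trans this
  constructor
  · intro i
    exact Int.floor_le_floor (div_le_div_of_nonneg_right (abs_le.1 (h1 i)).1 hη.le)
  · intro i
    exact Int.floor_le_floor (div_le_div_of_nonneg_right (abs_le.1 (h1 i)).2 hη.le)

/-- The indicator is scaled so that this functional reproduces exactly the mean-value term of
`poincare_inequality`. -/
theorem enorm_inner_indicator_sq {U Q : Set Plane} (hQ : MeasurableSet Q) (hfin : volume Q ≠ ⊤)
    (hQU : Q ⊆ U) {φ : Plane → ℂ} (hφ : ContDiff ℝ ∞ φ) (hc : HasCompactSupport φ) :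
    ‖inner ℂ (indicatorConstLp 2 hQ (ne_top_of_le_ne_top hfin (Measure.restrict_apply_le U Q))
      (Real.sqrt (2 / (volume Q).toReal) : ℂ)) (H2.val (toH2 U hφ hc))‖ₑ ^ 2 =
      ENNReal.ofReal (2 / (volume Q).toReal) * ‖∫ x in Q, φ x‖ₑ ^ 2 := by
  rw [L2.inner_indicatorConstLp_eq_inner_setIntegral, Measure.restrict_restrict hQ,
    inter_eq_left.2 hQU]
  have h1 : ∫ x in Q, H2.val (toH2 U hφ hc) x = ∫ x in Q, φ x :=
    integral_congr_ae (ae_restrict_of_ae_restrict_of_subset hQU (coeFn_toH2 hφ hc (.inl ())))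
  rw [h1, RCLike.inner_apply, enorm_mul, mul_pow, RCLike.enorm_conj, enorm_ofReal,
    Real.enorm_of_nonneg (Real.sqrt_nonneg _), ← ENNReal.ofReal_pow (Real.sqrt_nonneg _),
    Real.sq_sqrt (by positivity), mul_comm]

/-- On a compact subset, the `L²` norm is controlled by a small multiple of the norm of the
gradient, up to finitely many functionals. -/
theorem exists_finite_rank_bound {K U : Set Plane} (hK : IsCompact K) (hU : IsOpen U)
    (hKU : K ⊆ U) {ε : ℝ} (hε : 0 < ε) :
    ∃ (n : ℕ) (P : L2 U →L[ℂ] EuclideanSpace ℂ (Fin n)), ∀ (φ : Plane → ℂ) (hφ : ContDiff ℝ ∞ φ)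
      (hc : HasCompactSupport φ), ∫⁻ x in K, ‖φ x‖ₑ ^ 2 ≤
        ENNReal.ofReal ε * (∫⁻ x in U, ∑ i, ‖pderiv i φ x‖ₑ ^ 2) +
          ‖P (H2.val (toH2 U hφ hc))‖ₑ ^ 2 := by
  obtain ⟨δ, hδ, hsub⟩ := hK.exists_cthickening_subset_open hU hKU
  -- Two points of a square are at distance at most `2η ≤ δ`, so squares that meet `K` lie in `U`;
  -- and the Poincaré constant `8(2η)² = 32η²` is at most `ε`.
  set η : ℝ := min (δ / 2) (Real.sqrt (ε / 32)) with hη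
  have hη0 : 0 < η := lt_min (by linarith) (Real.sqrt_pos.2 (by linarith))
  have hfin := finite_gridSquare_inter hη0 hK.isBounded
  set s := hfin.toFinset with hs
  have hsU : ∀ k ∈ s, gridSquare η k ⊆ U := by
    intro k hk y hy
    obtain ⟨x, hx, hxK⟩ := hfin.mem_toFinset.1 hk
    refine hsub (Metric.mem_cthickening_of_dist_le y x δ K hxK ?_)
    rw [dist_eq_norm]
    have := norm_sub_le_of_mem_gridSquare hy hx
    have := min_le_left (δ / 2) (Real.sqrt (ε / 32))
    linarith
  let w : (Fin 2 → ℤ) → L2 U := fun k => indicatorConstLp 2 (measurableSet_gridSquare η k)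
    (ne_top_of_le_ne_top (volume_gridSquare_ne_top η k) (Measure.restrict_apply_le U _))
      (Real.sqrt (2 / (volume (gridSquare η k)).toReal) : ℂ)
  let P : L2 U →L[ℂ] EuclideanSpace ℂ (Fin s.card) :=
    (PiLp.continuousLinearEquiv 2 ℂ fun _ : Fin s.card => ℂ).symm.toContinuousLinearMap ∘L
      ContinuousLinearMap.pi fun j => innerSL ℂ (w (s.equivFin.symm j))
  have hP : ∀ f, ‖P f‖ₑ ^ 2 = ∑ k ∈ s, ‖inner ℂ (w k) f‖ₑ ^ 2 := by
    intro f
    have h1 : ‖P f‖ ^ 2 = ∑ j, ‖inner ℂ (w (s.equivFin.symm j)) f‖ ^ 2 :=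
      EuclideanSpace.norm_sq_eq _
    have h2 : ‖P f‖ ^ 2 = ∑ k ∈ s, ‖inner ℂ (w k) f‖ ^ 2 := by
      rw [h1, ← Finset.sum_coe_sort s]
      exact s.equivFin.symm.sum_comp fun k : s => ‖inner ℂ (w k) f‖ ^ 2
    have h3 := congrArg ENNReal.ofReal h2
    rw [ENNReal.ofReal_pow (norm_nonneg _), ofReal_norm,
      ENNReal.ofReal_sum_of_nonneg fun _ _ => sq_nonneg _] at h3
    rw [h3]
    refine Finset.sum_congr rfl fun k _ => ?_
    rw [ENNReal.ofReal_pow (norm_nonneg _), ofReal_norm]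
  refine ⟨s.card, P, fun φ hφ hc => ?_⟩
  rw [hP]
  have hcov : K ⊆ ⋃ k ∈ s, gridSquare η k := fun x hx =>
    mem_iUnion₂.2 ⟨_, hfin.mem_toFinset.2 ⟨x, mem_gridSquare_floor hη0 x, hx⟩,
      mem_gridSquare_floor hη0 x⟩
  have hdisj : Set.PairwiseDisjoint (s : Set (Fin 2 → ℤ)) (gridSquare η) := by
    intro k _ l _ hkl
    rw [Function.onFun, Set.disjoint_left]
    intro x hx hx'
    exact hkl ((floor_eq_of_mem_gridSquare hη0 hx).trans (floor_eq_of_mem_gridSquare hη0 hx').symm)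
  calc _ ≤ ∫⁻ x in ⋃ k ∈ s, gridSquare η k, ‖φ x‖ₑ ^ 2 := lintegral_mono_set hcov
    _ ≤ ∑ k ∈ s, ∫⁻ x in gridSquare η k, ‖φ x‖ₑ ^ 2 := lintegral_biUnion_finset_le _ _ _
    _ ≤ ∑ k ∈ s, (ENNReal.ofReal ε * (∫⁻ x in gridSquare η k, ∑ i, ‖pderiv i φ x‖ₑ ^ 2) +
          ‖inner ℂ (w k) (H2.val (toH2 U hφ hc))‖ₑ ^ 2) := by
        refine Finset.sum_le_sum fun k hk => ?_
        refine (poincare_inequality (measurableSet_gridSquare η k) (convex_gridSquare η k)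
          (volume_gridSquare_ne_top η k) (fun x hx y hy => norm_sub_le_of_mem_gridSquare hx hy)
          hφ hc).trans ?_
        rw [enorm_inner_indicator_sq (measurableSet_gridSquare η k) (volume_gridSquare_ne_top η k)
          (hsU k hk) hφ hc]
        gcongr
        have h1 : η ≤ Real.sqrt (ε / 32) := min_le_right _ _
        have h2 := pow_le_pow_left₀ hη0.le h1 2
        rw [Real.sq_sqrt (by linarith)] at h2
        nlinarith
    _ = ENNReal.ofReal ε * (∫⁻ x in ⋃ k ∈ s, gridSquare η k, ∑ i, ‖pderiv i φ x‖ₑ ^ 2) +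
          ∑ k ∈ s, ‖inner ℂ (w k) (H2.val (toH2 U hφ hc))‖ₑ ^ 2 := by
        rw [Finset.sum_add_distrib, ← Finset.mul_sum,
          lintegral_biUnion_finset hdisj fun k _ => measurableSet_gridSquare η k]
    _ ≤ _ := by
        gcongr
        exact iUnion₂_subset hsU

/-! ### Singular sequences -/

/-- The space of complex test functions on the plane. -/
def testSpace : Submodule ℂ (Plane → ℂ) where
  carrier := {φ | ContDiff ℝ ∞ φ ∧ HasCompactSupport φ}
  zero_mem' := ⟨contDiff_const, HasCompactSupport.zero⟩
  add_mem' := fun ha hb => ⟨ha.1.add hb.1, ha.2.add hb.2⟩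
  smul_mem' := fun c _ ha => ⟨ha.1.const_smul c, ha.2.smul_left (f := fun _ => c)⟩

/-- The partial derivative on test functions. -/
noncomputable def testDeriv (i : Fin 2) : testSpace →ₗ[ℂ] testSpace where
  toFun φ := ⟨pderiv i φ, contDiff_pderiv φ.2.1 i, hasCompactSupport_pderiv φ.2.2 i⟩
  map_add' φ ψ := Subtype.ext (pderiv_add φ.2.1 ψ.2.1 i)
  map_smul' c φ := Subtype.ext (pderiv_smul φ.2.1 c i)

/-- Test functions as elements of `L²(U)`. -/
noncomputable def testToL2 (U : Set Plane) : testSpace →ₗ[ℂ] L2 U where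
  toFun φ := (memLp_of_test φ.2.1 φ.2.2).toLp
  map_add' _ _ := rfl
  map_smul' _ _ := rfl

theorem pderiv_clm_comp {F : Type*} [NormedAddCommGroup F] [NormedSpace ℝ F] {φ : Plane → ℂ}
    (hφ : ContDiff ℝ ∞ φ) (T : ℂ →L[ℝ] F) (i : Fin 2) :
    pderiv i (fun x => T (φ x)) = fun x => T (pderiv i φ x) := by
  funext x
  have h := T.hasFDerivAt.comp x (hφ.differentiable (by simp) x).hasFDerivAt
  have h2 : HasFDerivAt (fun x => T (φ x)) _ x := h
  rw [pderiv, h2.fderiv]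
  rfl

/-- Weak derivatives are tested with real functions; splitting into real and imaginary parts passes
to complex inner products. -/
theorem inner_toLp_eq {U : Set Plane} (φ : testSpace) (w : L2 U) :
    inner ℂ (testToL2 U φ) w =
      (∫ x in U, (φ.1 x).re • w x) - Complex.I * ∫ x in U, (φ.1 x).im • w x := by
  have hre : Continuous fun x => (φ.1 x).re := Complex.continuous_re.comp φ.2.1.continuous
  have him : Continuous fun x => (φ.1 x).im := Complex.continuous_im.comp φ.2.1.continuous
  have hrec : HasCompactSupport fun x => (φ.1 x).re := φ.2.2.comp_left (g := Complex.re) rfl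
  have himc : HasCompactSupport fun x => (φ.1 x).im := φ.2.2.comp_left (g := Complex.im) rfl
  rw [L2.inner_def, ← integral_const_mul, ← integral_sub (integrable_smul_L2 hre hrec w)
    ((integrable_smul_L2 him himc w).const_mul _)]
  refine integral_congr_ae ?_
  filter_upwards [(memLp_of_test (U := U) φ.2.1 φ.2.2).coeFn_toLp] with x hx
  have hx' : (testToL2 U φ) x = φ.1 x := hx
  rw [hx', RCLike.inner_apply]
  apply Complex.ext <;> simp <;> ring

/-- Integration by parts against complex test functions. -/
theorem IsWeakPartial.inner_eq {U : Set Plane} {i : Fin 2} {u v : L2 U} (h : IsWeakPartial U i u v)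
    (φ : testSpace) (hφ : tsupport φ.1 ⊆ U) :
    inner ℂ v (testToL2 U φ) = - inner ℂ u (testToL2 U (testDeriv i φ)) := by
  have hre : ContDiff ℝ ∞ fun x => (φ.1 x).re := Complex.reCLM.contDiff.comp φ.2.1
  have him : ContDiff ℝ ∞ fun x => (φ.1 x).im := Complex.imCLM.contDiff.comp φ.2.1
  have hrec : HasCompactSupport fun x => (φ.1 x).re := φ.2.2.comp_left (g := Complex.re) rfl
  have himc : HasCompactSupport fun x => (φ.1 x).im := φ.2.2.comp_left (g := Complex.im) rfl
  have e1 := h _ hre hrec ((closure_mono (fun x (hx : (φ.1 x).re ≠ 0) =>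
    (fun hx' => hx (by rw [hx', Complex.zero_re]) : φ.1 x ≠ 0))).trans hφ)
  have e2 := h _ him himc ((closure_mono (fun x (hx : (φ.1 x).im ≠ 0) =>
    (fun hx' => hx (by rw [hx', Complex.zero_im]) : φ.1 x ≠ 0))).trans hφ)
  have d1 : pderiv i (fun x => (φ.1 x).re) = fun x => (pderiv i φ.1 x).re :=
    pderiv_clm_comp φ.2.1 Complex.reCLM i
  have d2 : pderiv i (fun x => (φ.1 x).im) = fun x => (pderiv i φ.1 x).im :=
    pderiv_clm_comp φ.2.1 Complex.imCLM i
  rw [d1] at e1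
  rw [d2] at e2
  rw [← inner_conj_symm, ← inner_conj_symm u, ← map_neg, inner_toLp_eq, inner_toLp_eq]
  congr 1
  have hd : (testDeriv i φ).1 = pderiv i φ.1 := rfl
  rw [hd, e1, e2]
  ring

/-- The expression `Δ² - τ Δ` on test functions. -/
noncomputable def testOp (τ : ℝ) (φ : testSpace) : testSpace :=
  (∑ i, ∑ j, testDeriv i (testDeriv j (testDeriv j (testDeriv i φ)))) -
    (τ : ℂ) • ∑ i, testDeriv i (testDeriv i φ)

theorem tsupport_testDeriv {U : Set Plane} {φ : testSpace} (h : tsupport φ.1 ⊆ U) (i : Fin 2) :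
    tsupport (testDeriv i φ).1 ⊆ U := (tsupport_pderiv_subset i).trans h

/-- A test function supported in the exterior has zero trace, so the form reduces to its volume
terms. Moving the weak derivatives of `v` onto `φ` leaves `Δ²φ - τΔφ`. -/
theorem mem_robinGraph_of_test {Ω : Set Plane} (τ γ : ℝ)
    (htrace : ∀ φ, trace Ω (restrictExt Ω φ) = restrictBoundary Ω φ) (φ : testSpace)
    (hφ : tsupport φ.1 ⊆ extDomain Ω) :
    (testToL2 (extDomain Ω) φ, testToL2 (extDomain Ω) (testOp τ φ)) ∈ robinGraph Ω τ γ := by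
  refine ⟨toH2 (extDomain Ω) φ.2.1 φ.2.2, rfl, fun v => ?_⟩
  have hzero : φ.1 =ᵐ[arcLength Ω] 0 :=
    ae_restrict_of_forall_mem isClosed_frontier.measurableSet fun x hx =>
      image_eq_zero_of_notMem_tsupport fun hx' => hφ hx' (frontier_subset_closure hx)
  have hmem : MemLp φ.1 2 (arcLength Ω) := (memLp_congr_ae hzero).2 MemLp.zero
  have htr : trace Ω (toH2 (extDomain Ω) φ.2.1 φ.2.2) = 0 := by
    have h1 := htrace ⟨φ.1, φ.2.1, φ.2.2, hmem⟩
    refine h1.trans ?_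
    exact (MemLp.toLp_congr hmem MemLp.zero hzero).trans (MemLp.toLp_zero _)
  have hdd : ∀ i j, inner ℂ (H2.dd j i v) (H2.dd j i (toH2 (extDomain Ω) φ.2.1 φ.2.2)) =
      inner ℂ (H2.val v)
        (testToL2 (extDomain Ω) (testDeriv i (testDeriv j (testDeriv j (testDeriv i φ))))) := by
    intro i j
    have h1 := (v.2.2 i j).inner_eq (testDeriv j (testDeriv i φ))
      (tsupport_testDeriv (tsupport_testDeriv hφ i) j)
    have h2 := (v.2.1 i).inner_eq (testDeriv j (testDeriv j (testDeriv i φ)))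
      (tsupport_testDeriv (tsupport_testDeriv (tsupport_testDeriv hφ i) j) j)
    rw [h2, neg_neg] at h1
    exact h1
  have hd : ∀ i, inner ℂ (H2.d i v) (H2.d i (toH2 (extDomain Ω) φ.2.1 φ.2.2)) =
      - inner ℂ (H2.val v) (testToL2 (extDomain Ω) (testDeriv i (testDeriv i φ))) := fun i =>
    (v.2.1 i).inner_eq (testDeriv i φ) (tsupport_testDeriv hφ i)
  simp only [robinForm, hdd, hd, htr, inner_zero_right, mul_zero, add_zero, testOp, map_sub, map_sum,
    map_smul, inner_sub_right, inner_sum, inner_smul_right, Finset.sum_neg_distrib]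
  ring

/-! ### Plane waves with slowly varying amplitude -/

/-- The plane wave `exp (i k x₁)`. -/
noncomputable def planeWave (k : ℝ) (x : Plane) : ℂ := Complex.exp (Complex.I * k * (x 0 : ℂ))

theorem norm_planeWave (k : ℝ) (x : Plane) : ‖planeWave k x‖ = 1 := by
  have : Complex.I * k * (x 0 : ℂ) = ((k * x 0 : ℝ) : ℂ) * Complex.I := by push_cast; ring
  rw [planeWave, this, Complex.norm_exp_ofReal_mul_I]

theorem hasFDerivAt_planeWave (k : ℝ) (x : Plane) :
    HasFDerivAt (planeWave k) (planeWave k x • (Complex.I * k) •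
      (Complex.ofRealCLM ∘L (EuclideanSpace.proj 0 : Plane →L[ℝ] ℝ))) x := by
  have h1 : HasFDerivAt (fun x : Plane => (Complex.I * k) * (x 0 : ℂ)) ((Complex.I * k) •
      (Complex.ofRealCLM ∘L (EuclideanSpace.proj 0 : Plane →L[ℝ] ℝ))) x :=
    (Complex.ofRealCLM ∘L (EuclideanSpace.proj 0 : Plane →L[ℝ] ℝ)).hasFDerivAt.const_mul _
  exact h1.cexp

theorem contDiff_planeWave (k : ℝ) : ContDiff ℝ ∞ (planeWave k) := by
  have h1 : ContDiff ℝ ∞ fun x : Plane => (Complex.I * k) * (x 0 : ℂ) :=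
    contDiff_const.mul (Complex.ofRealCLM ∘L (EuclideanSpace.proj 0 : Plane →L[ℝ] ℝ)).contDiff
  exact h1.cexp

/-- A plane wave with a rescaled amplitude. -/
noncomputable def wavePacket (k : ℝ) (b : Plane) (δ : ℝ) (hδ : δ ≠ 0) :
    testSpace →ₗ[ℂ] testSpace where
  toFun g := ⟨fun x => planeWave k x * g.1 (δ • x - b),
    (contDiff_planeWave k).mul (g.2.1.comp ((contDiff_const_smul δ).sub contDiff_const)),
    HasCompactSupport.mul_left ((g.2.2.comp_homeomorph (Homeomorph.subRight b)).comp_smul hδ)⟩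
  map_add' _ _ := Subtype.ext (funext fun _ => mul_add _ _ _)
  map_smul' c g := Subtype.ext (funext fun x => mul_left_comm (planeWave k x) c (g.1 (δ • x - b)))

/-- The partial derivative of a wave packet, expressed on the amplitude. -/
noncomputable def amplitudeDeriv (k δ : ℝ) (i : Fin 2) : testSpace →ₗ[ℂ] testSpace :=
  (if i = 0 then Complex.I * k else 0) • LinearMap.id + (δ : ℂ) • testDeriv i

theorem testDeriv_wavePacket (k : ℝ) (b : Plane) {δ : ℝ} (hδ : δ ≠ 0) (i : Fin 2) (g : testSpace) :
    testDeriv i (wavePacket k b δ hδ g) = wavePacket k b δ hδ (amplitudeDeriv k δ i g) := by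
  refine Subtype.ext (funext fun x => ?_)
  have h1 : HasFDerivAt (fun x : Plane => g.1 (δ • x - b))
      (fderiv ℝ g.1 (δ • x - b) ∘L (δ • ContinuousLinearMap.id ℝ Plane)) x :=
    (g.2.1.differentiable (by simp) (δ • x - b)).hasFDerivAt.comp x
      (((hasFDerivAt_id x).const_smul δ).sub_const b)
  have h2 := (hasFDerivAt_planeWave k x).mul h1
  have h3 : (testDeriv i (wavePacket k b δ hδ g)).1 x =
      fderiv ℝ (fun x => planeWave k x * g.1 (δ • x - b)) x (EuclideanSpace.single i 1) := rfl
  have h4 : (wavePacket k b δ hδ (amplitudeDeriv k δ i g)).1 x = planeWave k x *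
      ((if i = 0 then Complex.I * k else 0) * g.1 (δ • x - b) +
        (δ : ℂ) * fderiv ℝ g.1 (δ • x - b) (EuclideanSpace.single i 1)) := rfl
  have h5 : fderiv ℝ (fun x => planeWave k x * g.1 (δ • x - b)) x = _ := h2.fderiv
  rw [h3, h4, h5]
  fin_cases i
  · simp
    ring
  · simp

theorem lintegral_comp_affine {G : Plane → ℝ≥0∞} (hG : Measurable G) {δ : ℝ} (hδ : δ ≠ 0)
    (b : Plane) : ∫⁻ x, G (δ • x - b) = ENNReal.ofReal |(δ ^ 2)⁻¹| * ∫⁻ x, G x := by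
  have h1 := Measure.map_addHaar_smul (volume : Measure Plane) hδ
  rw [finrank_euclideanSpace_fin] at h1
  have h2 : ∫⁻ y, G (δ • y - b) = ∫⁻ y, G (y - b) ∂(Measure.map (δ • ·) volume) := by
    rw [lintegral_map (by fun_prop) (measurable_const_smul δ)]
  rw [h2, h1, lintegral_smul_measure, lintegral_sub_right_eq_self, smul_eq_mul]

theorem enorm_testToL2_sq (U : Set Plane) (g : testSpace) :
    ‖testToL2 U g‖ₑ ^ 2 = ∫⁻ x in U, ‖g.1 x‖ₑ ^ 2 := by
  have : ‖testToL2 U g‖ₑ = eLpNorm g.1 2 (volume.restrict U) := 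
    Lp.enorm_toLp (memLp_of_test g.2.1 g.2.2)
  rw [this, eLpNorm_two_sq]

theorem lintegral_wavePacket (k : ℝ) (b : Plane) {δ : ℝ} (hδ : δ ≠ 0) (g : testSpace) :
    ∫⁻ x, ‖(wavePacket k b δ hδ g).1 x‖ₑ ^ 2 =
      ENNReal.ofReal |(δ ^ 2)⁻¹| * ‖testToL2 univ g‖ₑ ^ 2 := by
  rw [enorm_testToL2_sq, Measure.restrict_univ]
  have hm := g.2.1.continuous.measurable
  rw [← lintegral_comp_affine (G := fun x => ‖g.1 x‖ₑ ^ 2) (by fun_prop) hδ b]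
  refine lintegral_congr fun x => ?_
  have h1 : (wavePacket k b δ hδ g).1 x = planeWave k x * g.1 (δ • x - b) := rfl
  have h2 : ‖planeWave k x‖ₑ = 1 := by rw [← ofReal_norm, norm_planeWave, ENNReal.ofReal_one]
  rw [h1, enorm_mul, h2, one_mul]

theorem testOp_wavePacket (τ k : ℝ) (b : Plane) {δ : ℝ} (hδ : δ ≠ 0) (l : ℝ) (g : testSpace) :
    testOp τ (wavePacket k b δ hδ g) - (l : ℂ) • wavePacket k b δ hδ g =
      wavePacket k b δ hδ ((∑ i, ∑ j, amplitudeDeriv k δ i (amplitudeDeriv k δ j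
        (amplitudeDeriv k δ j (amplitudeDeriv k δ i g)))) -
        (τ : ℂ) • (∑ i, amplitudeDeriv k δ i (amplitudeDeriv k δ i g)) - (l : ℂ) • g) := by
  simp only [testOp, testDeriv_wavePacket, map_sub, map_sum, map_smul]

/-- The amplitude of the residual is a polynomial in `δ` with coefficients in `L²`. At `δ = 0` only
the symbol remains, and `(k⁴ + τk² - l) g = 0`. -/
theorem tendsto_amplitude (τ k l : ℝ) (hl : k ^ 4 + τ * k ^ 2 = l) (g : testSpace) :
    Tendsto (fun δ : ℝ => testToL2 univ ((∑ i, ∑ j, amplitudeDeriv k δ i (amplitudeDeriv k δ j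
        (amplitudeDeriv k δ j (amplitudeDeriv k δ i g)))) -
        (τ : ℂ) • (∑ i, amplitudeDeriv k δ i (amplitudeDeriv k δ i g)) - (l : ℂ) • g))
      (𝓝 0) (𝓝 0) := by
  have hc : Continuous (fun δ : ℝ => testToL2 univ ((∑ i, ∑ j, amplitudeDeriv k δ i
      (amplitudeDeriv k δ j (amplitudeDeriv k δ j (amplitudeDeriv k δ i g)))) -
        (τ : ℂ) • (∑ i, amplitudeDeriv k δ i (amplitudeDeriv k δ i g)) - (l : ℂ) • g)) := by
    simp only [amplitudeDeriv, LinearMap.add_apply, LinearMap.smul_apply, LinearMap.id_apply,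
      map_add, map_smul, map_sub, map_sum, smul_add]
    fun_prop
  have h0 := hc.tendsto 0
  have hz : (∑ i, ∑ j, amplitudeDeriv k 0 i
      (amplitudeDeriv k 0 j (amplitudeDeriv k 0 j (amplitudeDeriv k 0 i g)))) -
        (τ : ℂ) • (∑ i, amplitudeDeriv k 0 i (amplitudeDeriv k 0 i g)) - (l : ℂ) • g = 0 := by
    simp only [amplitudeDeriv, Complex.ofReal_zero, zero_smul, add_zero, Fin.sum_univ_two,
      LinearMap.smul_apply, LinearMap.id_apply, if_true, one_ne_zero, if_false, smul_smul,
      zero_mul, mul_zero, ← sub_smul]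
    have hI : Complex.I * k * (Complex.I * k * (Complex.I * k * (Complex.I * k))) -
        τ * (Complex.I * k * (Complex.I * k)) - l = 0 := by
      rw [← hl]
      push_cast
      linear_combination (k ^ 4 * (Complex.I ^ 2 - 1) - τ * k ^ 2 : ℂ) * Complex.I_sq
    rw [hI, zero_smul]
  rwa [hz, map_zero] at h0

theorem exists_frequency {τ l : ℝ} (hl : 0 ≤ l) : ∃ k : ℝ, k ^ 4 + τ * k ^ 2 = l := by
  -- The non-negative root of `s² + τs = l`, to be taken as `k²`.
  set s := (Real.sqrt (τ ^ 2 + 4 * l) - τ) / 2 with hs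
  have h1 : τ ≤ Real.sqrt (τ ^ 2 + 4 * l) := Real.le_sqrt_of_sq_le (by linarith)
  have h2 := Real.sq_sqrt (show 0 ≤ τ ^ 2 + 4 * l by positivity)
  have hs0 : 0 ≤ s := by rw [hs]; linarith
  refine ⟨Real.sqrt s, ?_⟩
  have h3 := Real.sq_sqrt hs0
  rw [show Real.sqrt s ^ 4 = (Real.sqrt s ^ 2) ^ 2 by ring, h3, hs]
  nlinarith

theorem exists_bump : ∃ g : testSpace, testToL2 univ g ≠ 0 ∧
    ∀ x, g.1 x ≠ 0 → x ∈ Metric.closedBall (0 : Plane) 2 := by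
  let B : ContDiffBump (0 : Plane) := ⟨1, 2, one_pos, one_lt_two⟩
  have hs : ContDiff ℝ ∞ fun x => (B x : ℂ) := Complex.ofRealCLM.contDiff.comp B.contDiff
  have hc : HasCompactSupport fun x => (B x : ℂ) :=
    B.hasCompactSupport.comp_left (g := fun t : ℝ => (t : ℂ)) Complex.ofReal_zero
  refine ⟨⟨fun x => (B x : ℂ), hs, hc⟩, fun h0 => ?_, fun x hx => ?_⟩
  · have h0' : (memLp_of_test (U := univ) hs hc).toLp = 0 := h0
    have h1 := (memLp_of_test (U := univ) hs hc).coeFn_toLp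
    rw [h0'] at h1
    have h2 := h1.symm.trans (Lp.coeFn_zero ℂ 2 (volume.restrict univ))
    rw [Measure.restrict_univ] at h2
    have h3 := (hs.continuous.ae_eq_iff_eq volume continuous_const).1 h2
    have h4 : ((B 0 : ℝ) : ℂ) = 0 := congrFun h3 0
    rw [B.one_of_mem_closedBall (by simp [B.rIn_pos.le]), Complex.ofReal_one] at h4
    exact one_ne_zero h4
  · have h2 : x ∈ Function.support B := fun h0 => hx (by
      change ((B x : ℝ) : ℂ) = 0
      rw [h0, Complex.ofReal_zero])
    rw [B.support_eq] at h2
    exact Metric.ball_subset_closedBall h2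

/-- On the support `‖δx - b‖ ≤ 2`, hence `δ‖x‖ ≥ 1 + |R|`, and `δ ≤ 1` puts `x` outside the ball
that contains `closure Ω`. -/
theorem tsupport_wavePacket_subset {Ω : Set Plane} {R : ℝ}
    (hR : closure Ω ⊆ Metric.closedBall 0 R) (k : ℝ) {b : Plane} (hb : ‖b‖ = 3 + |R|) {δ : ℝ}
    (hδ0 : 0 < δ) (hδ1 : δ ≤ 1) {g : testSpace}
    (hg : ∀ x, g.1 x ≠ 0 → x ∈ Metric.closedBall (0 : Plane) 2) :
    tsupport (wavePacket k b δ hδ0.ne' g).1 ⊆ extDomain Ω := by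
  have h1 : tsupport (wavePacket k b δ hδ0.ne' g).1 ⊆
      (fun x => δ • x - b) ⁻¹' Metric.closedBall 0 2 :=
    closure_minimal (fun x hx => hg _ (right_ne_zero_of_mul hx))
      (Metric.isClosed_closedBall.preimage (by fun_prop))
  intro x hx hxΩ
  have h2 := h1 hx
  rw [mem_preimage, mem_closedBall_zero_iff] at h2
  have h3 := hR hxΩ
  rw [mem_closedBall_zero_iff] at h3
  have h4 : ‖b‖ ≤ ‖δ • x‖ + ‖δ • x - b‖ := by
    have := norm_sub_le (δ • x) (δ • x - b)
    rwa [sub_sub_cancel] at this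
  rw [norm_smul, Real.norm_of_nonneg hδ0.le, hb] at h4
  have h5 : δ * ‖x‖ ≤ 1 * ‖x‖ := by gcongr
  linarith [le_abs_self R]

/-- Rescaling multiplies the squared norms of packet and residual by the same factor `δ⁻²`: exactly
for the packet, which lives in the exterior, and as an upper bound for the residual. The ratio is
thus governed by the amplitudes and is small for small `δ`. -/
theorem exists_singular_sequence {Ω : Set Plane} (hb : Bornology.IsBounded Ω) (τ γ : ℝ)
    (htrace : ∀ φ, trace Ω (restrictExt Ω φ) = restrictBoundary Ω φ) {l : ℝ} (hl : 0 ≤ l)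
    {ε : ℝ} (hε : 0 < ε) :
    ∃ p ∈ robinGraph Ω τ γ, p.1 ≠ 0 ∧ ‖p.2 - (l : ℂ) • p.1‖ ≤ ε * ‖p.1‖ := by
  obtain ⟨k, hk⟩ := exists_frequency (τ := τ) hl
  obtain ⟨R, hR⟩ := hb.closure.subset_closedBall 0
  obtain ⟨g, hg0, hg⟩ := exists_bump
  have hgpos : 0 < ‖testToL2 univ g‖ := norm_pos_iff.2 hg0
  have hev := (tendsto_amplitude τ k l hk g).norm.eventually
    (Iic_mem_nhds (by rw [norm_zero]; positivity : ‖(0 : L2 univ)‖ < ε * ‖testToL2 univ g‖))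
  obtain ⟨d, hd, hball⟩ := Metric.eventually_nhds_iff.1 hev
  obtain ⟨δ, hδ0, hδ1, hδd⟩ : ∃ δ : ℝ, 0 < δ ∧ δ ≤ 1 ∧ δ < d :=
    ⟨min 1 (d / 2), lt_min one_pos (by linarith), min_le_left _ _,
      (min_le_right _ _).trans_lt (by linarith)⟩
  have hsmall := @hball δ (by rwa [dist_zero_right, Real.norm_of_nonneg hδ0.le])
  obtain ⟨b, hbn⟩ : ∃ b : Plane, ‖b‖ = 3 + |R| := ⟨EuclideanSpace.single 0 (3 + |R|), by
    rw [PiLp.norm_single, Real.norm_of_nonneg (by positivity)]⟩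
  have hsupp := tsupport_wavePacket_subset hR k hbn hδ0 hδ1 hg
  set φ := wavePacket k b δ hδ0.ne' g with hφ
  have hnorm : ∀ f : testSpace, ‖testToL2 (extDomain Ω) (wavePacket k b δ hδ0.ne' f)‖ₑ ^ 2 ≤
      ENNReal.ofReal |(δ ^ 2)⁻¹| * ‖testToL2 univ f‖ₑ ^ 2 := by
    intro f
    rw [enorm_testToL2_sq, ← lintegral_wavePacket k b hδ0.ne']
    exact setLIntegral_le_lintegral _ _
  have hnorm_eq : ‖testToL2 (extDomain Ω) φ‖ₑ ^ 2 =
      ENNReal.ofReal |(δ ^ 2)⁻¹| * ‖testToL2 univ g‖ₑ ^ 2 := by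
    rw [enorm_testToL2_sq, ← lintegral_wavePacket k b hδ0.ne',
      ← lintegral_indicator (isOpen_extDomain Ω).measurableSet]
    refine lintegral_congr fun x => ?_
    by_cases hx : x ∈ extDomain Ω
    · rw [indicator_of_mem hx]
    · rw [indicator_of_notMem hx]
      have : φ.1 x = 0 := image_eq_zero_of_notMem_tsupport fun h => hx (hsupp h)
      rw [hφ] at this
      rw [this]
      simp
  have toReal : ∀ {E : Type} [NormedAddCommGroup E] (f : E), (‖f‖ₑ ^ 2).toReal = ‖f‖ ^ 2 := by
    intro E _ f
    rw [ENNReal.toReal_pow, toReal_enorm]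
  set a := |(δ ^ 2)⁻¹| with ha
  have ha0 : 0 < a := abs_pos.2 (inv_ne_zero (pow_ne_zero 2 hδ0.ne'))
  have hreal : ∀ f : testSpace, ‖testToL2 (extDomain Ω) (wavePacket k b δ hδ0.ne' f)‖ ^ 2 ≤
      a * ‖testToL2 univ f‖ ^ 2 := by
    intro f
    have := ENNReal.toReal_mono (ENNReal.mul_ne_top ENNReal.ofReal_ne_top
      (ENNReal.pow_ne_top enorm_ne_top)) (hnorm f)
    rwa [ENNReal.toReal_mul, toReal, toReal, ENNReal.toReal_ofReal ha0.le] at this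
  have hreal_eq : ‖testToL2 (extDomain Ω) φ‖ ^ 2 = a * ‖testToL2 univ g‖ ^ 2 := by
    have := congrArg ENNReal.toReal hnorm_eq
    rwa [ENNReal.toReal_mul, toReal, toReal, ENNReal.toReal_ofReal ha0.le] at this
  refine ⟨_, mem_robinGraph_of_test τ γ htrace φ hsupp, ?_, ?_⟩
  · dsimp only
    rw [← norm_pos_iff]
    have : 0 < ‖testToL2 (extDomain Ω) φ‖ ^ 2 := by rw [hreal_eq]; positivity
    exact (norm_nonneg _).lt_of_ne' fun h => by simp [h] at this
  · dsimp only
    rw [← map_smul, ← map_sub, hφ, testOp_wavePacket, ← hφ]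
    refine le_of_sq_le_sq ?_ (by positivity)
    refine (hreal _).trans ?_
    rw [mul_pow, hreal_eq]
    have h5 := pow_le_pow_left₀ (norm_nonneg _) hsmall 2
    rw [mul_pow] at h5
    calc _ ≤ a * (ε ^ 2 * ‖testToL2 univ g‖ ^ 2) := by gcongr
      _ = _ := by ring

/-! ### The Sobolev space as a Hilbert space -/

theorem eq_zero_of_forall_integral_smul {U : Set Plane} (hU : IsOpen U) {w : L2 U}
    (h : ∀ φ : Plane → ℝ, ContDiff ℝ ∞ φ → HasCompactSupport φ → tsupport φ ⊆ U →
      ∫ x in U, φ x • w x = 0) : w = 0 := by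
  have h1 := hU.ae_eq_zero_of_integral_contDiff_smul_eq_zero
    ((Lp.memLp w).locallyIntegrable one_le_two |>.locallyIntegrableOn U) h
  refine Lp.ext ?_
  filter_upwards [h1, ae_restrict_mem hU.measurableSet, Lp.coeFn_zero ℂ 2 (volume.restrict U)]
    with x hx hxU h0
  rw [hx hxU, h0, Pi.zero_apply]

/-- A real test function as a complex one. -/
noncomputable def ofRealTest {φ : Plane → ℝ} (h : ContDiff ℝ ∞ φ) (hc : HasCompactSupport φ) :
    testSpace :=
  ⟨fun x => (φ x : ℂ), Complex.ofRealCLM.contDiff.comp h,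
    hc.comp_left (g := fun t : ℝ => (t : ℂ)) Complex.ofReal_zero⟩

theorem integral_smul_eq_inner {U : Set Plane} {φ : Plane → ℝ} (h : ContDiff ℝ ∞ φ)
    (hc : HasCompactSupport φ) (w : L2 U) :
    ∫ x in U, φ x • w x = inner ℂ (testToL2 U (ofRealTest h hc)) w := by
  rw [inner_toLp_eq]
  have h2 : ∀ x, ((ofRealTest h hc).1 x).im = 0 := fun x => Complex.ofReal_im _
  have h1 : ∀ x, ((ofRealTest h hc).1 x).re = φ x := fun x => Complex.ofReal_re _
  simp only [h1, h2, zero_smul, integral_zero, mul_zero, sub_zero]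

theorem IsWeakPartial.eq_zero {U : Set Plane} (hU : IsOpen U) {i : Fin 2} {v : L2 U}
    (h : IsWeakPartial U i 0 v) : v = 0 := by
  refine eq_zero_of_forall_integral_smul hU fun φ h1 h2 h3 => ?_
  have h4 := h φ h1 h2 h3
  rw [integral_smul_eq_inner (contDiff_pderiv h1 i) (hasCompactSupport_pderiv h2 i),
    inner_zero_right, eq_comm, neg_eq_zero] at h4
  exact h4

/-- For each test function the defining identity is an equality of inner products, hence a closed
condition. This gives completeness of `H²`. -/
theorem isClosed_setOf_isWeakPartial {X : Type*} [TopologicalSpace X] {U : Set Plane} (i : Fin 2)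
    {f g : X → L2 U} (hf : Continuous f) (hg : Continuous g) :
    IsClosed {x | IsWeakPartial U i (f x) (g x)} := by
  simp only [IsWeakPartial, ofPred_forall]
  refine isClosed_iInter fun φ => isClosed_iInter fun h1 => isClosed_iInter fun h2 =>
    isClosed_iInter fun _ => ?_
  simp only [integral_smul_eq_inner (contDiff_pderiv h1 i) (hasCompactSupport_pderiv h2 i),
    integral_smul_eq_inner h1 h2]
  exact isClosed_eq (continuous_const.inner hf) (continuous_const.inner hg).neg

theorem isClosed_H2 (U : Set Plane) : IsClosed (H2 U : Set (PiLp 2 fun _ : Jet => L2 U)) := by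
  have hc : ∀ k : Jet, Continuous fun w : PiLp 2 (fun _ : Jet => L2 U) => w k := fun k =>
    PiLp.continuous_apply 2 _ k
  have : (H2 U : Set (PiLp 2 fun _ : Jet => L2 U)) =
      (⋂ i, {w | IsWeakPartial U i (w (.inl ())) (w (.inr (.inl i)))}) ∩
      ⋂ i, ⋂ j, {w | IsWeakPartial U j (w (.inr (.inl i))) (w (.inr (.inr (i, j))))} := by
    ext w
    simp only [mem_inter_iff, mem_iInter]
    rfl
  rw [this]
  exact (isClosed_iInter fun i => isClosed_setOf_isWeakPartial i (hc _) (hc _)).inter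
    (isClosed_iInter fun i => isClosed_iInter fun j =>
      isClosed_setOf_isWeakPartial j (hc _) (hc _))

instance completeSpace_H2 (U : Set Plane) : CompleteSpace (H2 U) :=
  (isClosed_H2 U).completeSpace_coe

/-- The components of an element of `H²(U)`, as bounded operators. -/
noncomputable def H2.component {U : Set Plane} (k : Jet) : H2 U →L[ℂ] L2 U :=
  PiLp.proj 2 (fun _ : Jet => L2 U) k ∘L (H2 U).subtypeL

/-- The squared norm of the gradient. -/
noncomputable def H2.gradSq {U : Set Plane} (u : H2 U) : ℝ := ∑ i, ‖H2.d i u‖ ^ 2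

/-- The squared norm of the Hessian. -/
noncomputable def H2.hessSq {U : Set Plane} (u : H2 U) : ℝ := ∑ i, ∑ j, ‖H2.dd j i u‖ ^ 2

theorem H2.gradSq_nonneg {U : Set Plane} (u : H2 U) : 0 ≤ H2.gradSq u :=
  Finset.sum_nonneg fun _ _ => sq_nonneg _

theorem H2.hessSq_nonneg {U : Set Plane} (u : H2 U) : 0 ≤ H2.hessSq u :=
  Finset.sum_nonneg fun _ _ => Finset.sum_nonneg fun _ _ => sq_nonneg _

theorem H2.norm_sq {U : Set Plane} (u : H2 U) :
    ‖u‖ ^ 2 = ‖H2.val u‖ ^ 2 + (H2.gradSq u + H2.hessSq u) := by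
  have h : ‖u‖ = ‖u.1‖ := rfl
  rw [h, PiLp.norm_sq_eq_of_L2, Fintype.sum_sum_type, Fintype.sum_sum_type,
    Fintype.sum_prod_type]
  simp [H2.val, H2.gradSq, H2.hessSq, H2.d, H2.dd]

theorem H2.continuous_component {U : Set Plane} (k : Jet) : Continuous fun u : H2 U => u.1 k :=
  (H2.component k).continuous

theorem H2.continuous_val {U : Set Plane} : Continuous (H2.val (U := U)) :=
  H2.continuous_component _

theorem H2.continuous_gradSq {U : Set Plane} : Continuous (H2.gradSq (U := U)) :=
  continuous_finsetSum _ fun _ _ => (H2.continuous_component _).norm.pow 2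

theorem H2.continuous_hessSq {U : Set Plane} : Continuous (H2.hessSq (U := U)) :=
  continuous_finsetSum _ fun _ _ => continuous_finsetSum _ fun _ _ =>
    (H2.continuous_component _).norm.pow 2

theorem H2.val_injective {U : Set Plane} (hU : IsOpen U) :
    Function.Injective (H2.component (U := U) (.inl ())) := by
  refine (injective_iff_map_eq_zero _).2 fun u hu => ?_
  have h0 : u.1 (.inl ()) = 0 := hu
  have h1 : ∀ i, u.1 (.inr (.inl i)) = 0 := fun i => by
    have := u.2.1 i
    rw [h0] at this
    exact this.eq_zero hU
  have h2 : ∀ i j, u.1 (.inr (.inr (i, j))) = 0 := fun i j => by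
    have := u.2.2 i j
    rw [h1] at this
    exact this.eq_zero hU
  refine Subtype.ext (PiLp.ext fun k => ?_)
  rcases k with _ | i | ⟨i, j⟩
  · exact h0
  · exact h1 i
  · exact h2 i j

theorem H2.denseRange_val {U : Set Plane} (hU : IsOpen U) :
    DenseRange (H2.component (U := U) (.inl ())) := by
  have h : (LinearMap.range (H2.component (U := U) (.inl ())).toLinearMap)ᗮ = ⊥ := by
    refine (Submodule.eq_bot_iff _).2 fun w hw => ?_
    refine eq_zero_of_forall_integral_smul hU fun φ h1 h2 _ => ?_
    rw [integral_smul_eq_inner h1 h2]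
    exact (Submodule.mem_orthogonal _ _).1 hw _
      ⟨toH2 U (ofRealTest h1 h2).2.1 (ofRealTest h1 h2).2.2, rfl⟩
  have h2 := (Submodule.topologicalClosure_eq_top_iff).2 h
  exact (Submodule.dense_iff_topologicalClosure_eq_top).2 h2

/-! ### The inequalities on the Sobolev space -/

theorem enorm_sq_eq_ofReal {E : Type*} [NormedAddCommGroup E] (x : E) :
    ‖x‖ₑ ^ 2 = ENNReal.ofReal (‖x‖ ^ 2) := by
  rw [← ofReal_norm, ENNReal.ofReal_pow (norm_nonneg _)]

theorem lintegral_classicalJet_sq {U : Set Plane} {φ : Plane → ℂ} (h : ContDiff ℝ ∞ φ)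
    (hc : HasCompactSupport φ) (k : Jet) :
    ∫⁻ x in U, ‖classicalJet φ k x‖ₑ ^ 2 = ENNReal.ofReal (‖(toH2 U h hc).1 k‖ ^ 2) := by
  rw [← enorm_sq_eq_ofReal, Lp.enorm_def, eLpNorm_congr_ae (coeFn_toH2 h hc k), eLpNorm_two_sq]

theorem lintegral_gradient_sq {U : Set Plane} {φ : Plane → ℂ} (h : ContDiff ℝ ∞ φ)
    (hc : HasCompactSupport φ) :
    ∫⁻ x in U, ∑ i, ‖pderiv i φ x‖ₑ ^ 2 = ENNReal.ofReal (H2.gradSq (toH2 U h hc)) := by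
  rw [lintegral_finsetSum _ fun i _ => by
    have := (continuous_pderiv h i).measurable
    fun_prop]
  rw [H2.gradSq, ENNReal.ofReal_sum_of_nonneg fun _ _ => sq_nonneg _]
  exact Finset.sum_congr rfl fun i _ => lintegral_classicalJet_sq h hc (.inr (.inl i))

theorem lintegral_hessian_sq {U : Set Plane} {φ : Plane → ℂ} (h : ContDiff ℝ ∞ φ)
    (hc : HasCompactSupport φ) :
    ∫⁻ x in U, ∑ i, ∑ j, ‖pderiv j (pderiv i φ) x‖ₑ ^ 2 =
      ENNReal.ofReal (H2.hessSq (toH2 U h hc)) := by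
  have hm : ∀ i j, Measurable fun x => ‖pderiv j (pderiv i φ) x‖ₑ ^ 2 := fun i j => by
    have := (continuous_pderiv (contDiff_pderiv h i) j).measurable
    fun_prop
  rw [lintegral_finsetSum _ fun i _ => Finset.measurable_sum _ fun j _ => hm i j]
  rw [H2.hessSq, ENNReal.ofReal_sum_of_nonneg fun _ _ => Finset.sum_nonneg fun _ _ => sq_nonneg _]
  refine Finset.sum_congr rfl fun i _ => ?_
  rw [lintegral_finsetSum _ fun j _ => hm i j,
    ENNReal.ofReal_sum_of_nonneg fun _ _ => sq_nonneg _]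
  exact Finset.sum_congr rfl fun j _ => lintegral_classicalJet_sq h hc (.inr (.inr (i, j)))

/-! ### Quadratic forms built from bounded operators -/

section FormSum

open ContinuousLinearMap

variable {V H K : Type*} [NormedAddCommGroup V] [InnerProductSpace ℂ V] [CompleteSpace V]
  [NormedAddCommGroup H] [InnerProductSpace ℂ H] [CompleteSpace H]
  [NormedAddCommGroup K] [InnerProductSpace ℂ K] [CompleteSpace K]
  (D₂ : Fin 2 → Fin 2 → V →L[ℂ] H) (D₁ : Fin 2 → V →L[ℂ] H) (T : V →L[ℂ] K) (τ γ : ℝ)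

/-- The operator of the form `∑ ‖D₂ u‖² + τ ∑ ‖D₁ u‖² + γ ‖T u‖²`. -/
noncomputable def formSum : V →L[ℂ] V :=
  (∑ i, ∑ j, adjoint (D₂ i j) ∘L D₂ i j) + (τ : ℂ) • (∑ i, adjoint (D₁ i) ∘L D₁ i) +
    (γ : ℂ) • (adjoint T ∘L T)

theorem inner_formSum (u v : V) :
    inner ℂ v (formSum D₂ D₁ T τ γ u) = (∑ i, ∑ j, inner ℂ (D₂ i j v) (D₂ i j u)) +
      (τ : ℂ) * (∑ i, inner ℂ (D₁ i v) (D₁ i u)) + (γ : ℂ) * inner ℂ (T v) (T u) := by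
  simp only [formSum, add_apply, smul_apply, sum_apply, comp_apply, inner_add_right,
    inner_smul_right, inner_sum, adjoint_inner_right]

theorem isSelfAdjoint_formSum : IsSelfAdjoint (formSum D₂ D₁ T τ γ) := by
  rw [isSelfAdjoint_iff_isSymmetric]
  intro u v
  change inner ℂ (formSum D₂ D₁ T τ γ u) v = inner ℂ u (formSum D₂ D₁ T τ γ v)
  rw [← inner_conj_symm, inner_formSum, inner_formSum]
  simp only [map_add, map_mul, map_sum, inner_conj_symm, Complex.conj_ofReal]

theorem re_inner_formSum_self (u : V) :
    (inner ℂ (formSum D₂ D₁ T τ γ u) u).re =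
      (∑ i, ∑ j, ‖D₂ i j u‖ ^ 2) + τ * (∑ i, ‖D₁ i u‖ ^ 2) + γ * ‖T u‖ ^ 2 := by
  have h : inner ℂ u (formSum D₂ D₁ T τ γ u) =
      (((∑ i, ∑ j, ‖D₂ i j u‖ ^ 2) + τ * (∑ i, ‖D₁ i u‖ ^ 2) + γ * ‖T u‖ ^ 2 : ℝ) : ℂ) := by
    simp only [inner_formSum, inner_self_eq_norm_sq_to_K]
    push_cast
    rfl
  rw [← inner_conj_symm, Complex.conj_re, h, Complex.ofReal_re]

end FormSum

/-! ### Estimates on `H²(Ω^ext)` by density -/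

section Exterior

variable {Ω : Set Plane}

theorem memLp_arcLength [IsFiniteMeasure (arcLength Ω)] {φ : Plane → ℂ} (h : ContDiff ℝ ∞ φ)
    (hc : HasCompactSupport φ) : MemLp φ 2 (arcLength Ω) :=
  h.continuous.memLp_of_hasCompactSupport hc

theorem denseRange_restrictExt_of_c2 (hΩ : IsOpen Ω) (hb : Bornology.IsBounded Ω)
    (hC2 : HasC2Boundary Ω) : DenseRange (restrictExt Ω) := by
  have := (hC2.trace_inequality hΩ hb).1
  exact denseRange_restrictExt hΩ hC2.hasInwardSegments fun φ h hc => memLp_arcLength h hc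

theorem exists_gradSq_le (hΩ : IsOpen Ω) (hb : Bornology.IsBounded Ω) (hC2 : HasC2Boundary Ω) :
    ∃ C : ℝ, 0 ≤ C ∧ ∀ u : H2 (extDomain Ω),
      H2.gradSq u ≤ C * (‖H2.val u‖ ^ 2 + H2.hessSq u) := by
  obtain ⟨C, hC, h⟩ := exists_lintegral_gradient_sq_le hb hC2
  refine ⟨2 * C.toReal, by positivity, fun u => ?_⟩
  refine (denseRange_restrictExt_of_c2 hΩ hb hC2).induction_on u
    (isClosed_le H2.continuous_gradSq (continuous_const.mul
      ((H2.continuous_val.norm.pow 2).add H2.continuous_hessSq))) fun φ => ?_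
  have hcomp : ∀ k, ‖H2.d k (restrictExt Ω φ)‖ ^ 2 ≤
      C.toReal * (‖H2.val (restrictExt Ω φ)‖ ^ 2 + H2.hessSq (restrictExt Ω φ)) := by
    intro k
    have h1 := h φ.1 φ.2.1 k
    have hm : Measurable fun x => ‖φ.1 x‖ₑ ^ 2 := by
      have := φ.2.1.continuous.measurable
      fun_prop
    rw [lintegral_add_left hm, lintegral_hessian_sq φ.2.1 φ.2.2.1] at h1
    have h2 := lintegral_classicalJet_sq (U := extDomain Ω) φ.2.1 φ.2.2.1 (.inl ())
    have h3 := lintegral_classicalJet_sq (U := extDomain Ω) φ.2.1 φ.2.2.1 (.inr (.inl k))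
    simp only [classicalJet] at h2 h3
    rw [h2, h3, ← ENNReal.ofReal_add (sq_nonneg _) (H2.hessSq_nonneg _),
      ← ENNReal.ofReal_toReal hC, ← ENNReal.ofReal_mul ENNReal.toReal_nonneg] at h1
    exact (ENNReal.ofReal_le_ofReal_iff (mul_nonneg ENNReal.toReal_nonneg
      (add_nonneg (sq_nonneg _) (H2.hessSq_nonneg _)))).1 h1
  rw [H2.gradSq, Fin.sum_univ_two]
  linarith [hcomp 0, hcomp 1]

/-- First `δ` is fixed so that the direct gradient term is at most `ε/2`. This fixes `K`, and then
the tolerance `η` of `exists_finite_rank_bound` is chosen so that the gradient term arising on `K`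
is also at most `ε/2`. -/
theorem exists_restrictBoundary_le (hΩ : IsOpen Ω) (hb : Bornology.IsBounded Ω)
    (hC2 : HasC2Boundary Ω) {ε : ℝ} (hε : 0 < ε) :
    ∃ (n : ℕ) (P : L2 (extDomain Ω) →L[ℂ] EuclideanSpace ℂ (Fin n)), ∀ φ : testFun Ω,
      ‖restrictBoundary Ω φ‖ ^ 2 ≤
        ε * H2.gradSq (restrictExt Ω φ) + ‖P (H2.val (restrictExt Ω φ))‖ ^ 2 := by
  obtain ⟨-, C, hC, δ₀, hδ₀, h⟩ := hC2.trace_inequality hΩ hb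
  set c := C.toReal with hc
  have hc0 : 0 ≤ c := ENNReal.toReal_nonneg
  set δ := min δ₀ (ε / (4 * (c + 1))) with hδ
  have hδ0 : 0 < δ := lt_min hδ₀ (by positivity)
  have hδε : c * (2 * δ) ≤ ε / 2 := by
    have h1 : δ ≤ ε / (4 * (c + 1)) := min_le_right _ _
    rw [le_div_iff₀ (by positivity)] at h1
    nlinarith
  obtain ⟨K, hK, hKU, hφ⟩ := h δ ⟨hδ0, min_le_left _ _⟩
  set η := ε * δ / (8 * (c + 1)) with hη
  have hη0 : 0 < η := by positivity
  have hηε : c * (4 / δ * η) ≤ ε / 2 := by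
    have : c * (4 / δ * η) = ε / 2 * (c / (c + 1)) := by
      rw [hη]
      field_simp
      ring
    rw [this]
    have h2 : c / (c + 1) ≤ 1 := (div_le_one (by positivity)).2 (by linarith)
    nlinarith
  obtain ⟨n, P, hP⟩ := exists_finite_rank_bound hK (isOpen_extDomain Ω) hKU hη0
  -- The factor in front of the integral over `K` is absorbed into the finite-rank map.
  refine ⟨n, ((Real.sqrt (c * (4 / δ)) : ℝ) : ℂ) • P, fun φ => ?_⟩
  have h1 := hφ φ.1 φ.2.1
  have h2 := hP φ.1 φ.2.1 φ.2.2.1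
  rw [lintegral_gradient_sq φ.2.1 φ.2.2.1] at h1 h2
  have h3 : ∫⁻ y, ‖φ.1 y‖ₑ ^ 2 ∂(arcLength Ω) = ENNReal.ofReal (‖restrictBoundary Ω φ‖ ^ 2) := by
    rw [← enorm_sq_eq_ofReal, ← eLpNorm_two_sq]
    congr 1
    exact (Lp.enorm_toLp φ.2.2.2).symm
  have hu : toH2 (extDomain Ω) φ.2.1 φ.2.2.1 = restrictExt Ω φ := rfl
  rw [hu] at h1 h2
  set u := restrictExt Ω φ
  have hg := H2.gradSq_nonneg u
  rw [enorm_sq_eq_ofReal, ← ENNReal.ofReal_mul hη0.le, ← ENNReal.ofReal_add (by positivity)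
    (by positivity)] at h2
  have h4 : ENNReal.ofReal (‖restrictBoundary Ω φ‖ ^ 2) ≤ ENNReal.ofReal (c * (4 / δ *
      (η * H2.gradSq u + ‖P (H2.val u)‖ ^ 2) + 2 * δ * H2.gradSq u)) := by
    rw [← h3]
    refine h1.trans ?_
    rw [ENNReal.ofReal_mul hc0, ENNReal.ofReal_toReal hC, ENNReal.ofReal_add (by positivity)
      (by positivity), ENNReal.ofReal_mul (by positivity : 0 ≤ 4 / δ),
      ENNReal.ofReal_mul (by positivity : 0 ≤ 2 * δ)]
    gcongr
  rw [ENNReal.ofReal_le_ofReal_iff (by positivity)] at h4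
  rw [smul_apply, norm_smul, mul_pow, Complex.norm_real, Real.norm_eq_abs,
    sq_abs, Real.sq_sqrt (by positivity)]
  nlinarith [mul_le_mul_of_nonneg_right hδε hg, mul_le_mul_of_nonneg_right hηε hg]

theorem exists_norm_restrictBoundary_le (hΩ : IsOpen Ω) (hb : Bornology.IsBounded Ω)
    (hC2 : HasC2Boundary Ω) : ∃ C, ∀ φ, ‖restrictBoundary Ω φ‖ ≤ C * ‖restrictExt Ω φ‖ := by
  obtain ⟨n, P, h⟩ := exists_restrictBoundary_le hΩ hb hC2 one_pos
  refine ⟨1 + ‖P‖, fun φ => ?_⟩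
  refine le_of_sq_le_sq ?_ (by positivity)
  refine (h φ).trans ?_
  set u := restrictExt Ω φ
  have h1 := H2.norm_sq u
  have h2 := H2.gradSq_nonneg u
  have h3 := H2.hessSq_nonneg u
  have h4 : ‖P (H2.val u)‖ ^ 2 ≤ ‖P‖ ^ 2 * ‖H2.val u‖ ^ 2 := by
    rw [← mul_pow]
    gcongr
    exact P.le_opNorm _
  have h5 : ‖P‖ ^ 2 * ‖H2.val u‖ ^ 2 ≤ ‖P‖ ^ 2 * ‖u‖ ^ 2 := by
    gcongr _ * ?_
    linarith [sq_nonneg ‖H2.val u‖]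
  have h6 : 0 ≤ ‖P‖ * ‖u‖ ^ 2 := by positivity
  nlinarith [sq_nonneg ‖H2.val u‖]

/-- Density and boundedness are what make `extendOfNorm` an actual extension; from here on `trace`
is the trace. -/
theorem trace_restrictExt (hΩ : IsOpen Ω) (hb : Bornology.IsBounded Ω) (hC2 : HasC2Boundary Ω)
    (φ : testFun Ω) : trace Ω (restrictExt Ω φ) = restrictBoundary Ω φ :=
  LinearMap.extendOfNorm_eq (denseRange_restrictExt_of_c2 hΩ hb hC2)
    (exists_norm_restrictBoundary_le hΩ hb hC2) φ

theorem exists_trace_le (hΩ : IsOpen Ω) (hb : Bornology.IsBounded Ω) (hC2 : HasC2Boundary Ω)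
    {ε : ℝ} (hε : 0 < ε) :
    ∃ (n : ℕ) (P : L2 (extDomain Ω) →L[ℂ] EuclideanSpace ℂ (Fin n)), ∀ u : H2 (extDomain Ω),
      ‖trace Ω u‖ ^ 2 ≤ ε * H2.gradSq u + ‖P (H2.val u)‖ ^ 2 := by
  obtain ⟨n, P, h⟩ := exists_restrictBoundary_le hΩ hb hC2 hε
  refine ⟨n, P, fun u => (denseRange_restrictExt_of_c2 hΩ hb hC2).induction_on u
    (isClosed_le ((trace Ω).continuous.norm.pow 2) ((continuous_const.mul
      H2.continuous_gradSq).add ((P.continuous.comp H2.continuous_val).norm.pow 2))) fun φ => ?_⟩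
  rw [trace_restrictExt hΩ hb hC2]
  exact h φ

/-! ### The operator -/

/-- The bounded operator on `H²(Ω^ext)` that represents the form. -/
noncomputable def formOperator (Ω : Set Plane) (τ γ : ℝ) :
    H2 (extDomain Ω) →L[ℂ] H2 (extDomain Ω) :=
  formSum (fun i j => H2.component (.inr (.inr (i, j)))) (fun i => H2.component (.inr (.inl i)))
    (trace Ω) τ γ

theorem inner_formOperator (τ γ : ℝ) (u v : H2 (extDomain Ω)) :
    inner ℂ v (formOperator Ω τ γ u) = robinForm Ω τ γ u v :=
  inner_formSum _ _ _ τ γ u v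

theorem isSelfAdjoint_formOperator (τ γ : ℝ) : IsSelfAdjoint (formOperator Ω τ γ) :=
  isSelfAdjoint_formSum _ _ _ τ γ

theorem re_inner_formOperator_self (τ γ : ℝ) (u : H2 (extDomain Ω)) :
    (inner ℂ (formOperator Ω τ γ u) u).re =
      H2.hessSq u + τ * H2.gradSq u + γ * ‖trace Ω u‖ ^ 2 :=
  re_inner_formSum_self _ _ _ τ γ u

theorem formData (hΩ : IsOpen Ω) (hb : Bornology.IsBounded Ω) (hC2 : HasC2Boundary Ω) {τ : ℝ}
    (hτ : 0 ≤ τ) (γ : ℝ) :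
    FormData (H2.component (U := extDomain Ω) (.inl ())) (formOperator Ω τ γ)
      (robinGraph Ω τ γ) where
  injective := H2.val_injective (isOpen_extDomain Ω)
  denseRange := H2.denseRange_val (isOpen_extDomain Ω)
  isSelfAdjoint := isSelfAdjoint_formOperator τ γ
  mem_graph p := by
    refine exists_congr fun u => and_congr Iff.rfl ⟨fun h => ext_inner_left ℂ fun v => ?_,
      fun h v => ?_⟩
    · rw [inner_formOperator, h v, ContinuousLinearMap.adjoint_inner_right]
      rfl
    · rw [← inner_formOperator, h, ContinuousLinearMap.adjoint_inner_right]
      rfl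
  garding δ hδ := by
    obtain ⟨C, hC, hgrad⟩ := exists_gradSq_le hΩ hb hC2
    -- Write `A`, `G`, `S` for the squared norms of the function, gradient and Hessian. The trace
    -- tolerance makes the boundary term at least `-m(A + S) - |γ|‖P u‖²`. Since `m ≤ 1/2` and `m ≤
    -- δ/2`, the form plus `δA` plus `|γ|‖P u‖²` still dominates `m(A + S)`, and `A + G + S ≤ (1 +
    -- C)(A + S)` gives the full norm. The tension term is dropped, being non-negative.
    set m := min (1 / 2) (δ / 2) with hm
    have hm0 : 0 < m := lt_min (by norm_num) (by linarith)
    have hm1 : m ≤ 1 / 2 := min_le_left _ _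
    have hm2 : m ≤ δ / 2 := min_le_right _ _
    obtain ⟨n, P, hP⟩ := exists_trace_le hΩ hb hC2
      (show 0 < m / ((|γ| + 1) * (C + 1)) by positivity)
    refine ⟨m / (1 + C), by positivity, n, ((Real.sqrt |γ| : ℝ) : ℂ) • P, fun u => ?_⟩
    have hJ : H2.component (.inl ()) u = H2.val u := rfl
    rw [hJ, smul_apply, norm_smul, mul_pow, Complex.norm_real,
      Real.norm_eq_abs, sq_abs, Real.sq_sqrt (abs_nonneg _),
      re_inner_formOperator_self, H2.norm_sq]
    have h1 := hgrad u
    have h2 := hP u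
    have hg := H2.gradSq_nonneg u
    have hh := H2.hessSq_nonneg u
    have hv := sq_nonneg ‖H2.val u‖
    set A := ‖H2.val u‖ ^ 2
    set G := H2.gradSq u
    set S := H2.hessSq u
    have h3 : -(|γ| * ‖trace Ω u‖ ^ 2) ≤ γ * ‖trace Ω u‖ ^ 2 := by
      nlinarith [neg_abs_le γ, sq_nonneg ‖trace Ω u‖]
    have h4 := mul_le_mul_of_nonneg_left h2 (abs_nonneg γ)
    have h5 : |γ| * (m / ((|γ| + 1) * (C + 1)) * G) ≤ m * (A + S) := by
      have e1 : |γ| * (m / ((|γ| + 1) * (C + 1)) * G) =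
          m * (|γ| / (|γ| + 1)) * (G / (C + 1)) := by field_simp
      have e2 : |γ| / (|γ| + 1) ≤ 1 := (div_le_one (by positivity)).2 (by linarith)
      have e3 : G / (C + 1) ≤ A + S := by
        rw [div_le_iff₀ (by positivity)]
        nlinarith
      rw [e1]
      calc _ ≤ m * 1 * (A + S) := by gcongr
        _ = _ := by ring
    have h6 : m / (1 + C) * (A + (G + S)) ≤ m * (A + S) := by
      rw [div_mul_eq_mul_div, div_le_iff₀ (by positivity), mul_assoc]
      gcongr
      nlinarith
    nlinarith [mul_nonneg hτ hg]

end Exterior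

end RobinBiLaplacian

theorem proposition2p3 (Ω : Set RobinBiLaplacian.Plane)
    (hΩ_open : IsOpen Ω) (hΩ_bounded : Bornology.IsBounded Ω)
    (hΩ_simply_connected : IsSimplyConnected Ω)
    (hΩ_C2 : RobinBiLaplacian.HasC2Boundary Ω)
    (γ τ : ℝ) (hτ : 0 ≤ τ) :
    IsSelfAdjoint (RobinBiLaplacian.robinBilaplacian Ω τ γ) ∧
      RobinBiLaplacian.essentialSpectrum (RobinBiLaplacian.robinBilaplacian Ω τ γ) =
        Complex.ofReal '' Set.Ici 0 := by
  have D := RobinBiLaplacian.formData hΩ_open hΩ_bounded hΩ_C2 hτ γ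
  exact ⟨D.isSelfAdjoint_toLinearPMap, D.essentialSpectrum_eq fun l hl ε hε =>
    RobinBiLaplacian.exists_singular_sequence hΩ_bounded τ γ
      (RobinBiLaplacian.trace_restrictExt hΩ_open hΩ_bounded hΩ_C2) hl hε⟩
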